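/- Let $N\ge1$, let $\Omega_N$ be the set of normal $N\times N$ complex matrices, and for $h>0$ let $\mu_h$ be the measure on $\Omega_N$ with $$\int_{\Omega_N} F\,d\mu_h=(\pi h)^{-N}\int_{U(N)}\int_{\mathbb C^N}F(U^*\operatorname{diag}(d)\,U)\,e^{-\|d\|^2/h}\,dd\,dU ,$$ where $dU$ is the normalized Haar measure and $dd$ the Lebesgue measure. Let $\mathcal H_h$ be the closed linear span of the functions $Z\mapsto Z^k\chi$ ($k\ge0$, $\chi\in\mathbb C^N$) in $L^2_{\mathbb C^N}(\Omega_N,d\mu_h)$, with reproducing kernel $K_h(X,Y)=\sum_{k\ge0}\frac{X^kY^{*k}}{k!\,h^k}$, and put $K_{X,\chi}=K_h(\cdot,X)\chi\in\mathcal H_h$. For a matrix-valued function $\phi$ on $\Omega_N$ let $T^{(h)}_\phi u=P(\phi u)$, where $P:L^2_{\mathbb C^N}(\Omega_N,d\mu_h)\to\mathcal H_h$ is the orthogonal projection, on the domain $\{u\in\mathcal H_h:\phi u\in L^2\}$; products of operators are taken on their natural domains. The Berezin transform of an operator $T$ on $\mathcal H_h$ whose domain contains all $K_{X,\chi}$ is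 the matrix-valued function $\widetilde T(X)=K_h(X,X)^{-1/2}M(X)K_h(X,X)^{-1/2}$ on $\Omega_N$, where $\chi'^*M(X)\chi=\langle TK_{X,\chi},K_{X,\chi'}\rangle$ for all $\chi,\chi'\in\mathbb C^N$. For a function $f(d_1;d_2,\dots,d_N)$ on $\mathbb C\times\mathbb C^{N-1}$ that is symmetric in $d_2,\dots,d_N$, put $$f^\#(U\operatorname{diag}(d)U^*)=U\operatorname{diag}_j\big(f(d_j;d_1,\dots,\widehat{d_j},\dots,d_N)\big)U^*\qquad(U\in U(N),\ d\in\mathbb C^N),$$ and for $u:\mathbb C\to\mathbb C$ put $u^\#(U\operatorname{diag}(d)U^*)=U\operatorname{diag}_j(u(d_j))U^*$. A function $\phi$ on $\Omega_N$ is $U$-invariant if $\phi(UZU^*)=U\phi(Z)U^*$ for all $U\in U(N)$, $Z\in\Omega_N$. **Theorem.** Let $\phi=f^\#$ and $\psi=g^\#$ be smooth $U$-invariant functions on $\Omega_N$ (smooth meaning $f,g\in C^\infty(\mathbb C^N)$, in the real sense), each of which is square-integrable with respect to $\mu_{h_0}$ for some $h_0>0$ (which may depend on the function). Then for all sufficiently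 small $h>0$ all the vectors $K_{X,\chi}$ ($X\in\Omega_N$, $\chi\in\mathbb C^N$) lie in the domains of $T^{(h)}_\phi$ and of $T^{(h)}_\phi T^{(h)}_\psi$, and, for every $X\in\Omega_N$, as $h\searrow0$, $$\widetilde{T^{(h)}_\phi}(X)\approx\sum_{r\ge0}h^r\,(l_r\phi)^\#(X),\qquad \widetilde{T^{(h)}_\phi T^{(h)}_\psi}(X)\approx\sum_{r\ge0}h^r\,m_r(\phi,\psi)^\#(X),$$ where $l_r\phi$ and $m_r(\phi,\psi)$ are the functions on $\mathbb C$ $$l_r\phi(z)=\frac1{r!}(\Delta^rf)(z;0,\dots,0),$$ $$m_r(\phi,\psi)(z)=\frac1{r!}\Big[\Big(\Delta_{(d)}+\Delta_{(e)}+\frac{\partial^2}{\partial\overline d_1\,\partial e_1}\Big)^r f(d)\,g(e)\Big]\Big|_{d=e=(z;0,\dots,0)} ,$$ with $\Delta=\sum_j\partial^2/\partial d_j\partial\overline d_j$. Here $A(h)\approx\sum_r h^ra_r$ means that $A(h)-\sum_{r=0}^m h^ra_r=O(h^{m+1})$ as $h\searrow0$ for every $m\ge0$. -/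

import Mathlib

open MeasureTheory Filter Topology
open scoped Matrix ContDiff

noncomputable section

namespace NormalMatrix

/-- The unitary group `U(N)`. -/
abbrev UN (N : ℕ) : Type := Matrix.unitaryGroup (Fin N) ℂ

/-- The domain `Ω_N` of all normal `N × N` complex matrices. -/
def Omega (N : ℕ) : Type := {Z : Matrix (Fin N) (Fin N) ℂ // Zᴴ * Z = Z * Zᴴ}

instance (N : ℕ) : TopologicalSpace (Omega N) :=
  inferInstanceAs (TopologicalSpace {Z : Matrix (Fin N) (Fin N) ℂ // Zᴴ * Z = Z * Zᴴ})

instance (N : ℕ) : MeasurableSpace (Omega N) := borel _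

instance (N : ℕ) : BorelSpace (Omega N) := ⟨rfl⟩

instance (N : ℕ) : MeasurableSpace (UN N) := borel _

instance (N : ℕ) : BorelSpace (UN N) := ⟨rfl⟩

instance (N : ℕ) : CompactSpace (UN N) := by
  have hc : IsClosed {U : Matrix (Fin N) (Fin N) ℂ | U ∈ Matrix.unitaryGroup (Fin N) ℂ} := by
    have : {U : Matrix (Fin N) (Fin N) ℂ | U ∈ Matrix.unitaryGroup (Fin N) ℂ}
        = {U | U * Uᴴ = 1} := by
      ext U
      simp only [Set.mem_ofPred_eq, Matrix.mem_unitaryGroup_iff, Matrix.star_eq_conjTranspose]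
    rw [this]
    exact isClosed_eq (by fun_prop) continuous_const
  have hb : IsCompact (Set.univ.pi fun _ : Fin N => Set.univ.pi fun _ : Fin N =>
      Metric.closedBall (0 : ℂ) 1) :=
    isCompact_univ_pi fun _ => isCompact_univ_pi fun _ => isCompact_closedBall 0 1
  refine isCompact_iff_compactSpace.mp ?_
  refine IsCompact.of_isClosed_subset hb hc ?_
  intro U hU i _ j _
  simpa using entry_norm_bound_of_unitary hU i j

/-- The normalized Haar measure on `U(N)`. -/
def haarUN (N : ℕ) : Measure (UN N) := Measure.haarMeasure ⊤

/-- `(π h)^{-N} e^{-‖d‖²/h} dd` on `ℂ^N`, with `dd` the Lebesgue measure. -/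
def gaussian (N : ℕ) (h : ℝ) : Measure (Fin N → ℂ) :=
  volume.withDensity fun d =>
    ENNReal.ofReal (((Real.pi * h) ^ N)⁻¹ * Real.exp (-(∑ j, ‖d j‖ ^ 2) / h))

/-- The normal matrix `U diag(d) U*`. -/
def unitaryConj {N : ℕ} (U : UN N) (d : Fin N → ℂ) : Omega N :=
  ⟨(U : Matrix (Fin N) (Fin N) ℂ) * Matrix.diagonal d * (U : Matrix (Fin N) (Fin N) ℂ)ᴴ, by
    have hU : (U : Matrix (Fin N) (Fin N) ℂ)ᴴ * (U : Matrix (Fin N) (Fin N) ℂ) = 1 :=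
      Matrix.UnitaryGroup.star_mul_self U
    have key : ∀ A B : Matrix (Fin N) (Fin N) ℂ,
        ((U : Matrix (Fin N) (Fin N) ℂ) * A * (U : Matrix (Fin N) (Fin N) ℂ)ᴴ)
          * ((U : Matrix (Fin N) (Fin N) ℂ) * B * (U : Matrix (Fin N) (Fin N) ℂ)ᴴ)
        = (U : Matrix (Fin N) (Fin N) ℂ) * (A * B) * (U : Matrix (Fin N) (Fin N) ℂ)ᴴ := by
      intro A B
      calc _ = (U : Matrix (Fin N) (Fin N) ℂ) * A *
            ((U : Matrix (Fin N) (Fin N) ℂ)ᴴ * (U : Matrix (Fin N) (Fin N) ℂ)) * B *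
            (U : Matrix (Fin N) (Fin N) ℂ)ᴴ := by simp only [Matrix.mul_assoc]
        _ = _ := by rw [hU]; simp only [Matrix.mul_assoc, Matrix.mul_one]
    have hs : ((U : Matrix (Fin N) (Fin N) ℂ) * Matrix.diagonal d *
          (U : Matrix (Fin N) (Fin N) ℂ)ᴴ)ᴴ
        = (U : Matrix (Fin N) (Fin N) ℂ) * (Matrix.diagonal d)ᴴ *
          (U : Matrix (Fin N) (Fin N) ℂ)ᴴ := by
      simp only [Matrix.conjTranspose_mul, Matrix.conjTranspose_conjTranspose, Matrix.mul_assoc]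
    rw [hs, key, key, Matrix.diagonal_conjTranspose, Matrix.diagonal_mul_diagonal,
      Matrix.diagonal_mul_diagonal]
    simp only [mul_comm]⟩

/-- The measure `μ_h` on `Ω_N`: the image of Haar measure times the Gaussian under
`(U, d) ↦ U* diag(d) U`. -/
def mu (N : ℕ) (h : ℝ) : Measure (Omega N) :=
  ((haarUN N).prod (gaussian N h)).map fun p => unitaryConj p.1⁻¹ p.2

/-- The Hilbert space `L²_{ℂ^N}(Ω_N, dμ_h)`. -/
abbrev L2 (N : ℕ) (h : ℝ) : Type := Lp (EuclideanSpace ℂ (Fin N)) 2 (mu N h)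

/-- The linear map `v ↦ A v` on column vectors `v ∈ ℂ^N`. -/
abbrev act {N : ℕ} (A : Matrix (Fin N) (Fin N) ℂ) :
    EuclideanSpace ℂ (Fin N) →L[ℂ] EuclideanSpace ℂ (Fin N) := Matrix.toEuclideanCLM (𝕜 := ℂ) A

/-- The space `𝓗_h`: the closed linear span in `L²` of the functions `Z ↦ Z^k χ`. -/
def H (N : ℕ) (h : ℝ) : Submodule ℂ (L2 N h) :=
  (Submodule.span ℂ {u : L2 N h | ∃ (k : ℕ) (χ : EuclideanSpace ℂ (Fin N)),
    (u : Omega N → EuclideanSpace ℂ (Fin N)) =ᵐ[mu N h] fun Z => act (Z.1 ^ k) χ}).topologicalClosure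

instance (N : ℕ) (h : ℝ) : CompleteSpace (H N h) :=
  (Submodule.isClosed_topologicalClosure _).completeSpace_coe

/-- The reproducing kernel `K_h(X, Y) = ∑ₖ X^k Y*^k / (k! h^k)`. -/
def kernel {N : ℕ} (h : ℝ) (X Y : Omega N) : Matrix (Fin N) (Fin N) ℂ :=
  ∑' k : ℕ, ((Nat.factorial k : ℂ) * (h : ℂ) ^ k)⁻¹ • (X.1 ^ k * Y.1ᴴ ^ k)

/-- The space of all `u ∈ L²` such that `φ u ∈ L²`. -/
def mulDomain {N : ℕ} (h : ℝ) (φ : Omega N → Matrix (Fin N) (Fin N) ℂ) :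
    Submodule ℂ (L2 N h) where
  carrier := {u | MemLp (fun Z => act (φ Z) (u Z)) 2 (mu N h)}
  zero_mem' := by
    refine (memLp_congr_ae ?_).mpr (MemLp.zero (ε := EuclideanSpace ℂ (Fin N)))
    filter_upwards [Lp.coeFn_zero (EuclideanSpace ℂ (Fin N)) 2 (mu N h)] with Z hZ
    rw [hZ, Pi.zero_apply, map_zero]
  add_mem' := by
    intro u v hu hv
    refine (memLp_congr_ae ?_).mpr (MemLp.add hu hv)
    filter_upwards [Lp.coeFn_add u v] with Z hZ
    rw [hZ, Pi.add_apply, map_add, Pi.add_apply]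
  smul_mem' := by
    intro c u hu
    refine (memLp_congr_ae ?_).mpr (MemLp.const_smul hu c)
    filter_upwards [Lp.coeFn_smul c u] with Z hZ
    rw [hZ, Pi.smul_apply, map_smul, Pi.smul_apply]

/-- The multiplication operator `u ↦ φ u` in `L²`. -/
def mulOp {N : ℕ} (h : ℝ) (φ : Omega N → Matrix (Fin N) (Fin N) ℂ) :
    mulDomain h φ →ₗ[ℂ] L2 N h where
  toFun u := MemLp.toLp (fun Z => act (φ Z) ((u : L2 N h) Z)) u.2
  map_add' u v := by
    rw [← MemLp.toLp_add u.2 v.2]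
    refine MemLp.toLp_congr _ _ ?_
    filter_upwards [Lp.coeFn_add u.1 v.1] with Z hZ
    rw [Submodule.coe_add, hZ, Pi.add_apply, map_add, Pi.add_apply]
  map_smul' c u := by
    rw [RingHom.id_apply, ← MemLp.toLp_const_smul c u.2]
    refine MemLp.toLp_congr _ _ ?_
    filter_upwards [Lp.coeFn_smul c u.1] with Z hZ
    rw [Submodule.coe_smul, hZ, Pi.smul_apply, map_smul, Pi.smul_apply]

/-- The Toeplitz operator `T_φ u = P(φ u)` on `𝓗_h`, where `P` is the orthogonal projection of `L²`
onto `𝓗_h`, with its natural domain `{u ∈ 𝓗_h | φ u ∈ L²}` (which is all of `𝓗_h` if `φ` is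
measurable and bounded). -/
def toeplitz {N : ℕ} (h : ℝ) (φ : Omega N → Matrix (Fin N) (Fin N) ℂ) :
    H N h →ₗ.[ℂ] H N h where
  domain := (mulDomain h φ).comap (H N h).subtype
  toFun := ((H N h).orthogonalProjectionOnto : L2 N h →ₗ[ℂ] H N h) ∘ₗ mulOp h φ ∘ₗ
    (H N h).subtype.restrict (p := (mulDomain h φ).comap (H N h).subtype) (fun _ hu => hu)

theorem mem_domain_of_mem_map {V : Type*} [AddCommGroup V] [Module ℂ V] {S T : V →ₗ.[ℂ] V} {u : V}
    (hu : u ∈ (S.domain.comap T.toFun).map T.domain.subtype) :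
    ∃ hT : u ∈ T.domain, T ⟨u, hT⟩ ∈ S.domain := by
  obtain ⟨w, hw', rfl⟩ := hu
  exact ⟨w.2, hw'⟩

/-- The product `S T` of two partially defined operators, on its natural domain
`{u ∈ dom T | T u ∈ dom S}`. -/
def opMul {V : Type*} [AddCommGroup V] [Module ℂ V] (S T : V →ₗ.[ℂ] V) : V →ₗ.[ℂ] V where
  domain := (S.domain.comap T.toFun).map T.domain.subtype
  toFun :=
    { toFun := fun u => S ⟨T ⟨u.1, (mem_domain_of_mem_map u.2).1⟩, (mem_domain_of_mem_map u.2).2⟩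
      map_add' := by
        intro u v
        rw [← LinearPMap.map_add]
        congr 1
        apply Subtype.ext
        exact T.map_add ⟨u.1, (mem_domain_of_mem_map u.2).1⟩ ⟨v.1, (mem_domain_of_mem_map v.2).1⟩
      map_smul' := by
        intro c u
        rw [RingHom.id_apply, ← LinearPMap.map_smul]
        congr 1
        apply Subtype.ext
        exact T.map_smul c ⟨u.1, (mem_domain_of_mem_map u.2).1⟩ }

theorem continuous_unitaryConj (N : ℕ) :
    Continuous fun p : UN N × (Fin N → ℂ) => unitaryConj p.1⁻¹ p.2 := by
  refine Continuous.subtype_mk ?_ _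
  have h1 : Continuous fun p : UN N × (Fin N → ℂ) =>
      ((p.1⁻¹ : UN N) : Matrix (Fin N) (Fin N) ℂ) :=
    continuous_subtype_val.comp (continuous_inv.comp continuous_fst)
  exact (h1.mul continuous_snd.matrix_diagonal).mul h1.matrix_conjTranspose

instance (N : ℕ) : IsProbabilityMeasure (haarUN N) :=
  ⟨Measure.haarMeasure_self (K₀ := (⊤ : TopologicalSpace.PositiveCompacts (UN N)))⟩

instance (N : ℕ) (h : ℝ) : SFinite (gaussian N h) := by
  unfold gaussian; infer_instance

theorem continuous_act (N : ℕ) : Continuous (act (N := N)) :=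
  LinearMap.continuous_of_finiteDimensional
    (Matrix.toEuclideanCLM (n := Fin N) (𝕜 := ℂ)).toAlgEquiv.toLinearMap

theorem norm_act_unitaryConj {N : ℕ} (U : UN N) (d : Fin N → ℂ) :
    ‖act (unitaryConj U d).1‖ = ‖d‖ := by
  have hU : act (U : Matrix (Fin N) (Fin N) ℂ) ∈
      unitary (EuclideanSpace ℂ (Fin N) →L[ℂ] EuclideanSpace ℂ (Fin N)) :=
    Unitary.map_mem (Matrix.toEuclideanCLM (n := Fin N) (𝕜 := ℂ)) U.2
  have e : act (unitaryConj U d).1 = act (U : Matrix (Fin N) (Fin N) ℂ) * act (Matrix.diagonal d)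
      * star (act (U : Matrix (Fin N) (Fin N) ℂ)) := by
    simp only [unitaryConj, act, map_mul, ← map_star, Matrix.star_eq_conjTranspose]
  rw [e, CStarRing.norm_mul_mem_unitary _ (Unitary.star_mem hU), CStarRing.norm_mem_unitary_mul _ hU]
  exact Matrix.l2_opNorm_diagonal d

theorem integrable_exp_norm_sq (N : ℕ) {b : ℝ} (hb : 0 < b) :
    Integrable (fun d : Fin N → ℂ => Real.exp (-b * ∑ j, ‖d j‖ ^ 2)) := by
  have h1 : Integrable (fun z : ℂ => Real.exp (-b * ‖z‖ ^ 2)) := by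
    have := (GaussianFourier.integrable_cexp_neg_mul_sq_norm_add (V := ℂ) (b := (b : ℂ))
      (by simpa using hb) 0 0).norm
    refine this.congr (Eventually.of_forall fun z => ?_)
    simp [Complex.norm_exp, ← Complex.ofReal_pow]
  have := Integrable.fintype_prod (f := fun (_ : Fin N) (z : ℂ) => Real.exp (-b * ‖z‖ ^ 2))
    (fun _ => h1)
  refine this.congr (Eventually.of_forall fun d => ?_)
  simp only [← Real.exp_sum, Finset.mul_sum]

theorem memLp_exp (N : ℕ) {h : ℝ} (hh : 0 < h) (a : ℝ) :
    MemLp (fun Z : Omega N => Real.exp (a * ‖act Z.1‖)) 2 (mu N h) := by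
  have hm := (continuous_unitaryConj N).measurable
  have hc : Continuous fun Z : Omega N => Real.exp (a * ‖act Z.1‖) :=
    Real.continuous_exp.comp (continuous_const.mul
      ((continuous_act N).comp continuous_subtype_val).norm)
  unfold mu
  rw [memLp_map_measure_iff hc.aestronglyMeasurable hm.aemeasurable]
  have e : ((fun Z : Omega N => Real.exp (a * ‖act Z.1‖)) ∘
      fun p : UN N × (Fin N → ℂ) => unitaryConj p.1⁻¹ p.2) = fun p => Real.exp (a * ‖p.2‖) := by
    funext p
    simp only [Function.comp, norm_act_unitaryConj]
  rw [e, memLp_two_iff_integrable_sq (by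
    exact (Continuous.aestronglyMeasurable (by fun_prop)))]
  refine Integrable.comp_snd (f := fun d : Fin N → ℂ => Real.exp (a * ‖d‖) ^ 2) ?_ _
  unfold gaussian
  rw [integrable_withDensity_iff_integrable_smul' (by fun_prop) (by simp)]
  have hb : 0 < 1 / (2 * h) := by positivity
  refine ((integrable_exp_norm_sq N hb).const_mul
    (((Real.pi * h) ^ N)⁻¹ * Real.exp (2 * h * a ^ 2))).mono'
    (Measurable.aestronglyMeasurable (by fun_prop)) (Eventually.of_forall fun d => ?_)
  rw [ENNReal.toReal_ofReal (by positivity), smul_eq_mul, Real.norm_of_nonneg (by positivity),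
    mul_assoc, mul_assoc, ← Real.exp_nat_mul, ← Real.exp_add, ← Real.exp_add]
  refine mul_le_mul_of_nonneg_left (Real.exp_le_exp.mpr ?_) (by positivity)
  have hd : ‖d‖ ^ 2 ≤ ∑ j, ‖d j‖ ^ 2 := by
    have h0 : ‖d‖ ≤ Real.sqrt (∑ j, ‖d j‖ ^ 2) := by
      refine (pi_norm_le_iff_of_nonneg (Real.sqrt_nonneg _)).mpr fun j => ?_
      refine Real.le_sqrt_of_sq_le ?_
      exact Finset.single_le_sum (f := fun j => ‖d j‖ ^ 2) (fun _ _ => by positivity)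
        (Finset.mem_univ j)
    calc ‖d‖ ^ 2 ≤ Real.sqrt (∑ j, ‖d j‖ ^ 2) ^ 2 := by gcongr
      _ = _ := Real.sq_sqrt (Finset.sum_nonneg fun _ _ => by positivity)
  set S := ∑ j, ‖d j‖ ^ 2
  have h2 : 2 * (a * ‖d‖) ≤ 2 * h * a ^ 2 + 1 / (2 * h) * ‖d‖ ^ 2 := by
    have := sq_nonneg (2 * h * a - ‖d‖)
    have h3 : 2 * h * a ^ 2 + 1 / (2 * h) * ‖d‖ ^ 2 - 2 * (a * ‖d‖)
        = (2 * h * a - ‖d‖) ^ 2 / (2 * h) := by field_simp; ring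
    have : 0 ≤ (2 * h * a - ‖d‖) ^ 2 / (2 * h) := by positivity
    linarith
  have h4 : 1 / (2 * h) * ‖d‖ ^ 2 ≤ 1 / (2 * h) * S := by gcongr
  have h5 : -S / h = -(1 / (2 * h)) * S - 1 / (2 * h) * S := by field_simp; ring
  rw [h5]
  push_cast
  linarith

/-- The function `Y ↦ K_h(Y, X) χ` on `Ω_N`. -/
def kernelFun {N : ℕ} (h : ℝ) (X : Omega N) (χ : EuclideanSpace ℂ (Fin N)) (Y : Omega N) :
    EuclideanSpace ℂ (Fin N) := act (kernel h Y X) χ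

theorem act_mul_apply {N : ℕ} (A B : Matrix (Fin N) (Fin N) ℂ) (v : EuclideanSpace ℂ (Fin N)) :
    act (A * B) v = act A (act B v) := by
  simp only [act, map_mul, mul_apply_eq_comp]

theorem act_single {N : ℕ} (A : Matrix (Fin N) (Fin N) ℂ) (i j : Fin N) :
    act A (EuclideanSpace.single j 1) i = A i j := by
  have := congrFun (Matrix.ofLp_toEuclideanCLM (𝕜 := ℂ) A (EuclideanSpace.single j 1)) i
  rw [act, this]
  simp

/-- The `k`-th term of the series for `K_h(Y, X) χ`. -/
def kernelTerm {N : ℕ} (h : ℝ) (X : Omega N) (χ : EuclideanSpace ℂ (Fin N)) (k : ℕ)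
    (Y : Omega N) : EuclideanSpace ℂ (Fin N) :=
  act (((Nat.factorial k : ℂ) * (h : ℂ) ^ k)⁻¹ • (Y.1 ^ k * X.1ᴴ ^ k)) χ

theorem kernelTerm_eq {N : ℕ} (h : ℝ) (X : Omega N) (χ : EuclideanSpace ℂ (Fin N)) (k : ℕ)
    (Y : Omega N) : kernelTerm h X χ k Y =
      ((Nat.factorial k : ℂ) * (h : ℂ) ^ k)⁻¹ • act (Y.1 ^ k) (act (X.1ᴴ ^ k) χ) := by
  have : act (((Nat.factorial k : ℂ) * (h : ℂ) ^ k)⁻¹ • (Y.1 ^ k * X.1ᴴ ^ k))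
      = ((Nat.factorial k : ℂ) * (h : ℂ) ^ k)⁻¹ • act (Y.1 ^ k * X.1ᴴ ^ k) := map_smul _ _ _
  rw [kernelTerm, this, smul_apply, act_mul_apply]

theorem norm_act_pow_le {N : ℕ} (A : Matrix (Fin N) (Fin N) ℂ) (k : ℕ)
    (v : EuclideanSpace ℂ (Fin N)) : ‖act (A ^ k) v‖ ≤ ‖act A‖ ^ k * ‖v‖ := by
  have : act (A ^ k) = act A ^ k := map_pow _ _ _
  rw [this]
  rcases Nat.eq_zero_or_pos k with rfl | hk
  · simp
  · exact (ContinuousLinearMap.le_opNorm _ _).trans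
      (mul_le_mul_of_nonneg_right (norm_pow_le' _ hk) (norm_nonneg _))

theorem norm_kernelTerm_le {N : ℕ} {h : ℝ} (hh : 0 < h) (X : Omega N)
    (χ : EuclideanSpace ℂ (Fin N)) (k : ℕ) (Y : Omega N) :
    ‖kernelTerm h X χ k Y‖ ≤ (‖act X.1ᴴ‖ / h * ‖act Y.1‖) ^ k / Nat.factorial k * ‖χ‖ := by
  have h1 : ‖act (Y.1 ^ k) (act (X.1ᴴ ^ k) χ)‖ ≤ ‖act Y.1‖ ^ k * (‖act X.1ᴴ‖ ^ k * ‖χ‖) :=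
    (norm_act_pow_le _ _ _).trans (by gcongr; exact norm_act_pow_le _ _ _)
  have h2 : ‖((Nat.factorial k : ℂ) * (h : ℂ) ^ k)⁻¹‖ = ((Nat.factorial k : ℝ) * h ^ k)⁻¹ := by
    rw [norm_inv, norm_mul, norm_pow, Complex.norm_natCast, Complex.norm_real,
      Real.norm_of_nonneg hh.le]
  rw [kernelTerm_eq, norm_smul, h2]
  calc _ ≤ ((Nat.factorial k : ℝ) * h ^ k)⁻¹ * (‖act Y.1‖ ^ k * (‖act X.1ᴴ‖ ^ k * ‖χ‖)) := by gcongr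
    _ = _ := by
      rw [mul_pow, div_pow]
      field_simp

theorem hasSum_kernelFun {N : ℕ} {h : ℝ} (hh : 0 < h) (X : Omega N)
    (χ : EuclideanSpace ℂ (Fin N)) (Y : Omega N) :
    HasSum (fun k => kernelTerm h X χ k Y) (kernelFun h X χ Y) := by
  have hs : ∀ χ', Summable fun k => kernelTerm h X χ' k Y := fun χ' =>
    Summable.of_norm_bounded ((Real.summable_pow_div_factorial _).mul_right ‖χ'‖)
      (fun k => norm_kernelTerm_le hh X χ' k Y)
  have hm : Summable fun k : ℕ =>
      ((Nat.factorial k : ℂ) * (h : ℂ) ^ k)⁻¹ • (Y.1 ^ k * X.1ᴴ ^ k) := by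
    refine Pi.summable.mpr fun i => Pi.summable.mpr fun j => ?_
    refine ((EuclideanSpace.proj (𝕜 := ℂ) i).summable (hs (EuclideanSpace.single j 1))).congr
      fun k => ?_
    exact act_single _ i j
  let L : Matrix (Fin N) (Fin N) ℂ →ₗ[ℂ] EuclideanSpace ℂ (Fin N) :=
    { toFun := fun A => act A χ
      map_add' := fun A B => by simp only [act, map_add, add_apply]
      map_smul' := fun c A => by
        simp only [act, map_smul, smul_apply, RingHom.id_apply] }
  exact hm.hasSum.map L L.continuous_of_finiteDimensional

theorem tsum_exp_bound (a c : ℝ) :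
    HasSum (fun k : ℕ => a ^ k / Nat.factorial k * c) (Real.exp a * c) := by
  rw [Real.exp_eq_exp_ℝ]
  exact (NormedSpace.expSeries_div_hasSum_exp a).mul_right c

theorem norm_sum_kernelTerm_le {N : ℕ} {h : ℝ} (hh : 0 < h) (X : Omega N)
    (χ : EuclideanSpace ℂ (Fin N)) (n : ℕ) (Y : Omega N) :
    ‖∑ k ∈ Finset.range n, kernelTerm h X χ k Y‖
      ≤ Real.exp (‖act X.1ᴴ‖ / h * ‖act Y.1‖) * ‖χ‖ :=
  (norm_sum_le _ _).trans ((Finset.sum_le_sum fun k _ => norm_kernelTerm_le hh X χ k Y).trans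
    ((tsum_exp_bound (‖act X.1ᴴ‖ / h * ‖act Y.1‖) ‖χ‖).summable.sum_le_tsum _
      (fun k _ => by positivity) |>.trans_eq
      (tsum_exp_bound _ _).tsum_eq))

theorem norm_kernelFun_le {N : ℕ} {h : ℝ} (hh : 0 < h) (X : Omega N)
    (χ : EuclideanSpace ℂ (Fin N)) (Y : Omega N) :
    ‖kernelFun h X χ Y‖ ≤ Real.exp (‖act X.1ᴴ‖ / h * ‖act Y.1‖) * ‖χ‖ :=
  le_of_tendsto (hasSum_kernelFun hh X χ Y).tendsto_sum_nat.norm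
    (Eventually.of_forall fun n => norm_sum_kernelTerm_le hh X χ n Y)

theorem continuous_act_pow {N : ℕ} (k : ℕ) (v : EuclideanSpace ℂ (Fin N)) :
    Continuous fun Y : Omega N => act (Y.1 ^ k) v :=
  ((continuous_act N).comp (continuous_subtype_val.pow k)).clm_apply continuous_const

theorem continuous_kernelTerm {N : ℕ} (h : ℝ) (X : Omega N)
    (χ : EuclideanSpace ℂ (Fin N)) (k : ℕ) : Continuous (kernelTerm h X χ k) := by
  have : kernelTerm h X χ k = fun Y => ((Nat.factorial k : ℂ) * (h : ℂ) ^ k)⁻¹ •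
      act (Y.1 ^ k) (act (X.1ᴴ ^ k) χ) := funext fun Y => kernelTerm_eq h X χ k Y
  rw [this]
  exact (continuous_act_pow (N := N) k (act (X.1ᴴ ^ k) χ)).const_smul
    (((Nat.factorial k : ℂ) * (h : ℂ) ^ k)⁻¹)

instance (N : ℕ) : SecondCountableTopology (Omega N) :=
  inferInstanceAs (SecondCountableTopology
    {Z : Fin N → Fin N → ℂ // (Matrix.of Z)ᴴ * Matrix.of Z = Matrix.of Z * (Matrix.of Z)ᴴ})

theorem aestronglyMeasurable_kernelFun {N : ℕ} {h : ℝ} (hh : 0 < h) (X : Omega N)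
    (χ : EuclideanSpace ℂ (Fin N)) : AEStronglyMeasurable (kernelFun h X χ) (mu N h) :=
  aestronglyMeasurable_of_tendsto_ae atTop
    (f := fun n Y => ∑ k ∈ Finset.range n, kernelTerm h X χ k Y)
    (fun _ => (continuous_finsetSum _ fun k _ => continuous_kernelTerm h X χ k).aestronglyMeasurable)
    (Eventually.of_forall fun Y => (hasSum_kernelFun hh X χ Y).tendsto_sum_nat)

theorem memLp_kernelFun {N : ℕ} {h : ℝ} (hh : 0 < h) (X : Omega N)
    (χ : EuclideanSpace ℂ (Fin N)) : MemLp (kernelFun h X χ) 2 (mu N h) :=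
  ((memLp_exp N hh (‖act X.1ᴴ‖ / h)).mul_const ‖χ‖).mono'
    (aestronglyMeasurable_kernelFun hh X χ)
    (Eventually.of_forall fun Y => norm_kernelFun_le hh X χ Y)

theorem memLp_monomial {N : ℕ} {h : ℝ} (hh : 0 < h) (k : ℕ) (v : EuclideanSpace ℂ (Fin N)) :
    MemLp (fun Y : Omega N => act (Y.1 ^ k) v) 2 (mu N h) := by
  refine ((memLp_exp N hh 1).mul_const (Nat.factorial k * ‖v‖)).mono'
    (continuous_act_pow k v).aestronglyMeasurable (Eventually.of_forall fun Y => ?_)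
  refine (norm_act_pow_le _ _ _).trans ?_
  have h1 := Real.pow_div_factorial_le_exp ‖act Y.1‖ (norm_nonneg _) k
  rw [div_le_iff₀ (by positivity)] at h1
  rw [one_mul, ← mul_assoc]
  gcongr

theorem exists_mem_span_sum {N : ℕ} {h : ℝ} (hh : 0 < h) (X : Omega N)
    (χ : EuclideanSpace ℂ (Fin N)) (n : ℕ) :
    ∃ u ∈ Submodule.span ℂ {u : L2 N h | ∃ (k : ℕ) (χ : EuclideanSpace ℂ (Fin N)),
      (u : Omega N → EuclideanSpace ℂ (Fin N)) =ᵐ[mu N h] fun Z => act (Z.1 ^ k) χ},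
      (u : Omega N → EuclideanSpace ℂ (Fin N)) =ᵐ[mu N h]
        fun Y => ∑ k ∈ Finset.range n, kernelTerm h X χ k Y := by
  induction n with
  | zero =>
    refine ⟨0, Submodule.zero_mem _, ?_⟩
    filter_upwards [Lp.coeFn_zero (EuclideanSpace ℂ (Fin N)) 2 (mu N h)] with Y hY
    rw [hY, Finset.range_zero, Finset.sum_empty, Pi.zero_apply]
  | succ n ih =>
    obtain ⟨u, hu, hu'⟩ := ih
    have hv := memLp_monomial hh n (act (X.1ᴴ ^ n) χ)
    refine ⟨u + ((Nat.factorial n : ℂ) * (h : ℂ) ^ n)⁻¹ • hv.toLp _, Submodule.add_mem _ hu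
      (Submodule.smul_mem _ _ (Submodule.subset_span ⟨n, _, hv.coeFn_toLp⟩)), ?_⟩
    filter_upwards [hu', hv.coeFn_toLp,
      Lp.coeFn_add u (((Nat.factorial n : ℂ) * (h : ℂ) ^ n)⁻¹ • hv.toLp _),
      Lp.coeFn_smul ((Nat.factorial n : ℂ) * (h : ℂ) ^ n)⁻¹ (hv.toLp _)] with Y h1 h2 h3 h4
    rw [h3, Pi.add_apply, h1, h4, Pi.smul_apply, h2, Finset.sum_range_succ, kernelTerm_eq]

theorem toLp_kernelFun_mem {N : ℕ} {h : ℝ} (hh : 0 < h) (X : Omega N)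
    (χ : EuclideanSpace ℂ (Fin N)) : (memLp_kernelFun hh X χ).toLp _ ∈ H N h := by
  choose u hu hu' using exists_mem_span_sum (N := N) hh X χ
  refine mem_closure_of_tendsto (f := u) (b := atTop) ?_ (Eventually.of_forall hu)
  rw [Lp.tendsto_Lp_iff_tendsto_eLpNorm']
  have e : ∀ n, eLpNorm (⇑(u n) - ⇑((memLp_kernelFun hh X χ).toLp _)) 2 (mu N h)
      = (∫⁻ Y, ‖(∑ k ∈ Finset.range n, kernelTerm h X χ k Y) - kernelFun h X χ Y‖ₑ ^ (2 : ℝ)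
          ∂(mu N h)) ^ (1 / 2 : ℝ) := by
    intro n
    rw [eLpNorm_congr_ae ((hu' n).sub (memLp_kernelFun hh X χ).coeFn_toLp),
      eLpNorm_eq_lintegral_rpow_enorm_toReal (by norm_num) (by norm_num)]
    norm_num
  simp only [e]
  have hlim := tendsto_lintegral_of_dominated_convergence' (μ := mu N h)
    (F := fun n Y => ‖(∑ k ∈ Finset.range n, kernelTerm h X χ k Y) - kernelFun h X χ Y‖ₑ ^ (2 : ℝ))
    (f := fun _ => 0)
    (fun Y => ‖Real.exp (‖act X.1ᴴ‖ / h * ‖act Y.1‖) * (2 * ‖χ‖)‖ₑ ^ (2 : ℝ))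
    (fun _ => ((((continuous_finsetSum _ fun k _ =>
      continuous_kernelTerm h X χ k).aestronglyMeasurable).sub
        (aestronglyMeasurable_kernelFun hh X χ)).enorm.pow_const _))
    (fun n => Eventually.of_forall fun Y => by
      refine ENNReal.rpow_le_rpow (enorm_le_iff_norm_le.mpr ?_) (by norm_num)
      rw [Real.norm_of_nonneg (by positivity)]
      refine (norm_sub_le _ _).trans ?_
      have h1 := norm_sum_kernelTerm_le hh X χ n Y
      have h2 := norm_kernelFun_le hh X χ Y
      linarith)
    (by
      have := ((memLp_exp N hh (‖act X.1ᴴ‖ / h)).mul_const (2 * ‖χ‖)).eLpNorm_lt_top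
      have h3 := lintegral_rpow_enorm_lt_top_of_eLpNorm_lt_top (by norm_num) (by norm_num) this
      exact (by simpa using h3.ne))
    (Eventually.of_forall fun Y => by
      have h1 := ((hasSum_kernelFun hh X χ Y).tendsto_sum_nat.sub_const (kernelFun h X χ Y)).enorm
      rw [sub_self, enorm_zero] at h1
      have h2 := (ENNReal.continuous_rpow_const (y := (2 : ℝ))).continuousAt.tendsto.comp h1
      simpa [Function.comp_def] using h2)
  have h2 := (ENNReal.continuous_rpow_const (y := (1 / 2 : ℝ))).continuousAt.tendsto.comp hlim
  simpa [Function.comp_def] using h2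

/-- The element `K_{X,χ} = K_h(·, X) χ` of `𝓗_h`. -/
def coherent {N : ℕ} {h : ℝ} (hh : 0 < h) (X : Omega N) (χ : EuclideanSpace ℂ (Fin N)) : H N h :=
  ⟨(memLp_kernelFun hh X χ).toLp _, toLp_kernelFun_mem hh X χ⟩

theorem exists_perm_of_prod_eq {m : ℕ} (d e : Fin m → ℂ)
    (hde : (Finset.univ.val.map d) = Finset.univ.val.map e) :
    ∃ σ : Equiv.Perm (Fin m), d = e ∘ σ := by
  have hc : ∀ c : ℂ, Fintype.card {i // d i = c} = Fintype.card {i // e i = c} := by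
    intro c
    have := congrArg (Multiset.count c) hde
    rw [Multiset.count_map, Multiset.count_map] at this
    rw [Fintype.card_subtype, Fintype.card_subtype, Finset.card_def, Finset.card_def,
      Finset.filter_val, Finset.filter_val]
    simpa only [eq_comm] using this
  let σ : Equiv.Perm (Fin m) := (Equiv.sigmaFiberEquiv d).symm.trans
    ((Equiv.sigmaCongrRight fun c => Fintype.equivOfCardEq (hc c)).trans (Equiv.sigmaFiberEquiv e))
  refine ⟨σ, funext fun i => ?_⟩
  exact ((Fintype.equivOfCardEq (hc (d i))) ⟨i, rfl⟩).2.symm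

/-- `f(d_1; d_2, …, d_N)` is symmetric in the `N - 1 = n` variables `d_2, …, d_N`. -/
def IsTailSymmetric {n : ℕ} (f : (Fin (n + 1) → ℂ) → ℂ) : Prop :=
  ∀ (σ : Equiv.Perm (Fin n)) (z : ℂ) (w : Fin n → ℂ),
    f (Matrix.vecCons z (w ∘ σ)) = f (Matrix.vecCons z w)

/-- The vector with `j`-th entry `f(d_j; d_1, …, d̂_j, …, d_N)`. -/
def sharpDiag {n : ℕ} (f : (Fin (n + 1) → ℂ) → ℂ) (d : Fin (n + 1) → ℂ) : Fin (n + 1) → ℂ :=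
  fun j => f (Matrix.vecCons (d j) fun i => d (j.succAbove i))

open Classical in
/-- The function `f^#` on `Ω_N`, `N = n + 1`: one has `f^#(Z) = U diag(f(d_j; …, d̂_j, …)) U*` for any
spectral decomposition `Z = U diag(d) U*`, see `sharp_unitaryConj`. -/
def sharp {n : ℕ} (f : (Fin (n + 1) → ℂ) → ℂ) (Z : Omega (n + 1)) :
    Matrix (Fin (n + 1)) (Fin (n + 1)) ℂ :=
  if hZ : ∃ p : UN (n + 1) × (Fin (n + 1) → ℂ), Z = unitaryConj p.1 p.2 then
    (unitaryConj hZ.choose.1 (sharpDiag f hZ.choose.2)).1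
  else 0

theorem unitaryConj_sharpDiag_congr {n : ℕ} {f : (Fin (n + 1) → ℂ) → ℂ} (hf : IsTailSymmetric f)
    {U V : UN (n + 1)} {d e : Fin (n + 1) → ℂ} (hde : unitaryConj U d = unitaryConj V e) :
    unitaryConj U (sharpDiag f d) = unitaryConj V (sharpDiag f e) := by
  have hU : (U.1)ᴴ * U.1 = 1 := Matrix.UnitaryGroup.star_mul_self U
  have hV : (V.1)ᴴ * V.1 = 1 := Matrix.UnitaryGroup.star_mul_self V
  have hV' : V.1 * (V.1)ᴴ = 1 := Matrix.mem_unitaryGroup_iff.mp V.2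
  have hU' : U.1 * (U.1)ᴴ = 1 := Matrix.mem_unitaryGroup_iff.mp U.2
  have h0 : U.1 * Matrix.diagonal d * (U.1)ᴴ = V.1 * Matrix.diagonal e * (V.1)ᴴ :=
    congrArg Subtype.val hde
  set W := (V.1)ᴴ * U.1 with hW
  have hWd : W * Matrix.diagonal d = Matrix.diagonal e * W := by
    calc W * Matrix.diagonal d = (V.1)ᴴ * (U.1 * Matrix.diagonal d * (U.1)ᴴ) * U.1 := by
          simp only [hW, Matrix.mul_assoc, hU, Matrix.mul_one]
      _ = ((V.1)ᴴ * V.1) * Matrix.diagonal e * W := by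
          rw [h0]; simp only [hW, Matrix.mul_assoc]
      _ = _ := by rw [hV, Matrix.one_mul]
  have hch : ∀ (Y : UN (n + 1)) (c : Fin (n + 1) → ℂ),
      (Y.1 * Matrix.diagonal c * (Y.1)ᴴ).charpoly.roots = Finset.univ.val.map c := by
    intro Y c
    have hY : (Y.1)ᴴ * Y.1 = 1 := Matrix.UnitaryGroup.star_mul_self Y
    rw [Matrix.charpoly_mul_comm, ← Matrix.mul_assoc, hY, Matrix.one_mul, Matrix.charpoly_diagonal]
    have := Polynomial.roots_multiset_prod_X_sub_C (Finset.univ.val.map c)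
    rw [Multiset.map_map] at this
    exact this
  have hms : Finset.univ.val.map d = Finset.univ.val.map e := by
    rw [← hch U d, ← hch V e, h0]
  have hcons : ∀ (c : Fin (n + 1) → ℂ) (j : Fin (n + 1)),
      Finset.univ.val.map c = c j ::ₘ Finset.univ.val.map fun i => c (j.succAbove i) := by
    intro c j
    rw [Fin.univ_succAbove n j]
    simp [Function.comp_def]
  have hkey : ∀ i j, d j = e i → sharpDiag f d j = sharpDiag f e i := by
    intro i j hij
    rw [hcons d j, hcons e i, hij, Multiset.cons_inj_right] at hms
    obtain ⟨σ, hσ⟩ := exists_perm_of_prod_eq _ _ hms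
    unfold sharpDiag
    rw [hσ, hij]
    exact hf σ _ _
  have hWf : W * Matrix.diagonal (sharpDiag f d) = Matrix.diagonal (sharpDiag f e) * W := by
    ext i j
    have h1 := congrFun (congrFun hWd i) j
    rw [Matrix.mul_diagonal, Matrix.diagonal_mul] at h1 ⊢
    rcases eq_or_ne (W i j) 0 with hw | hw
    · rw [hw, zero_mul, mul_zero]
    · rw [mul_comm, mul_right_cancel₀ hw (by rw [mul_comm]; exact h1 : d j * W i j = e i * W i j)
        |> hkey i j]
  refine Subtype.ext ?_
  change U.1 * Matrix.diagonal (sharpDiag f d) * (U.1)ᴴ = V.1 * Matrix.diagonal (sharpDiag f e) * (V.1)ᴴ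
  calc _ = (V.1 * (V.1)ᴴ) * U.1 * Matrix.diagonal (sharpDiag f d) * (U.1)ᴴ := by
        rw [hV', Matrix.one_mul]
    _ = V.1 * (W * Matrix.diagonal (sharpDiag f d)) * (U.1)ᴴ := by
        simp only [hW, Matrix.mul_assoc]
    _ = V.1 * Matrix.diagonal (sharpDiag f e) * (V.1)ᴴ * (U.1 * (U.1)ᴴ) := by
        rw [hWf]; simp only [hW, Matrix.mul_assoc]
    _ = _ := by rw [hU', Matrix.mul_one]

theorem sharp_unitaryConj {n : ℕ} {f : (Fin (n + 1) → ℂ) → ℂ} (hf : IsTailSymmetric f)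
    (U : UN (n + 1)) (d : Fin (n + 1) → ℂ) :
    sharp f (unitaryConj U d) = (unitaryConj U (sharpDiag f d)).1 := by
  have hZ : ∃ p : UN (n + 1) × (Fin (n + 1) → ℂ), unitaryConj U d = unitaryConj p.1 p.2 :=
    ⟨(U, d), rfl⟩
  rw [sharp, dif_pos hZ, unitaryConj_sharpDiag_congr hf hZ.choose_spec]

/-- The spectral function `u^#(U diag(d_j) U*) = U diag(u(d_j)) U*` of a function `u` on `ℂ`,
i.e. `f^#` for `f(d_1; d_2, …, d_N) = u(d_1)`. -/
def spectralSharp {n : ℕ} (u : ℂ → ℂ) : Omega (n + 1) → Matrix (Fin (n + 1)) (Fin (n + 1)) ℂ :=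
  sharp fun d => u (d 0)

/-- The matrix `U Z U*`. -/
def conjBy {N : ℕ} (U : UN N) (Z : Omega N) : Omega N :=
  ⟨U.1 * Z.1 * (U.1)ᴴ, by
    have hU : (U.1)ᴴ * U.1 = 1 := Matrix.UnitaryGroup.star_mul_self U
    have key : ∀ A B : Matrix (Fin N) (Fin N) ℂ,
        (U.1 * A * (U.1)ᴴ) * (U.1 * B * (U.1)ᴴ) = U.1 * (A * B) * (U.1)ᴴ := by
      intro A B
      calc _ = U.1 * A * ((U.1)ᴴ * U.1) * B * (U.1)ᴴ := by simp only [Matrix.mul_assoc]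
        _ = _ := by rw [hU]; simp only [Matrix.mul_assoc, Matrix.mul_one]
    have hs : (U.1 * Z.1 * (U.1)ᴴ)ᴴ = U.1 * (Z.1)ᴴ * (U.1)ᴴ := by
      simp only [Matrix.conjTranspose_mul, Matrix.conjTranspose_conjTranspose, Matrix.mul_assoc]
    rw [hs, key, key, Z.2]⟩

/-- `φ(U Z U*) = U φ(Z) U*` for all `U ∈ U(N)` and `Z ∈ Ω_N`. -/
def IsUInvariant {N : ℕ} (φ : Omega N → Matrix (Fin N) (Fin N) ℂ) : Prop :=
  ∀ (U : UN N) (Z : Omega N), φ (conjBy U Z) = U.1 * φ Z * (U.1)ᴴ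

open Classical in
/-- The Berezin transform `K(X,X)^{-1/2} M K(X,X)^{-1/2}` of an operator `T` on `𝓗_h`, where
`χ'* M χ = ⟨T K_{X,χ}, K_{X,χ'}⟩` for all `χ, χ'`. It is meaningful if all `K_{X,χ}` belong to the
domain of `T`. The matrix power is taken in the functional calculus of Hermitian matrices. (The inner
product of Mathlib is linear in its second argument.) -/
def berezin {N : ℕ} {h : ℝ} (hh : 0 < h) (T : H N h →ₗ.[ℂ] H N h) (X : Omega N) :
    Matrix (Fin N) (Fin N) ℂ :=
  let M : Matrix (Fin N) (Fin N) ℂ := Matrix.of fun a b =>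
    if hb : coherent hh X (EuclideanSpace.single b 1) ∈ T.domain then
      inner ℂ (coherent hh X (EuclideanSpace.single a 1)) (T ⟨_, hb⟩)
    else 0
  let R : Matrix (Fin N) (Fin N) ℂ := cfc (fun x : ℝ => (Real.sqrt x)⁻¹) (kernel h X X)
  R * M * R

/-- The Wirtinger derivative `½ (∂/∂x - i ∂/∂y)` in the complex direction `v`. -/
def dz {E : Type*} [NormedAddCommGroup E] [NormedSpace ℂ E] [NormedSpace ℝ E] (v : E) (F : E → ℂ)
    (x : E) : ℂ :=
  (fderiv ℝ F x v - Complex.I * fderiv ℝ F x (Complex.I • v)) / 2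

/-- The Wirtinger derivative `½ (∂/∂x + i ∂/∂y)` in the complex direction `v`. -/
def dzbar {E : Type*} [NormedAddCommGroup E] [NormedSpace ℂ E] [NormedSpace ℝ E] (v : E)
    (F : E → ℂ) (x : E) : ℂ :=
  (fderiv ℝ F x v + Complex.I * fderiv ℝ F x (Complex.I • v)) / 2

/-- `Δ = ∑ⱼ ∂²/∂d_j ∂d̄_j` on `ℂ^N`. -/
def laplacian {N : ℕ} (F : (Fin N → ℂ) → ℂ) (d : Fin N → ℂ) : ℂ :=
  ∑ j, dz (Pi.single j 1) (dzbar (Pi.single j 1) F) d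

/-- `Δ_(d) + Δ_(e) + ∂²/∂d̄_1 ∂e_1` on functions of `(d, e) ∈ ℂ^N × ℂ^N`. -/
def productOp {n : ℕ} (F : (Fin (n + 1) → ℂ) × (Fin (n + 1) → ℂ) → ℂ)
    (p : (Fin (n + 1) → ℂ) × (Fin (n + 1) → ℂ)) : ℂ :=
  ∑ j, dz (Pi.single j 1, 0) (dzbar (Pi.single j 1, 0) F) p
    + ∑ j, dz (0, Pi.single j 1) (dzbar (0, Pi.single j 1) F) p
    + dzbar (Pi.single 0 1, 0) (dz (0, Pi.single 0 1) F) p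

/-- `(1/r!) (Δ^r f)(z; 0, …, 0)`. -/
def lCoeff {n : ℕ} (r : ℕ) (f : (Fin (n + 1) → ℂ) → ℂ) (z : ℂ) : ℂ :=
  (1 / Nat.factorial r : ℂ) * (laplacian^[r] f) (Matrix.vecCons z 0)

/-- `(1/r!) (Δ_(d) + Δ_(e) + ∂²/∂d̄_1 ∂e_1)^r f(d) g(e)` at `d = e = (z; 0, …, 0)`. -/
def mCoeff {n : ℕ} (r : ℕ) (f g : (Fin (n + 1) → ℂ) → ℂ) (z : ℂ) : ℂ :=
  (1 / Nat.factorial r : ℂ) *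
    (productOp^[r] fun p => f p.1 * g p.2) (Matrix.vecCons z 0, Matrix.vecCons z 0)

/-- `F(h) ≈ ∑ᵣ h^r a_r` as `h ↘ 0`: for every `m`, `F(h) - ∑_{r ≤ m} h^r a_r = O(h^{m+1})`. -/
def HasExpansion {N : ℕ} (F : ∀ h : ℝ, 0 < h → Matrix (Fin N) (Fin N) ℂ)
    (a : ℕ → Matrix (Fin N) (Fin N) ℂ) : Prop :=
  ∀ m : ℕ, ∃ C δ : ℝ, 0 < δ ∧ ∀ (h : ℝ) (hh : 0 < h), h < δ → ∀ i j : Fin N,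
    ‖F h hh i j - ∑ r ∈ Finset.range (m + 1), (h : ℂ) ^ r * a r i j‖ ≤ C * h ^ (m + 1)

/-- `φ ∈ L²(Ω_N, dμ_h)` for some `h > 0`. -/
def SquareIntegrableForSome {N : ℕ} (φ : Omega N → Matrix (Fin N) (Fin N) ℂ) : Prop :=
  ∃ h : ℝ, 0 < h ∧ ∀ i j : Fin N, MemLp (fun Z => φ Z i j) 2 (mu N h)

end NormalMatrix

end

open scoped ComplexConjugate

noncomputable section

namespace NormalMatrix

/-! Write X = V diag(x) V* and let v_j be the columns of V, so that X* v_j = conj(x_j) v_j. The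
kernel series then sums to K_{X,v_j}(Z) = q^#(Z) v_j with q(d) = exp(d_1 conj(x_j) / h). Every
function that occurs has this shape, a spectral function of Z applied to a fixed vector
(`SpectralAE`). Multiplication by f^# replaces q by f q, and L² pairings become scalar:
orthogonality of matrix entries under Haar measure gives ∫ ⟨w, q^#(Z) v⟩ dμ_h = ⟨w, v⟩ ∫ q dγ_h,
with γ_h the Gaussian on ℂ^N (`integral_inner_sharpDiag`). Toeplitz operators preserve the shape
too: by the reproducing property on 𝓗_h (`reproduces_of_mem_H`) the value of T_ψ K at Z is found by
pairing with K_{Z,χ} for eigenvectors χ of Z (`toeplitz_spectralAE`). This is what makes the product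
computable.

Consequently M(X) and K(X,X)^{-1/2} are both diagonal in the basis v_j (`berezin_unitaryConj`), and
each Berezin transform is V diag(c_j(h)) V* with c_j a Gaussian integral. Completing the square and
substituting d = (x_j; 0) + √h y makes h disappear from the weight: c_j(h) = ∫ f((x_j; 0) + √h y)
w(y) dy with w = π^{-N} e^{-|y|²} (`integral_toeplitz_eq`), and for the product the same with f(d)
g(e) and w(a, b) = π^{-2N} e^{-|a|² - |b|² + a_1 conj(b_1)} (`integral_toeplitz_mul_eq`).

The expansion of u(t) = ∫ F(p + √t y) w(y) dy comes from an evolution equation. Since y w is a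
combination of first derivatives of w, integration by parts turns u' into the same average of L F,
where L is Δ for the first weight and Δ_(d) + Δ_(e) + ∂²/∂d̄_1∂e_1 for the second
(`heatPair_laplacian`, `heatPair_productOp`). Iterating, the r-th coefficient is L^r F(p) / r!. For
compactly supported F the remainder is controlled by induction
(`HeatPair.expansion_of_hasCompactSupport`). In general F is only integrable against some Gaussian,
and it is cut off near p: the part vanishing near p contributes O(t^m) for every m
(`HeatPair.tail`).

The domain statements rest on explicit Gaussian estimates, valid once h is at most a quarter of each
h_0 for which a symbol is square-integrable. -/

/-! ### Spectral decompositions and functional calculus of normal matrices -/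

theorem unitaryConj_val {N : ℕ} (U : UN N) (d : Fin N → ℂ) :
    (unitaryConj U d).1 = U.1 * Matrix.diagonal d * (U.1)ᴴ := rfl

theorem conjTranspose_mul_self {N : ℕ} (U : UN N) : (U.1)ᴴ * U.1 = 1 :=
  Matrix.UnitaryGroup.star_mul_self U

theorem unitaryConj_mul {N : ℕ} (U : UN N) (c d : Fin N → ℂ) :
    (unitaryConj U c).1 * (unitaryConj U d).1 = (unitaryConj U fun i => c i * d i).1 := by
  simp only [unitaryConj_val]
  calc _ = U.1 * Matrix.diagonal c * ((U.1)ᴴ * U.1) * Matrix.diagonal d * (U.1)ᴴ := by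
        simp only [Matrix.mul_assoc]
    _ = U.1 * (Matrix.diagonal c * Matrix.diagonal d) * (U.1)ᴴ := by
        rw [conjTranspose_mul_self]; simp only [Matrix.mul_assoc, Matrix.mul_one]
    _ = _ := by rw [Matrix.diagonal_mul_diagonal]

theorem unitaryConj_conjTranspose {N : ℕ} (U : UN N) (c : Fin N → ℂ) :
    ((unitaryConj U c).1)ᴴ = (unitaryConj U fun i => conj (c i)).1 := by
  simp only [unitaryConj_val, Matrix.conjTranspose_mul, Matrix.conjTranspose_conjTranspose,
    Matrix.mul_assoc, Matrix.diagonal_conjTranspose]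
  rfl

theorem unitaryConj_one {N : ℕ} (U : UN N) : (unitaryConj U fun _ => 1).1 = 1 := by
  rw [unitaryConj_val, Matrix.diagonal_one, Matrix.mul_one]
  exact Matrix.mem_unitaryGroup_iff.mp U.2

theorem unitaryConj_pow {N : ℕ} (U : UN N) (c : Fin N → ℂ) (k : ℕ) :
    (unitaryConj U c).1 ^ k = (unitaryConj U fun i => c i ^ k).1 := by
  induction k with
  | zero => simp [unitaryConj_one]
  | succ k ih => rw [pow_succ, ih, unitaryConj_mul]; simp only [pow_succ]

theorem unitaryConj_apply {N : ℕ} (U : UN N) (c : Fin N → ℂ) (a b : Fin N) :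
    (unitaryConj U c).1 a b = ∑ j, U.1 a j * c j * conj (U.1 b j) := by
  rw [unitaryConj_val, Matrix.mul_apply]
  simp only [Matrix.mul_diagonal, Matrix.conjTranspose_apply]
  rfl

theorem inner_act_left {N : ℕ} (A : Matrix (Fin N) (Fin N) ℂ) (v w : EuclideanSpace ℂ (Fin N)) :
    inner ℂ (act A v) w = inner ℂ v (act Aᴴ w) := by
  have : act Aᴴ = ContinuousLinearMap.adjoint (act A) := by
    rw [← ContinuousLinearMap.star_eq_adjoint]
    exact map_star (Matrix.toEuclideanCLM (n := Fin N) (𝕜 := ℂ)) A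
  rw [this, ContinuousLinearMap.adjoint_inner_right]

theorem inner_act_right {N : ℕ} (A : Matrix (Fin N) (Fin N) ℂ) (v w : EuclideanSpace ℂ (Fin N)) :
    inner ℂ v (act A w) = inner ℂ (act Aᴴ v) w := by
  rw [inner_act_left, Matrix.conjTranspose_conjTranspose]

/-- The columns of a unitary matrix. -/
def colBasis {N : ℕ} (U : UN N) (j : Fin N) : EuclideanSpace ℂ (Fin N) :=
  act U.1 (EuclideanSpace.single j 1)

theorem colBasis_apply {N : ℕ} (U : UN N) (i j : Fin N) : colBasis U j i = U.1 i j :=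
  act_single _ _ _

theorem act_single_eq_sum {N : ℕ} (U : UN N) (a : Fin N) :
    (EuclideanSpace.single a 1 : EuclideanSpace ℂ (Fin N))
      = ∑ j, conj (U.1 a j) • colBasis U j := by
  ext i
  have h : U.1 * (U.1)ᴴ = 1 := Matrix.mem_unitaryGroup_iff.mp U.2
  have := congrFun (congrFun h i) a
  rw [Matrix.mul_apply] at this
  simp only [WithLp.ofLp_sum, Finset.sum_apply, PiLp.smul_apply, colBasis_apply, smul_eq_mul]
  simp only [Matrix.conjTranspose_apply] at this
  rw [← show (1 : Matrix (Fin N) (Fin N) ℂ) i a = (EuclideanSpace.single a (1:ℂ)).ofLp i by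
    simp [Matrix.one_apply], ← this]
  exact Finset.sum_congr rfl fun j _ => mul_comm _ _

theorem inner_colBasis {N : ℕ} (U : UN N) (i j : Fin N) :
    inner ℂ (colBasis U i) (colBasis U j) = if i = j then 1 else 0 := by
  rw [colBasis, colBasis, inner_act_left, ← act_mul_apply, conjTranspose_mul_self]
  simp [act, EuclideanSpace.inner_single_left]

theorem act_unitaryConj_colBasis {N : ℕ} (U : UN N) (c : Fin N → ℂ) (j : Fin N) :
    act (unitaryConj U c).1 (colBasis U j) = c j • colBasis U j := by
  have : (unitaryConj U c).1 * U.1 = U.1 * Matrix.diagonal c := by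
    rw [unitaryConj_val, Matrix.mul_assoc, conjTranspose_mul_self, Matrix.mul_one]
  rw [colBasis, ← act_mul_apply, this]
  ext i
  rw [PiLp.smul_apply, act_single, act_single, Matrix.mul_diagonal, smul_eq_mul, mul_comm]

theorem act_unitaryConj_eq_sum {N : ℕ} (U : UN N) (c : Fin N → ℂ) (v : EuclideanSpace ℂ (Fin N)) :
    act (unitaryConj U c).1 v = ∑ j, (c j * inner ℂ (colBasis U j) v) • colBasis U j := by
  ext a
  have h1 := congrFun (Matrix.ofLp_toEuclideanCLM (𝕜 := ℂ) (unitaryConj U c).1 v) a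
  rw [act, h1]
  simp only [Matrix.mulVec, dotProduct, unitaryConj_apply, WithLp.ofLp_sum, Finset.sum_apply,
    PiLp.smul_apply, colBasis_apply, smul_eq_mul, PiLp.inner_apply, RCLike.inner_apply,
    Finset.sum_mul, Finset.mul_sum]
  rw [Finset.sum_comm]
  exact Finset.sum_congr rfl fun j _ => Finset.sum_congr rfl fun i _ => by ring

theorem norm_unitary_entry_le {N : ℕ} (U : UN N) (i j : Fin N) : ‖U.1 i j‖ ≤ 1 :=
  entry_norm_bound_of_unitary U.2 i j

/-- The spectral theorem for normal matrices. -/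
theorem exists_unitaryConj {N : ℕ} (Z : Omega N) : ∃ (U : UN N) (d : Fin N → ℂ),
    Z = unitaryConj U d := by
  classical
  let E := EuclideanSpace ℂ (Fin N)
  -- Normality means that the real and imaginary parts are commuting self-adjoint operators, so
  -- their joint eigenspaces decompose the space orthogonally.
  let ZA := act Z.1
  let A : E →L[ℂ] E := realPart ZA
  let B : E →L[ℂ] E := imaginaryPart ZA
  have hn : IsStarNormal ZA := by
    refine ⟨?_⟩
    have h1 : star ZA = act (Z.1)ᴴ :=
      (map_star (Matrix.toEuclideanCLM (n := Fin N) (𝕜 := ℂ)) Z.1).symm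
    rw [h1]
    change act _ * act _ = act _ * act _
    rw [← map_mul, ← map_mul, Z.2]
  have hAB : Commute A B := Commute.realPart_imaginaryPart ZA
  have hA : (A : E →ₗ[ℂ] E).IsSymmetric :=
    ContinuousLinearMap.isSelfAdjoint_iff_isSymmetric.mp (realPart ZA).2
  have hB : (B : E →ₗ[ℂ] E).IsSymmetric :=
    ContinuousLinearMap.isSelfAdjoint_iff_isSymmetric.mp (imaginaryPart ZA).2
  have hAB' : Commute (A : E →ₗ[ℂ] E) (B : E →ₗ[ℂ] E) := by
    have := congrArg (fun T : E →L[ℂ] E => (T : E →ₗ[ℂ] E)) hAB.eq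
    exact this
  have hint := LinearMap.IsSymmetric.directSum_isInternal_of_commute hA hB hAB'
  have horth := LinearMap.IsSymmetric.orthogonalFamily_eigenspace_inf_eigenspace hA hB
  set W : ℂ × ℂ → Submodule ℂ E := fun i =>
    Module.End.eigenspace (A : E →ₗ[ℂ] E) i.2 ⊓ Module.End.eigenspace (B : E →ₗ[ℂ] E) i.1 with hW
  -- The joint eigenspaces are indexed by all of ℂ × ℂ. Discarding the zero ones leaves a finite
  -- index type, from which an orthonormal basis can be assembled.
  have hfin : {i | W i ≠ ⊥}.Finite :=
    WellFoundedGT.finite_ne_bot_of_iSupIndep hint.submodule_iSupIndep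
  have hint' := DirectSum.isInternal_ne_bot_iff.mpr hint
  have : Fintype {i // W i ≠ ⊥} := hfin.fintype
  have hrank : Module.finrank ℂ E = N := by simp [E]
  have horth' : OrthogonalFamily ℂ (fun i : {i // W i ≠ ⊥} => W i) fun i => (W i).subtypeₗᵢ :=
    horth.comp Subtype.val_injective
  let b : OrthonormalBasis (Fin N) ℂ E := hint'.subordinateOrthonormalBasis hrank horth'
  have hb : ∀ a, ∃ c : ℂ, ZA (b a) = c • b a := by
    intro a
    have h1 := hint'.subordinateOrthonormalBasis_subordinate hrank a horth'
    set i := hint'.subordinateOrthonormalBasisIndex hrank a horth'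
    -- In `W` the second index is the eigenvalue of the real part and the first that of the
    -- imaginary part.
    refine ⟨i.1.2 + Complex.I * i.1.1, ?_⟩
    have hAb : A (b a) = i.1.2 • b a := Module.End.mem_eigenspace_iff.mp h1.1
    have hBb : B (b a) = i.1.1 • b a := Module.End.mem_eigenspace_iff.mp h1.2
    have hZ : ZA = A + Complex.I • B := (realPart_add_I_smul_imaginaryPart ZA).symm
    rw [hZ, add_apply, smul_apply, hAb, hBb, add_smul, mul_smul]
  choose d hd using hb
  let V : Matrix (Fin N) (Fin N) ℂ := Matrix.of fun i j => b j i
  have hV : V ∈ Matrix.unitaryGroup (Fin N) ℂ := by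
    rw [Matrix.mem_unitaryGroup_iff']
    ext i j
    have := orthonormal_iff_ite.mp b.orthonormal i j
    rw [Matrix.mul_apply, Matrix.one_apply, ← this, PiLp.inner_apply]
    exact Finset.sum_congr rfl fun k _ => mul_comm _ _
  refine ⟨⟨V, hV⟩, d, Subtype.ext ?_⟩
  have hV' : V * Vᴴ = 1 := Matrix.mem_unitaryGroup_iff.mp hV
  have h2 : Z.1 * V = V * Matrix.diagonal d := by
    ext i j
    have := congrFun (congrArg WithLp.ofLp (hd j)) i
    have h1 := congrFun (Matrix.ofLp_toEuclideanCLM (𝕜 := ℂ) Z.1 (b j)) i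
    rw [Matrix.mul_diagonal]
    rw [show (ZA (b j)).ofLp i = _ from h1] at this
    rw [mul_comm]
    exact this
  rw [unitaryConj_val]
  change Z.1 = V * Matrix.diagonal d * Vᴴ
  rw [← h2, Matrix.mul_assoc, hV', Matrix.mul_one]

/-- The functional calculus is computed in a particular eigenbasis of the matrix. The result is
independent of the diagonalization by `unitaryConj_sharpDiag_congr`, applied to a symbol depending
on the first variable only. -/
theorem cfc_unitaryConj {n : ℕ} (V : UN (n + 1)) (c : Fin (n + 1) → ℝ) (f : ℝ → ℝ) :
    cfc f (unitaryConj V fun i => (c i : ℂ)).1 = (unitaryConj V fun i => (f (c i) : ℂ)).1 := by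
  have hA : (unitaryConj V fun i => (c i : ℂ)).1.IsHermitian := by
    rw [Matrix.IsHermitian, unitaryConj_conjTranspose]; simp
  have h1 : unitaryConj V (fun i => (c i : ℂ))
      = unitaryConj hA.eigenvectorUnitary (fun i => (hA.eigenvalues i : ℂ)) :=
    Subtype.ext (by
      conv_lhs => rw [hA.spectral_theorem]
      rfl)
  have h2 := unitaryConj_sharpDiag_congr (f := fun d => ((f (d 0).re : ℝ) : ℂ))
    (fun σ z w => rfl) h1
  have h3 := congrArg Subtype.val h2
  rw [hA.cfc_eq]
  refine Eq.trans ?_ h3.symm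
  rfl

theorem isTailSymmetric_head {n : ℕ} (u : ℂ → ℂ) :
    IsTailSymmetric fun d : Fin (n + 1) → ℂ => u (d 0) := fun _ _ _ => rfl

theorem spectralSharp_unitaryConj {n : ℕ} (u : ℂ → ℂ) (U : UN (n + 1)) (d : Fin (n + 1) → ℂ) :
    spectralSharp u (unitaryConj U d) = (unitaryConj U fun i => u (d i)).1 := by
  rw [spectralSharp, sharp_unitaryConj (isTailSymmetric_head u)]
  rfl

/-! ### Averaging over the unitary group and over permutations -/

instance (N : ℕ) : (haarUN N).IsHaarMeasure := by
  unfold haarUN; infer_instance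

/-- Unimodularity of a compact group: the right translate of Haar measure is a left-invariant
probability measure, hence Haar measure itself by uniqueness. -/
theorem integral_mul_right_haarUN {N : ℕ} (F : UN N → ℂ) (hF : Continuous F) (V : UN N) :
    ∫ U, F (U * V) ∂(haarUN N) = ∫ U, F U ∂(haarUN N) := by
  have hc : Continuous fun U : UN N => U * V := continuous_id.mul continuous_const
  have hm : Measurable fun U : UN N => U * V := hc.measurable
  have : IsProbabilityMeasure ((haarUN N).map fun U => U * V) :=
    Measure.isProbabilityMeasure_map hm.aemeasurable
  have hl : ((haarUN N).map fun U => U * V).IsMulLeftInvariant := by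
    refine ⟨fun W => ?_⟩
    have hW : Measurable fun U : UN N => W * U := (continuous_const.mul continuous_id).measurable
    rw [Measure.map_map hW hm]
    have : (fun U : UN N => W * U) ∘ (fun U => U * V) = (fun U => U * V) ∘ fun U => W * U := by
      funext U; simp only [Function.comp, mul_assoc]
    rw [this, ← Measure.map_map hm hW, map_mul_left_eq_self]
  have h1 := Measure.isMulInvariant_eq_smul_of_compactSpace
    ((haarUN N).map fun U => U * V) (haarUN N)
  have h2 : (haarUN N).map (fun U => U * V) = haarUN N := by
    have h3 := congrArg (fun m => m Set.univ) h1
    simp only [measure_univ, Measure.smul_apply] at h3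
    rw [h1]
    have h4 : Measure.haarScalarFactor ((haarUN N).map fun U => U * V) (haarUN N) = 1 := by
      rw [ENNReal.smul_def, smul_eq_mul, mul_one] at h3
      exact_mod_cast h3.symm
    rw [h4, one_smul]
  conv_rhs => rw [← h2]
  rw [integral_map hm.aemeasurable hF.aestronglyMeasurable]

theorem continuous_entry {N : ℕ} (i j : Fin N) : Continuous fun U : UN N => U.1 i j :=
  continuous_subtype_val.matrix_elem i j

theorem continuous_entry_mul {N : ℕ} (j a b : Fin N) :
    Continuous fun U : UN N => conj (U.1 j a) * U.1 j b :=
  (Complex.continuous_conj.comp (continuous_entry j a)).mul (continuous_entry j b)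

theorem integrable_of_continuous_UN {N : ℕ} {F : UN N → ℂ} (hF : Continuous F) :
    Integrable F (haarUN N) :=
  hF.integrable_of_hasCompactSupport (HasCompactSupport.of_compactSpace F)

/-- Invariance under right multiplication by permutation matrices makes the diagonal integrals
equal, and they sum to 1 because rows have norm 1. Changing the sign of one column kills the
off-diagonal ones. -/
theorem integral_entry_mul {N : ℕ} (j a b : Fin N) :
    ∫ U : UN N, conj (U.1 j a) * U.1 j b ∂(haarUN N) = if a = b then (N : ℂ)⁻¹ else 0 := by
  have hc := continuous_entry_mul (N := N)
  split_ifs with hab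
  · subst hab
    have hperm : ∀ b : Fin N, ∫ U : UN N, conj (U.1 j b) * U.1 j b ∂(haarUN N)
        = ∫ U : UN N, conj (U.1 j a) * U.1 j a ∂(haarUN N) := by
      intro b
      -- Right multiplication by this permutation matrix brings column b into position a.
      let P : Matrix (Fin N) (Fin N) ℂ := Matrix.of fun i k => if Equiv.swap a b k = i then 1 else 0
      have hP : P ∈ Matrix.unitaryGroup (Fin N) ℂ := by
        rw [Matrix.mem_unitaryGroup_iff']
        ext i k
        simp [P, Matrix.mul_apply, Matrix.star_apply, Matrix.one_apply, apply_ite, eq_comm]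
      have h := integral_mul_right_haarUN _ (hc j a a) ⟨P, hP⟩
      rw [← h]
      have : ∀ (U : UN N), (U * ⟨P, hP⟩ : UN N).1 j a = U.1 j b := by
        intro U
        change (U.1 * P) j a = _
        simp [P, Matrix.mul_apply]
      simp only [this]
    have hsum : ∑ b, ∫ U : UN N, conj (U.1 j b) * U.1 j b ∂(haarUN N) = 1 := by
      rw [← integral_finsetSum _ fun b _ => integrable_of_continuous_UN (hc j b b)]
      have : ∀ U : UN N, ∑ b, conj (U.1 j b) * U.1 j b = 1 := by
        intro U
        have h : U.1 * (U.1)ᴴ = 1 := Matrix.mem_unitaryGroup_iff.mp U.2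
        have := congrFun (congrFun h j) j
        rw [Matrix.mul_apply, Matrix.one_apply_eq] at this
        rw [← this]
        exact Finset.sum_congr rfl fun b _ => mul_comm _ _
      simp only [this]
      simp
    rw [Finset.sum_congr rfl fun b _ => hperm b, Finset.sum_const, Finset.card_univ,
      Fintype.card_fin, nsmul_eq_mul] at hsum
    exact eq_inv_of_mul_eq_one_right hsum
  -- Right multiplication by this diagonal matrix negates column a only, so the integrand changes
  -- sign.
  · let P : Matrix (Fin N) (Fin N) ℂ := Matrix.diagonal fun k => if k = a then -1 else 1
    have hP : P ∈ Matrix.unitaryGroup (Fin N) ℂ := by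
      rw [Matrix.mem_unitaryGroup_iff', Matrix.star_eq_conjTranspose,
        Matrix.diagonal_conjTranspose, Matrix.diagonal_mul_diagonal, ← Matrix.diagonal_one]
      congr 1
      funext k
      simp only [Pi.star_apply]
      split_ifs <;> simp
    have h := integral_mul_right_haarUN _ (hc j a b) ⟨P, hP⟩
    have : ∀ (U : UN N), conj ((U * ⟨P, hP⟩ : UN N).1 j a) * (U * ⟨P, hP⟩ : UN N).1 j b
        = -(conj (U.1 j a) * U.1 j b) := by
      intro U
      change conj ((U.1 * P) j a) * (U.1 * P) j b = _
      simp [P, Matrix.mul_diagonal, Ne.symm hab]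
    simp only [this, integral_neg] at h
    have h2 : (2 : ℂ) * ∫ U : UN N, conj (U.1 j a) * U.1 j b ∂(haarUN N) = 0 := by
      linear_combination -h
    simpa using h2

theorem measurePreserving_comp_perm_volume {N : ℕ} (σ : Equiv.Perm (Fin N)) :
    MeasurePreserving (fun d : Fin N → ℂ => d ∘ σ) volume volume := by
  have := volume_measurePreserving_piCongrLeft (fun _ : Fin N => ℂ) σ.symm
  convert this using 1
  funext d i
  have := Equiv.piCongrLeft_apply_apply (fun _ : Fin N => ℂ) σ.symm d (σ i)
  rw [Equiv.symm_apply_apply] at this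
  exact this.symm

theorem measurePreserving_comp_perm {N : ℕ} (h : ℝ) (σ : Equiv.Perm (Fin N)) :
    MeasurePreserving (fun d : Fin N → ℂ => d ∘ σ) (gaussian N h) (gaussian N h) := by
  have hv := measurePreserving_comp_perm_volume σ
  refine ⟨hv.measurable, ?_⟩
  ext s hs
  rw [Measure.map_apply hv.measurable hs, gaussian, withDensity_apply _ hs,
    withDensity_apply _ (hv.measurable hs),
    ← hv.setLIntegral_comp_preimage hs (by fun_prop)]
  refine lintegral_congr fun d => ?_
  have : ∑ j, ‖(d ∘ σ) j‖ ^ 2 = ∑ j, ‖d j‖ ^ 2 := Equiv.sum_comp σ fun j => ‖d j‖ ^ 2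
  rw [this]

/-- Moving d_j to the front while keeping the order of the other entries is a permutation of the
coordinates. Each entry of `sharpDiag` is thus f after a measure-preserving map, with no symmetry of
f needed. -/
theorem sharpDiag_eq {n : ℕ} (f : (Fin (n + 1) → ℂ) → ℂ) (d : Fin (n + 1) → ℂ) (j : Fin (n + 1)) :
    sharpDiag f d j = f (d ∘ (Fin.cycleRange j).symm) := by
  unfold sharpDiag
  congr 1
  funext i
  refine Fin.cases ?_ (fun i => ?_) i
  · simp [Fin.cycleRange_symm_zero]
  · simp [Fin.cycleRange_symm_succ]

theorem sharpDiag_zero {n : ℕ} (f : (Fin (n + 1) → ℂ) → ℂ) (d : Fin (n + 1) → ℂ) :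
    sharpDiag f d 0 = f d := by
  unfold sharpDiag
  congr 1
  funext i
  refine Fin.cases ?_ (fun i => ?_) i <;> simp

theorem integrable_sharpDiag {n : ℕ} {h : ℝ} {q : (Fin (n + 1) → ℂ) → ℂ}
    (hq : Integrable q (gaussian (n + 1) h)) (j : Fin (n + 1)) :
    Integrable (fun d => sharpDiag q d j) (gaussian (n + 1) h) := by
  simp only [sharpDiag_eq]
  exact (measurePreserving_comp_perm h (Fin.cycleRange j).symm).integrable_comp_of_integrable hq

theorem integral_sharpDiag {n : ℕ} {h : ℝ} {q : (Fin (n + 1) → ℂ) → ℂ}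
    (hq : Integrable q (gaussian (n + 1) h)) (j : Fin (n + 1)) :
    ∫ d, sharpDiag q d j ∂(gaussian (n + 1) h) = ∫ d, q d ∂(gaussian (n + 1) h) := by
  simp only [sharpDiag_eq]
  have hp := measurePreserving_comp_perm h (Fin.cycleRange j).symm
  conv_rhs => rw [← hp.map_eq]
  rw [integral_map hp.measurable.aemeasurable (by rw [hp.map_eq]; exact hq.1)]

theorem inner_act_unitaryConj_inv {N : ℕ} (U : UN N) (c : Fin N → ℂ)
    (w v : EuclideanSpace ℂ (Fin N)) :
    inner ℂ w (act (unitaryConj U⁻¹ c).1 v)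
      = ∑ a, ∑ b, ∑ j, conj (w a) * v b * ((conj (U.1 j a) * U.1 j b) * c j) := by
  rw [PiLp.inner_apply]
  refine Finset.sum_congr rfl fun a _ => ?_
  have h1 := congrFun (Matrix.ofLp_toEuclideanCLM (𝕜 := ℂ) (unitaryConj U⁻¹ c).1 v) a
  rw [act, h1, RCLike.inner_apply]
  have hi : ∀ i k, (U⁻¹ : UN N).1 i k = conj (U.1 k i) := fun i k => rfl
  simp only [Matrix.mulVec, dotProduct, unitaryConj_apply, hi, Complex.conj_conj, Finset.sum_mul]
  refine Finset.sum_congr rfl fun b _ => Finset.sum_congr rfl fun j _ => ?_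
  ring

/-- Averaging over the unitary group turns a spectral function into a scalar. -/
theorem integral_inner_sharpDiag {n : ℕ} {h : ℝ} {q : (Fin (n + 1) → ℂ) → ℂ}
    (hq : Integrable q (gaussian (n + 1) h)) (w v : EuclideanSpace ℂ (Fin (n + 1))) :
    ∫ p : UN (n + 1) × (Fin (n + 1) → ℂ),
      inner ℂ w (act (unitaryConj p.1⁻¹ (sharpDiag q p.2)).1 v)
      ∂((haarUN (n + 1)).prod (gaussian (n + 1) h))
      = inner ℂ w v * ∫ d, q d ∂(gaussian (n + 1) h) := by
  have hi : ∀ a b j, Integrable (fun p : UN (n + 1) × (Fin (n + 1) → ℂ) =>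
      conj (w a) * v b * ((conj (p.1.1 j a) * p.1.1 j b) * sharpDiag q p.2 j))
      ((haarUN (n + 1)).prod (gaussian (n + 1) h)) := fun a b j =>
    ((integrable_of_continuous_UN (continuous_entry_mul j a b)).mul_prod
      (integrable_sharpDiag hq j)).const_mul _
  simp only [inner_act_unitaryConj_inv]
  rw [integral_finsetSum _ fun a _ => integrable_finsetSum _ fun b _ =>
    integrable_finsetSum _ fun j _ => hi a b j]
  simp_rw [integral_finsetSum _ fun b _ => integrable_finsetSum _ fun j _ => hi _ b j,
    integral_finsetSum _ fun j _ => hi _ _ j, integral_const_mul]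
  rw [PiLp.inner_apply, Finset.sum_mul]
  refine Finset.sum_congr rfl fun a _ => ?_
  have hj : ∀ b j, ∫ p : UN (n + 1) × (Fin (n + 1) → ℂ),
      (conj (p.1.1 j a) * p.1.1 j b) * sharpDiag q p.2 j
        ∂((haarUN (n + 1)).prod (gaussian (n + 1) h))
      = (if a = b then ((n + 1 : ℕ) : ℂ)⁻¹ else 0) * ∫ d, q d ∂(gaussian (n + 1) h) := by
    intro b j
    rw [← integral_sharpDiag hq j, ← integral_entry_mul j a b]
    exact integral_prod_mul (fun U : UN (n + 1) => conj (U.1 j a) * U.1 j b)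
      fun d => sharpDiag q d j
  -- The integral no longer depends on j, so the n + 1 eigenvalues contribute n + 1 equal terms,
  -- which cancel the Haar factor 1 / (n + 1).
  simp only [hj, Finset.sum_const, Finset.card_univ, Fintype.card_fin, nsmul_eq_mul]
  rw [Finset.sum_eq_single a (fun b _ hb => by rw [if_neg hb.symm]; simp) (by simp), if_pos rfl,
    RCLike.inner_apply]
  have : ((n + 1 : ℕ) : ℂ) ≠ 0 := by exact_mod_cast n.succ_ne_zero
  field_simp

/-! ### Wirtinger derivatives -/

section Wirtinger

variable {E : Type*} [NormedAddCommGroup E] [NormedSpace ℂ E] [NormedSpace ℝ E]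

theorem dz_eq {F : E → ℂ} {F' : E →L[ℝ] ℂ} {x : E} (hF : HasFDerivAt F F' x) (v : E) :
    dz v F x = (F' v - Complex.I * F' (Complex.I • v)) / 2 := by
  rw [dz, hF.fderiv]

theorem dzbar_eq {F : E → ℂ} {F' : E →L[ℝ] ℂ} {x : E} (hF : HasFDerivAt F F' x) (v : E) :
    dzbar v F x = (F' v + Complex.I * F' (Complex.I • v)) / 2 := by
  rw [dzbar, hF.fderiv]

variable [MeasurableSpace E] [BorelSpace E] [FiniteDimensional ℝ E]
  {μ : Measure E} [μ.IsAddHaarMeasure]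

/-- Integration by parts in the two real directions `v` and `I • v`, which is why integrability is
asked for all directions `u`. -/
theorem integral_mul_dz {f w : E → ℂ} (v : E) (hf : Differentiable ℝ f) (hw : Differentiable ℝ w)
    (h1 : ∀ u, Integrable (fun x => fderiv ℝ f x u * w x) μ)
    (h2 : ∀ u, Integrable (fun x => f x * fderiv ℝ w x u) μ)
    (h3 : Integrable (fun x => f x * w x) μ) :
    ∫ x, f x * dz v w x ∂μ = -∫ x, dz v f x * w x ∂μ := by
  have key : ∀ u, ∫ x, f x * fderiv ℝ w x u ∂μ = -∫ x, fderiv ℝ f x u * w x ∂μ := fun u =>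
    integral_mul_fderiv_eq_neg_fderiv_mul_of_integrable (h1 u) (h2 u) h3 (fun x _ => hf x)
      fun x _ => hw x
  have e1 : ∀ x, f x * dz v w x = (1 / 2) * (f x * fderiv ℝ w x v)
      - (Complex.I / 2) * (f x * fderiv ℝ w x (Complex.I • v)) := fun x => by rw [dz]; ring
  have e2 : ∀ x, dz v f x * w x = (1 / 2) * (fderiv ℝ f x v * w x)
      - (Complex.I / 2) * (fderiv ℝ f x (Complex.I • v) * w x) := fun x => by rw [dz]; ring
  simp only [e1, e2]
  rw [integral_sub ((h2 _).const_mul _) ((h2 _).const_mul _),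
    integral_sub ((h1 _).const_mul _) ((h1 _).const_mul _)]
  simp only [integral_const_mul, key]
  ring

theorem integral_mul_dzbar {f w : E → ℂ} (v : E) (hf : Differentiable ℝ f)
    (hw : Differentiable ℝ w)
    (h1 : ∀ u, Integrable (fun x => fderiv ℝ f x u * w x) μ)
    (h2 : ∀ u, Integrable (fun x => f x * fderiv ℝ w x u) μ)
    (h3 : Integrable (fun x => f x * w x) μ) :
    ∫ x, f x * dzbar v w x ∂μ = -∫ x, dzbar v f x * w x ∂μ := by
  have key : ∀ u, ∫ x, f x * fderiv ℝ w x u ∂μ = -∫ x, fderiv ℝ f x u * w x ∂μ := fun u =>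
    integral_mul_fderiv_eq_neg_fderiv_mul_of_integrable (h1 u) (h2 u) h3 (fun x _ => hf x)
      fun x _ => hw x
  have e1 : ∀ x, f x * dzbar v w x = (1 / 2) * (f x * fderiv ℝ w x v)
      + (Complex.I / 2) * (f x * fderiv ℝ w x (Complex.I • v)) := fun x => by rw [dzbar]; ring
  have e2 : ∀ x, dzbar v f x * w x = (1 / 2) * (fderiv ℝ f x v * w x)
      + (Complex.I / 2) * (fderiv ℝ f x (Complex.I • v) * w x) := fun x => by rw [dzbar]; ring
  simp only [e1, e2]
  rw [integral_add ((h2 _).const_mul _) ((h2 _).const_mul _),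
    integral_add ((h1 _).const_mul _) ((h1 _).const_mul _)]
  simp only [integral_const_mul, key]
  ring

end Wirtinger

/-! ### Gaussian integrals -/

theorem integral_gaussian_eq {N : ℕ} {h : ℝ} (hh : 0 < h) (F : (Fin N → ℂ) → ℂ) :
    ∫ d, F d ∂(gaussian N h)
      = ((Real.pi * h : ℝ) : ℂ)⁻¹ ^ N * ∫ d, F d * Real.exp (-(∑ j, ‖d j‖ ^ 2) / h) := by
  unfold gaussian
  rw [integral_withDensity_eq_integral_toReal_smul (by fun_prop) (by simp),
    ← integral_const_mul]
  refine integral_congr_ae (Eventually.of_forall fun d => ?_)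
  simp only
  rw [ENNReal.toReal_ofReal (by positivity), Complex.real_smul]
  push_cast
  rw [inv_pow]
  ring

theorem integrable_gaussian_iff {N : ℕ} {h : ℝ} (hh : 0 < h) (F : (Fin N → ℂ) → ℂ) :
    Integrable F (gaussian N h)
      ↔ Integrable (fun d => F d * Real.exp (-(∑ j, ‖d j‖ ^ 2) / h)) := by
  unfold gaussian
  rw [integrable_withDensity_iff_integrable_smul' (by fun_prop) (by simp)]
  have hc : IsUnit (((Real.pi * h : ℝ) : ℂ)⁻¹ ^ N) := by
    refine IsUnit.mk0 _ (pow_ne_zero _ (inv_ne_zero ?_))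
    exact_mod_cast (by positivity : Real.pi * h ≠ 0)
  refine Iff.trans ?_ (integrable_const_mul_iff hc _)
  refine iff_of_eq (congrArg (fun G => Integrable G volume) (funext fun d => ?_))
  rw [ENNReal.toReal_ofReal (by positivity), Complex.real_smul]
  push_cast
  rw [inv_pow]
  ring

/-- Transported from `memLp_exp`: the operator norm of U diag(d) U* is the sup norm of d, and the
Haar factor is a probability measure. -/
theorem memLp_exp_gaussian (N : ℕ) {h : ℝ} (hh : 0 < h) (a : ℝ) :
    MemLp (fun d : Fin N → ℂ => Real.exp (a * ‖d‖)) 2 (gaussian N h) := by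
  have h1 := memLp_exp N hh a
  unfold mu at h1
  have hc : Continuous fun Z : Omega N => Real.exp (a * ‖act Z.1‖) :=
    Real.continuous_exp.comp (continuous_const.mul
      ((continuous_act N).comp continuous_subtype_val).norm)
  rw [memLp_map_measure_iff hc.aestronglyMeasurable
    (continuous_unitaryConj N).measurable.aemeasurable] at h1
  have e : ((fun Z : Omega N => Real.exp (a * ‖act Z.1‖)) ∘
      fun p : UN N × (Fin N → ℂ) => unitaryConj p.1⁻¹ p.2) = fun p => Real.exp (a * ‖p.2‖) := by
    funext p
    simp only [Function.comp, norm_act_unitaryConj]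
  rw [e, memLp_two_iff_integrable_sq (by exact (Continuous.aestronglyMeasurable (by fun_prop)))]
    at h1
  rw [memLp_two_iff_integrable_sq (by exact (Continuous.aestronglyMeasurable (by fun_prop)))]
  exact (Integrable.comp_snd_iff (IsProbabilityMeasure.ne_zero (haarUN N))
    (f := fun d : Fin N → ℂ => Real.exp (a * ‖d‖) ^ 2)).mp h1

instance (N : ℕ) {h : ℝ} [hh : Fact (0 < h)] : IsFiniteMeasure (gaussian N h) := by
  -- With exponent 0 this says that the constant 1 is square-integrable, i.e. that the measure is
  -- finite.
  have := memLp_exp_gaussian N hh.out 0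
  simp only [zero_mul, Real.exp_zero] at this
  have h2 := (memLp_const_iff (by norm_num) (by norm_num)).mp this
  exact ⟨h2.resolve_left one_ne_zero⟩

/-- At most exponential growth. -/
def ExpGrowth {N : ℕ} (F : (Fin N → ℂ) → ℂ) : Prop :=
  ∃ C a : ℝ, ∀ d, ‖F d‖ ≤ C * Real.exp (a * ‖d‖)

theorem ExpGrowth.mul {N : ℕ} {F G : (Fin N → ℂ) → ℂ} (hF : ExpGrowth F) (hG : ExpGrowth G) :
    ExpGrowth fun d => F d * G d := by
  obtain ⟨C, a, hF⟩ := hF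
  obtain ⟨D, b, hG⟩ := hG
  refine ⟨C * D, a + b, fun d => ?_⟩
  rw [norm_mul, add_mul, Real.exp_add]
  calc ‖F d‖ * ‖G d‖ ≤ (C * Real.exp (a * ‖d‖)) * (D * Real.exp (b * ‖d‖)) :=
        mul_le_mul (hF d) (hG d) (norm_nonneg _) ((norm_nonneg _).trans (hF d))
    _ = _ := by ring

theorem ExpGrowth.add {N : ℕ} {F G : (Fin N → ℂ) → ℂ} (hF : ExpGrowth F) (hG : ExpGrowth G) :
    ExpGrowth fun d => F d + G d := by
  obtain ⟨C, a, hF⟩ := hF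
  obtain ⟨D, b, hG⟩ := hG
  have hC : 0 ≤ C := by simpa using (norm_nonneg _).trans (hF 0)
  have hD : 0 ≤ D := by simpa using (norm_nonneg _).trans (hG 0)
  refine ⟨C + D, max a b, fun d => (norm_add_le _ _).trans ?_⟩
  rw [add_mul]
  refine add_le_add ((hF d).trans ?_) ((hG d).trans ?_)
  · gcongr; exact le_max_left _ _
  · gcongr; exact le_max_right _ _

theorem expGrowth_const {N : ℕ} (c : ℂ) : ExpGrowth fun _ : Fin N → ℂ => c :=
  ⟨‖c‖, 0, fun d => by simp⟩

theorem expGrowth_apply {N : ℕ} (i : Fin N) : ExpGrowth fun d : Fin N → ℂ => d i :=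
  ⟨1, 1, fun d => by
    have := Real.add_one_le_exp ‖d‖
    have := norm_le_pi_norm d i
    rw [one_mul, one_mul]; linarith⟩

theorem ExpGrowth.conj {N : ℕ} {F : (Fin N → ℂ) → ℂ} (hF : ExpGrowth F) :
    ExpGrowth fun d => conj (F d) := by
  obtain ⟨C, a, hF⟩ := hF
  exact ⟨C, a, fun d => by rw [Complex.norm_conj]; exact hF d⟩

theorem ExpGrowth.pow {N : ℕ} {F : (Fin N → ℂ) → ℂ} (hF : ExpGrowth F) (k : ℕ) :
    ExpGrowth fun d => F d ^ k := by
  induction k with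
  | zero => simpa using expGrowth_const 1
  | succ k ih => simp only [pow_succ]; exact ih.mul hF

theorem expGrowth_cexp {N : ℕ} (i : Fin N) (c : ℂ) :
    ExpGrowth fun d : Fin N → ℂ => Complex.exp (c * d i) := by
  refine ⟨1, ‖c‖, fun d => ?_⟩
  rw [Complex.norm_exp, one_mul]
  refine Real.exp_le_exp.mpr ((Complex.re_le_norm _).trans ?_)
  rw [norm_mul]
  gcongr
  exact norm_le_pi_norm d i

theorem ExpGrowth.memLp {N : ℕ} {F : (Fin N → ℂ) → ℂ} (hF : ExpGrowth F) (hc : Continuous F)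
    {h : ℝ} (hh : 0 < h) : MemLp F 2 (gaussian N h) := by
  obtain ⟨C, a, hF⟩ := hF
  exact ((memLp_exp_gaussian N hh a).const_mul C).mono' hc.aestronglyMeasurable
    (Eventually.of_forall hF)

theorem ExpGrowth.integrable {N : ℕ} {F : (Fin N → ℂ) → ℂ} (hF : ExpGrowth F) (hc : Continuous F)
    {h : ℝ} (hh : 0 < h) : Integrable F (gaussian N h) :=
  have : Fact (0 < h) := ⟨hh⟩
  (hF.memLp hc hh).integrable (by norm_num)

/-- In real coordinates z = x + iy the linear form α z + β z̄ has coefficients α + β and i(α - β),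
so the exponential factors. -/
theorem cexp_quadratic_prod {h : ℝ} (α β : ℂ) (p : ℝ × ℝ) :
    Complex.exp (-(‖(p.1 + p.2 * Complex.I : ℂ)‖ ^ 2 : ℝ) / h
        + (α * (p.1 + p.2 * Complex.I) + β * conj (p.1 + p.2 * Complex.I : ℂ)) / h)
      = Complex.exp (-(1 / h : ℝ) * (p.1 : ℂ) ^ 2 + (α + β) / h * p.1 + 0)
        * Complex.exp (-(1 / h : ℝ) * (p.2 : ℂ) ^ 2 + (Complex.I * (α - β)) / h * p.2 + 0) := by
  rw [← Complex.exp_add]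
  congr 1
  have h1 : ‖(p.1 + p.2 * Complex.I : ℂ)‖ ^ 2 = p.1 ^ 2 + p.2 ^ 2 := by
    rw [← Complex.normSq_eq_norm_sq, Complex.normSq_add_mul_I]
  rw [h1]
  simp only [map_add, map_mul, Complex.conj_ofReal, Complex.conj_I]
  push_cast
  ring

/-- A product of two one-dimensional Gaussian integrals. The exponents combine through (α + β)² - (α
- β)² = 4αβ. -/
theorem integral_cexp_complex {h : ℝ} (hh : 0 < h) (α β : ℂ) :
    ∫ z : ℂ, Complex.exp (-(‖z‖ ^ 2 : ℝ) / h + (α * z + β * conj z) / h)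
      = Real.pi * h * Complex.exp (α * β / h) := by
  rw [← (Complex.volume_preserving_equiv_real_prod.symm).integral_comp
    Complex.measurableEquivRealProd.symm.measurableEmbedding]
  have e : ∀ p : ℝ × ℝ, Complex.measurableEquivRealProd.symm p = p.1 + p.2 * Complex.I := by
    intro p
    apply Complex.ext <;> simp [Complex.measurableEquivRealProd]
  simp only [e, cexp_quadratic_prod]
  have hb : (-((1 / h : ℝ) : ℂ)).re < 0 := by
    rw [Complex.neg_re, Complex.ofReal_re]
    have : 0 < 1 / h := by positivity
    linarith
  have h0 : (h : ℂ) ≠ 0 := by exact_mod_cast hh.ne'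
  rw [Measure.volume_eq_prod, integral_prod_mul
    (fun x : ℝ => Complex.exp (-(1 / h : ℝ) * (x : ℂ) ^ 2 + (α + β) / h * x + 0))
    (fun x : ℝ => Complex.exp (-(1 / h : ℝ) * (x : ℂ) ^ 2 + (Complex.I * (α - β)) / h * x + 0)),
    integral_cexp_quadratic hb, integral_cexp_quadratic hb]
  -- Each one-dimensional integral contributes a square root of πh.
  have hs : ((Real.pi : ℂ) / -(-((1 / h : ℝ) : ℂ))) ^ (1 / 2 : ℂ)
      * ((Real.pi : ℂ) / -(-((1 / h : ℝ) : ℂ))) ^ (1 / 2 : ℂ) = Real.pi * h := by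
    have : (Real.pi : ℂ) / -(-((1 / h : ℝ) : ℂ)) = Real.pi * h := by
      push_cast; field_simp
    rw [this, ← Complex.cpow_add _ _ (by
      exact mul_ne_zero (by exact_mod_cast Real.pi_ne_zero) h0)]
    norm_num
  rw [mul_mul_mul_comm, hs, ← Complex.exp_add]
  congr 2
  push_cast
  field_simp
  linear_combination ((α - β) ^ 2) * Complex.I_sq

theorem cexp_sum_eq_prod {n : ℕ} {h : ℝ} (α β : ℂ) (d : Fin (n + 1) → ℂ) :
    Complex.exp (-(∑ j, ‖d j‖ ^ 2 : ℝ) / h + (α * d 0 + β * conj (d 0)) / h)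
      = ∏ j, Complex.exp (-(‖d j‖ ^ 2 : ℝ) / h
          + ((if j = 0 then α else 0) * d j + (if j = 0 then β else 0) * conj (d j)) / h) := by
  rw [← Complex.exp_sum, Finset.sum_add_distrib]
  congr 2
  · rw [Complex.ofReal_sum, ← Finset.sum_neg_distrib, Finset.sum_div]
  · rw [Finset.sum_eq_single 0 (fun j _ hj => by simp [hj]) (by simp)]
    simp

theorem integral_cexp_pi {n : ℕ} {h : ℝ} (hh : 0 < h) (α β : ℂ) :
    ∫ d : Fin (n + 1) → ℂ,
      Complex.exp (-(∑ j, ‖d j‖ ^ 2 : ℝ) / h + (α * d 0 + β * conj (d 0)) / h)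
      = (Real.pi * h) ^ (n + 1) * Complex.exp (α * β / h) := by
  simp only [cexp_sum_eq_prod]
  rw [integral_fintype_prod_volume_eq_prod (fun (j : Fin (n + 1)) (z : ℂ) =>
    Complex.exp (-(‖z‖ ^ 2 : ℝ) / h
          + ((if j = 0 then α else 0) * z + (if j = 0 then β else 0) * conj z) / h))]
  simp only [integral_cexp_complex hh]
  rw [Finset.prod_mul_distrib, Finset.prod_const, Finset.card_univ, Fintype.card_fin,
    Finset.prod_eq_single 0 (fun j _ hj => by simp [hj]) (by simp)]
  simp

/-- Writing |d_j|² as d_j times its conjugate presents the Gaussian as a complex exponential of a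
real polynomial map, to which the chain rule applies. Only the values of the derivative matter
later, so the derivative itself is hidden in an existential. -/
theorem hasFDerivAt_sum_norm_sq {N : ℕ} (h : ℝ) (d : Fin N → ℂ) :
    ∃ F' : (Fin N → ℂ) →L[ℝ] ℂ, HasFDerivAt (fun d : Fin N → ℂ =>
        ((Real.exp (-(∑ j, ‖d j‖ ^ 2) / h) : ℝ) : ℂ)) F' d ∧
      ∀ u, F' u = -(∑ j, (conj (d j) * u j + d j * conj (u j))) / h
        * ((Real.exp (-(∑ j, ‖d j‖ ^ 2) / h) : ℝ) : ℂ) := by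
  have e : (fun d : Fin N → ℂ => ((Real.exp (-(∑ j, ‖d j‖ ^ 2) / h) : ℝ) : ℂ))
      = fun d => Complex.exp (-(∑ j, d j * conj (d j)) / h) := by
    funext d
    push_cast
    simp only [Complex.mul_conj']
  have hp : ∀ j, HasFDerivAt (fun d : Fin N → ℂ => d j)
      (ContinuousLinearMap.proj (R := ℝ) j) d := fun j => hasFDerivAt_apply j d
  have hpc : ∀ j, HasFDerivAt (fun d : Fin N → ℂ => conj (d j))
      ((Complex.conjCLE : ℂ →L[ℝ] ℂ).comp (ContinuousLinearMap.proj (R := ℝ) j)) d := fun j =>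
    (Complex.conjCLE : ℂ →L[ℝ] ℂ).hasFDerivAt.comp d (hp j)
  have hs := (HasFDerivAt.fun_sum (u := Finset.univ) fun j _ => (hp j).mul (hpc j)).neg.mul_const
    (h : ℂ)⁻¹
  have := hs.cexp
  rw [e]
  refine ⟨_, this.congr_of_eventuallyEq (Eventually.of_forall fun x => by
    simp [div_eq_mul_inv]), fun u => ?_⟩
  simp only [smul_apply, neg_apply, sum_apply, add_apply,
    ContinuousLinearMap.proj_apply, ContinuousLinearMap.comp_apply, smul_eq_mul]
  have hexp := congrFun e d
  rw [hexp]
  have : ∑ j, (conj (d j) * u j + d j * conj (u j))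
      = ∑ j, (d j * (Complex.conjCLE : ℂ →L[ℝ] ℂ) (u j) + conj (d j) * u j) :=
    Finset.sum_congr rfl fun j _ => by rw [add_comm]; rfl
  rw [this]
  simp only [div_eq_mul_inv, Pi.neg_apply, Pi.mul_apply]
  ring

theorem ExpGrowth.sum {N : ℕ} {ι : Type*} (s : Finset ι) {F : ι → (Fin N → ℂ) → ℂ}
    (hF : ∀ i ∈ s, ExpGrowth (F i)) : ExpGrowth fun d => ∑ i ∈ s, F i d := by
  classical
  induction s using Finset.induction_on with
  | empty => simpa using expGrowth_const 0
  | insert i s hi ih =>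
    simp only [Finset.sum_insert hi]
    exact (hF i (Finset.mem_insert_self i s)).add
      (ih fun j hj => hF j (Finset.mem_insert_of_mem hj))

theorem conj_cexp_mul_div (z y : ℂ) (h : ℝ) :
    conj (Complex.exp (z * conj y / h)) = Complex.exp (y / h * conj z) := by
  rw [← Complex.exp_conj]
  congr 1
  simp only [map_div₀, map_mul, Complex.conj_conj, Complex.conj_ofReal]
  ring

theorem expGrowth_cexp_conj {N : ℕ} (i : Fin N) (c : ℂ) :
    ExpGrowth fun d : Fin N → ℂ => Complex.exp (c * conj (d i)) := by
  have := (expGrowth_cexp (N := N) i (conj c)).conj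
  refine (congrArg ExpGrowth (funext fun d => ?_)).mp this
  rw [← Complex.exp_conj, map_mul, Complex.conj_conj]

/-- The reproducing property of the kernel `e^{z ȳ / h}` on monomials. -/
theorem integral_pow_mul_cexp {n : ℕ} {h : ℝ} (hh : 0 < h) (y : ℂ) (k : ℕ) :
    ∫ d, d 0 ^ k * Complex.exp (y / h * conj (d 0)) ∂(gaussian (n + 1) h) = y ^ k := by
  have h0 : (h : ℂ) ≠ 0 := by exact_mod_cast hh.ne'
  have hpi : (Real.pi : ℂ) ≠ 0 := by exact_mod_cast Real.pi_ne_zero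
  rw [integral_gaussian_eq hh]
  have hcast : ∀ d : Fin (n + 1) → ℂ, ((Real.exp (-(∑ j, ‖d j‖ ^ 2) / h) : ℝ) : ℂ)
      = Complex.exp (-(∑ j, ‖d j‖ ^ 2 : ℝ) / h) := fun d => by push_cast; rfl
  induction k with
  | zero =>
    have := integral_cexp_pi (n := n) hh 0 y
    simp only [zero_mul, zero_add, zero_div, Complex.exp_zero, mul_one] at this
    have e : ∀ d : Fin (n + 1) → ℂ, d 0 ^ 0 * Complex.exp (y / h * conj (d 0))
        * ((Real.exp (-(∑ j, ‖d j‖ ^ 2) / h) : ℝ) : ℂ)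
        = Complex.exp (-(∑ j, ‖d j‖ ^ 2 : ℝ) / h + y * conj (d 0) / h) := by
      intro d
      rw [hcast, pow_zero, one_mul, ← Complex.exp_add]
      congr 1
      ring
    simp only [e, this]
    push_cast
    rw [inv_pow, pow_zero, inv_mul_cancel₀ (pow_ne_zero _ (mul_ne_zero hpi h0))]
  | succ k ih =>
    set w : (Fin (n + 1) → ℂ) → ℂ := fun d => ((Real.exp (-(∑ j, ‖d j‖ ^ 2) / h) : ℝ) : ℂ) with hw
    set f : (Fin (n + 1) → ℂ) → ℂ := fun d => d 0 ^ k * Complex.exp (y / h * conj (d 0)) with hf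
    have hfd : ∀ d, ∃ F' : (Fin (n + 1) → ℂ) →L[ℝ] ℂ, HasFDerivAt f F' d ∧ ∀ u,
        F' u = k * d 0 ^ (k - 1) * u 0 * Complex.exp (y / h * conj (d 0))
          + y / h * conj (u 0) * (d 0 ^ k * Complex.exp (y / h * conj (d 0))) := by
      intro d
      have hp : HasFDerivAt (fun d : Fin (n + 1) → ℂ => d 0)
        (ContinuousLinearMap.proj (R := ℝ) 0) d := hasFDerivAt_apply 0 d
      have hpc : HasFDerivAt (fun d : Fin (n + 1) → ℂ => conj (d 0))
          ((Complex.conjCLE : ℂ →L[ℝ] ℂ).comp (ContinuousLinearMap.proj (R := ℝ) 0)) d :=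
        (Complex.conjCLE : ℂ →L[ℝ] ℂ).hasFDerivAt.comp d hp
      refine ⟨_, (hp.pow k).mul (hpc.const_mul (y / h)).cexp, fun u => ?_⟩
      simp only [smul_apply, add_apply, ContinuousLinearMap.proj_apply,
        ContinuousLinearMap.comp_apply, smul_eq_mul, nsmul_eq_mul]
      have : (Complex.conjCLE : ℂ →L[ℝ] ℂ) (u 0) = conj (u 0) := rfl
      rw [this]
      ring
    have hg0 := expGrowth_apply (0 : Fin (n + 1))
    have hge := expGrowth_cexp_conj (0 : Fin (n + 1)) (y / h)
    have hfg : ExpGrowth f := (hg0.pow k).mul hge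
    have hfc : Continuous f := by fun_prop
    -- The induction step is one integration by parts: ∂̄_1 of the Gaussian is -d_1/h times the
    -- Gaussian, whereas ∂̄_1 acts on d_1^k e^{y d̄_1/h} as multiplication by y/h. Raising the power
    -- of d_1 therefore multiplies the integral by y.
    have hI := integral_mul_dzbar (μ := volume) (f := f) (w := w)
      (Pi.single 0 1) (fun d => (hfd d).choose_spec.1.differentiableAt)
      (fun d => (hasFDerivAt_sum_norm_sq h d).choose_spec.1.differentiableAt)
      (fun u => by
        have e : ∀ d, fderiv ℝ f d u = k * d 0 ^ (k - 1) * u 0 * Complex.exp (y / h * conj (d 0))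
          + y / h * conj (u 0) * (d 0 ^ k * Complex.exp (y / h * conj (d 0))) := fun d => by
            obtain ⟨F', h1, h2⟩ := hfd d
            rw [h1.fderiv, h2]
        simp only [e]
        refine (integrable_gaussian_iff hh _).mp (ExpGrowth.integrable ?_ (by fun_prop) hh)
        exact ((((expGrowth_const _).mul (hg0.pow _)).mul (expGrowth_const _)).mul hge).add
          (((expGrowth_const _)).mul hfg))
      (fun u => by
        have e : ∀ d, f d * fderiv ℝ w d u = (f d *
            (-(∑ j, (conj (d j) * u j + d j * conj (u j))) / h)) * w d := fun d => by
            obtain ⟨F', h1, h2⟩ := hasFDerivAt_sum_norm_sq h d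
            rw [h1.fderiv, h2]
            simp only [hf, hw]
            ring
        simp only [e]
        refine (integrable_gaussian_iff hh _).mp (ExpGrowth.integrable ?_ (by fun_prop) hh)
        refine hfg.mul ?_
        have : ExpGrowth fun d : Fin (n + 1) → ℂ =>
            (-1 / (h : ℂ)) * ∑ j, (conj (d j) * u j + d j * conj (u j)) :=
          (expGrowth_const _).mul (ExpGrowth.sum _ fun j _ =>
            (((expGrowth_apply j).conj.mul (expGrowth_const _)).add
              ((expGrowth_apply j).mul (expGrowth_const _))))
        refine (congrArg ExpGrowth (funext fun d => ?_)).mp this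
        ring)
      ((integrable_gaussian_iff hh _).mp (hfg.integrable hfc hh))
    have e1 : ∀ d, f d * dzbar (Pi.single 0 1) w d = (-1 / (h : ℂ)) * (d 0 ^ (k + 1)
        * Complex.exp (y / h * conj (d 0)) * w d) := by
      intro d
      obtain ⟨F', h1, h2⟩ := hasFDerivAt_sum_norm_sq h d
      rw [dzbar_eq h1, h2, h2]
      have s1 : ∑ j, (conj (d j) * (Pi.single 0 1 : Fin (n + 1) → ℂ) j
          + d j * conj ((Pi.single 0 1 : Fin (n + 1) → ℂ) j)) = conj (d 0) + d 0 := by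
        rw [Finset.sum_eq_single 0 (fun j _ hj => by simp [hj]) (by simp)]; simp
      have s2 : ∑ j, (conj (d j) * (Complex.I • (Pi.single 0 1 : Fin (n + 1) → ℂ)) j
          + d j * conj ((Complex.I • (Pi.single 0 1 : Fin (n + 1) → ℂ)) j))
          = Complex.I * (conj (d 0) - d 0) := by
        rw [Finset.sum_eq_single 0 (fun j _ hj => by simp [hj]) (by simp)]; simp; ring
      rw [s1, s2]
      simp only [hf, hw]
      field_simp
      linear_combination (-(conj (d 0) - d 0) * d 0 ^ k) * Complex.I_sq
    have e2 : ∀ d, dzbar (Pi.single 0 1) f d * w d = (y / h) * (d 0 ^ k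
        * Complex.exp (y / h * conj (d 0)) * w d) := by
      intro d
      obtain ⟨F', h1, h2⟩ := hfd d
      rw [dzbar_eq h1, h2, h2]
      simp only [Pi.smul_apply, Pi.single_eq_same, smul_eq_mul, map_mul, Complex.conj_I, map_one]
      linear_combination ((k * d 0 ^ (k - 1) * Complex.exp (y / h * conj (d 0))
        - y / h * (d 0 ^ k * Complex.exp (y / h * conj (d 0)))) / 2 * w d) * Complex.I_sq
    simp only [e1, e2, integral_const_mul] at hI
    have h3 : ∫ d : Fin (n + 1) → ℂ, d 0 ^ (k + 1) * Complex.exp (y / h * conj (d 0)) * w d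
        = y * ∫ d : Fin (n + 1) → ℂ, d 0 ^ k * Complex.exp (y / h * conj (d 0)) * w d := by
      have aux : ∀ A B : ℂ, -1 / (h : ℂ) * A = -(y / h * B) → A = y * B := by
        intro A B hAB
        field_simp at hAB
        linear_combination -hAB
      exact aux _ _ hI
    rw [h3, pow_succ' y, ← ih]
    ring

/-! ### Functions given by the spectral calculus -/

/-- `G(Z) = q^#(Z) v` for almost every `Z`. -/
def SpectralAE {n : ℕ} (h : ℝ) (q : (Fin (n + 1) → ℂ) → ℂ) (v : EuclideanSpace ℂ (Fin (n + 1)))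
    (G : Omega (n + 1) → EuclideanSpace ℂ (Fin (n + 1))) : Prop :=
  ∀ᵐ Z ∂(mu (n + 1) h), ∀ U d, Z = unitaryConj U d → G Z = act (unitaryConj U (sharpDiag q d)).1 v

theorem measurable_conjMap (N : ℕ) :
    Measurable fun p : UN N × (Fin N → ℂ) => unitaryConj p.1⁻¹ p.2 :=
  (continuous_unitaryConj N).measurable

theorem SpectralAE.ae_prod {n : ℕ} {h : ℝ} {q : (Fin (n + 1) → ℂ) → ℂ}
    {v : EuclideanSpace ℂ (Fin (n + 1))} {G : Omega (n + 1) → EuclideanSpace ℂ (Fin (n + 1))}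
    (hG : SpectralAE h q v G) :
    ∀ᵐ p ∂((haarUN (n + 1)).prod (gaussian (n + 1) h)),
      G (unitaryConj p.1⁻¹ p.2) = act (unitaryConj p.1⁻¹ (sharpDiag q p.2)).1 v := by
  filter_upwards [ae_of_ae_map (measurable_conjMap (n + 1)).aemeasurable hG] with p hp
  exact hp _ _ rfl

/-- The operator norm of q^#(Z) is the largest modulus among the entries of `sharpDiag`, bounded
here by their sum; each entry is q composed with a permutation that preserves the Gaussian. -/
theorem SpectralAE.memLp {n : ℕ} {h : ℝ} {q : (Fin (n + 1) → ℂ) → ℂ}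
    {v : EuclideanSpace ℂ (Fin (n + 1))} {G : Omega (n + 1) → EuclideanSpace ℂ (Fin (n + 1))}
    (hG : SpectralAE h q v G) (hm : AEStronglyMeasurable G (mu (n + 1) h))
    (hq : MemLp q 2 (gaussian (n + 1) h)) : MemLp G 2 (mu (n + 1) h) := by
  unfold mu at hm ⊢
  have hmap := (measurable_conjMap (n + 1)).aemeasurable
    (μ := (haarUN (n + 1)).prod (gaussian (n + 1) h))
  rw [memLp_map_measure_iff hm hmap]
  have hs : MemLp (fun d => ∑ j, ‖sharpDiag q d j‖) 2 (gaussian (n + 1) h) := by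
    refine memLp_finsetSum _ fun j _ => ?_
    simp only [sharpDiag_eq]
    exact (hq.comp_measurePreserving (measurePreserving_comp_perm h (Fin.cycleRange j).symm)).norm
  refine ((hs.comp_snd (haarUN (n + 1))).mul_const ‖v‖).mono' (hm.comp_aemeasurable hmap) ?_
  filter_upwards [hG.ae_prod] with p hp
  simp only [Function.comp]
  rw [hp]
  refine (ContinuousLinearMap.le_opNorm _ _).trans ?_
  rw [norm_act_unitaryConj]
  gcongr
  refine (pi_norm_le_iff_of_nonneg (by positivity)).mpr fun j => ?_
  exact Finset.single_le_sum (f := fun j => ‖sharpDiag q p.2 j‖) (fun _ _ => norm_nonneg _)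
    (Finset.mem_univ j)

/-- On an eigenvector of X* the powers of X* act as scalars, so on each eigenvector of Y the kernel
series becomes the exponential series. This is how coherent states become spectral functions. -/
theorem kernelFun_unitaryConj {N : ℕ} {h : ℝ} (hh : 0 < h) {X : Omega N} {x : ℂ}
    {v : EuclideanSpace ℂ (Fin N)} (hv : act X.1ᴴ v = conj x • v) (U : UN N) (d : Fin N → ℂ) :
    kernelFun h X v (unitaryConj U d)
      = act (unitaryConj U fun i => Complex.exp (d i * conj x / h)).1 v := by
  have hpow : ∀ k, act (X.1ᴴ ^ k) v = conj x ^ k • v := by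
    intro k
    induction k with
    | zero => simp [act]
    | succ k ih => rw [pow_succ, act_mul_apply, hv, map_smul, ih, smul_smul, pow_succ']
  refine (hasSum_kernelFun hh X v (unitaryConj U d)).unique ?_
  rw [act_unitaryConj_eq_sum]
  have hterm : ∀ k, kernelTerm h X v k (unitaryConj U d)
      = ∑ j, ((d j * conj x / h) ^ k / k.factorial * inner ℂ (colBasis U j) v) • colBasis U j := by
    intro k
    rw [kernelTerm_eq, hpow, unitaryConj_pow, map_smul, act_unitaryConj_eq_sum, smul_smul,
      Finset.smul_sum]
    refine Finset.sum_congr rfl fun j _ => ?_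
    rw [smul_smul]
    congr 1
    rw [div_pow, mul_pow]
    field_simp
  simp only [hterm]
  have hexp : ∀ z : ℂ, HasSum (fun k : ℕ => z ^ k / k.factorial) (Complex.exp z) := fun z => by
    rw [Complex.exp_eq_exp_ℂ]
    exact NormedSpace.expSeries_div_hasSum_exp z
  have hj : ∀ j, HasSum (fun k : ℕ => ((d j * conj x / h) ^ k / k.factorial *
      inner ℂ (colBasis U j) v) • colBasis U j)
      ((Complex.exp (d j * conj x / h) * inner ℂ (colBasis U j) v) • colBasis U j) := fun j =>
    ((hexp (d j * conj x / h)).mul_right (inner ℂ (colBasis U j) v)).smul_const (colBasis U j)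
  exact hasSum_sum fun j _ => hj j

theorem coherent_coeFn {N : ℕ} {h : ℝ} (hh : 0 < h) (X : Omega N) (v : EuclideanSpace ℂ (Fin N)) :
    ((coherent hh X v : L2 N h) : Omega N → EuclideanSpace ℂ (Fin N))
      =ᵐ[mu N h] kernelFun h X v :=
  (memLp_kernelFun hh X v).coeFn_toLp

theorem coherent_spectralAE {n : ℕ} {h : ℝ} (hh : 0 < h) {X : Omega (n + 1)} {x : ℂ}
    {v : EuclideanSpace ℂ (Fin (n + 1))} (hv : act X.1ᴴ v = conj x • v) :
    SpectralAE h (fun d => Complex.exp (d 0 * conj x / h)) v (coherent hh X v : L2 (n + 1) h) := by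
  filter_upwards [coherent_coeFn hh X v] with Z hZ U d hd
  rw [hZ, hd, kernelFun_unitaryConj hh hv]
  rfl

/-- Moving the coherent state's matrix to the other side conjugates its eigenvalues. The two
spectral functions then multiply, and `integral_inner_sharpDiag` averages the product. -/
theorem SpectralAE.inner_coherent {n : ℕ} {h : ℝ} (hh : 0 < h) {q : (Fin (n + 1) → ℂ) → ℂ}
    {v : EuclideanSpace ℂ (Fin (n + 1))} {G : Omega (n + 1) → EuclideanSpace ℂ (Fin (n + 1))}
    (hG : SpectralAE h q v G) (hm : AEStronglyMeasurable G (mu (n + 1) h))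
    {Y : Omega (n + 1)} {y : ℂ} {w : EuclideanSpace ℂ (Fin (n + 1))}
    (hw : act Y.1ᴴ w = conj y • w)
    (hq : Integrable (fun d => q d * Complex.exp (y / h * conj (d 0))) (gaussian (n + 1) h)) :
    ∫ Z, inner ℂ ((coherent hh Y w : L2 (n + 1) h) Z) (G Z) ∂(mu (n + 1) h)
      = inner ℂ w v * ∫ d, q d * Complex.exp (y / h * conj (d 0)) ∂(gaussian (n + 1) h) := by
  have hmi : AEStronglyMeasurable (fun Z => inner ℂ ((coherent hh Y w : L2 (n + 1) h) Z) (G Z))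
      (mu (n + 1) h) := (Lp.aestronglyMeasurable _).inner hm
  have hc := (coherent_spectralAE hh hw).ae_prod
  unfold mu at hmi ⊢
  rw [integral_map (measurable_conjMap (n + 1)).aemeasurable hmi, ← integral_inner_sharpDiag hq]
  refine integral_congr_ae ?_
  filter_upwards [hc, hG.ae_prod] with p h1 h2
  rw [h2]
  refine (congrArg (fun t => inner ℂ t _) h1).trans ?_
  rw [inner_act_left, ← act_mul_apply, unitaryConj_conjTranspose, unitaryConj_mul]
  congr 5
  funext j
  simp only [sharpDiag, Matrix.cons_val_zero, conj_cexp_mul_div]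
  ring

/-! ### The reproducing property -/

theorem coherent_add {N : ℕ} {h : ℝ} (hh : 0 < h) (X : Omega N) (v w : EuclideanSpace ℂ (Fin N)) :
    coherent hh X (v + w) = coherent hh X v + coherent hh X w := by
  refine Subtype.ext ?_
  change (memLp_kernelFun hh X (v + w)).toLp _
    = (memLp_kernelFun hh X v).toLp _ + (memLp_kernelFun hh X w).toLp _
  rw [← MemLp.toLp_add]
  refine MemLp.toLp_congr _ _ (Eventually.of_forall fun Z => ?_)
  simp only [kernelFun, map_add, Pi.add_apply]

theorem coherent_smul {N : ℕ} {h : ℝ} (hh : 0 < h) (X : Omega N) (c : ℂ)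
    (v : EuclideanSpace ℂ (Fin N)) : coherent hh X (c • v) = c • coherent hh X v := by
  refine Subtype.ext ?_
  change (memLp_kernelFun hh X (c • v)).toLp _ = c • (memLp_kernelFun hh X v).toLp _
  rw [← MemLp.toLp_const_smul]
  refine MemLp.toLp_congr _ _ (Eventually.of_forall fun Z => ?_)
  simp only [kernelFun, map_smul, Pi.smul_apply]

/-- `K_{X,v}` as a linear function of `v`. -/
def coherentMap {N : ℕ} {h : ℝ} (hh : 0 < h) (X : Omega N) :
    EuclideanSpace ℂ (Fin N) →ₗ[ℂ] H N h where
  toFun := coherent hh X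
  map_add' := coherent_add hh X
  map_smul' := coherent_smul hh X

theorem eq_sum_colBasis {N : ℕ} (U : UN N) (v : EuclideanSpace ℂ (Fin N)) :
    v = ∑ j, inner ℂ (colBasis U j) v • colBasis U j := by
  have := act_unitaryConj_eq_sum U (fun _ => 1) v
  rw [unitaryConj_one] at this
  simpa [act] using this

theorem act_conjTranspose_colBasis {N : ℕ} (U : UN N) (c : Fin N → ℂ) (j : Fin N) :
    act (unitaryConj U c).1ᴴ (colBasis U j) = conj (c j) • colBasis U j := by
  rw [unitaryConj_conjTranspose, act_unitaryConj_colBasis]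

/-- `⟨K_{Y,χ}, u⟩ = ⟨χ, u(Y)⟩` for almost every `Y`. -/
def Reproduces {N : ℕ} {h : ℝ} (hh : 0 < h) (u : L2 N h) : Prop :=
  ∀ᵐ Y ∂(mu N h), ∀ χ, inner ℂ (coherent hh Y χ : L2 N h) u = inner ℂ χ (u Y)

/-- By linearity it suffices to take w in an eigenbasis of Y, where the claim reduces to the scalar
identity `integral_pow_mul_cexp`. -/
theorem inner_coherent_monomial {n : ℕ} {h : ℝ} (hh : 0 < h) {u : L2 (n + 1) h} {k : ℕ}
    {χ : EuclideanSpace ℂ (Fin (n + 1))}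
    (hu : (u : Omega (n + 1) → EuclideanSpace ℂ (Fin (n + 1)))
      =ᵐ[mu (n + 1) h] fun Z => act (Z.1 ^ k) χ)
    (Y : Omega (n + 1)) (w : EuclideanSpace ℂ (Fin (n + 1))) :
    inner ℂ (coherent hh Y w : L2 (n + 1) h) u = inner ℂ w (act (Y.1 ^ k) χ) := by
  obtain ⟨U, y, rfl⟩ := exists_unitaryConj Y
  have hS : SpectralAE h (fun d : Fin (n + 1) → ℂ => d 0 ^ k) χ u := by
    filter_upwards [hu] with Z hZ V d hd
    rw [hZ, hd, unitaryConj_pow]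
    rfl
  have hj : ∀ j, inner ℂ (coherent hh (unitaryConj U y) (colBasis U j) : L2 (n + 1) h) u
      = inner ℂ (colBasis U j) (act ((unitaryConj U y).1 ^ k) χ) := by
    intro j
    have hi : Integrable (fun d : Fin (n + 1) → ℂ => d 0 ^ k *
        Complex.exp (y j / h * conj (d 0))) (gaussian (n + 1) h) :=
      (((expGrowth_apply 0).pow k).mul (expGrowth_cexp_conj 0 _)).integrable (by fun_prop) hh
    rw [L2.inner_def, hS.inner_coherent hh (Lp.aestronglyMeasurable _)
      (act_conjTranspose_colBasis U y j) hi, integral_pow_mul_cexp hh, unitaryConj_pow,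
      inner_act_right, act_conjTranspose_colBasis, inner_smul_left, Complex.conj_conj, mul_comm]
  have hl : (coherent hh (unitaryConj U y) w : L2 (n + 1) h)
      = ∑ j, inner ℂ (colBasis U j) w •
          (coherent hh (unitaryConj U y) (colBasis U j) : L2 (n + 1) h) := by
    have : coherentMap hh (unitaryConj U y) w = _ :=
      congrArg (coherentMap hh (unitaryConj U y)) (eq_sum_colBasis U w)
    rw [map_sum] at this
    have h2 := congrArg (Submodule.subtype _) this
    simp only [map_sum, map_smul] at h2
    exact h2
  rw [hl]
  conv_rhs => rw [eq_sum_colBasis U w]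
  rw [sum_inner, sum_inner]
  exact Finset.sum_congr rfl fun j _ => by rw [inner_smul_left, inner_smul_left, hj]

/-- The property is clear on the span of the monomials. It survives L² limits because the pairing
with a coherent state is continuous, while point values converge almost everywhere along a
subsequence. -/
theorem reproduces_of_mem_H {n : ℕ} {h : ℝ} (hh : 0 < h) {u : L2 (n + 1) h}
    (hu : u ∈ H (n + 1) h) : Reproduces hh u := by
  obtain ⟨s, hs, hlim⟩ := mem_closure_iff_seq_limit.mp hu
  have hspan : ∀ m, Reproduces hh (s m) := by
    intro m
    refine Submodule.span_induction (p := fun u _ => Reproduces hh u) ?_ ?_ ?_ ?_ (hs m)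
    · rintro u ⟨k, χ, hk⟩
      filter_upwards [hk] with Y hY w
      rw [hY, inner_coherent_monomial hh hk]
    · filter_upwards [Lp.coeFn_zero (EuclideanSpace ℂ (Fin (n + 1))) 2 (mu (n + 1) h)] with Y hY w
      rw [hY, inner_zero_right, Pi.zero_apply, inner_zero_right]
    · intro u v _ _ hu hv
      filter_upwards [hu, hv, Lp.coeFn_add u v] with Y h1 h2 h3 w
      rw [h3, Pi.add_apply, inner_add_right, inner_add_right, h1, h2]
    · intro c u _ hu
      filter_upwards [hu, Lp.coeFn_smul c u] with Y h1 h3 w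
      rw [h3, Pi.smul_apply, inner_smul_right, inner_smul_right, h1]
  -- A single null set has to serve all vectors w, so the subsequence is chosen before w.
  obtain ⟨ns, hns, hae⟩ := (tendstoInMeasure_of_tendsto_Lp hlim).exists_seq_tendsto_ae
  filter_upwards [hae, ae_all_iff.mpr hspan] with Y h1 h2 w
  refine tendsto_nhds_unique (f := fun m => inner ℂ (coherent hh Y w : L2 (n + 1) h) (s (ns m)))
    (l := atTop) ?_ ?_
  · exact (Filter.Tendsto.inner tendsto_const_nhds (hlim.comp hns.tendsto_atTop))
  · simp only [h2]
    exact Filter.Tendsto.inner tendsto_const_nhds h1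

/-- Measurability of the symbol is known entry by entry, hence the expansion in matrix units. -/
theorem aestronglyMeasurable_act {N : ℕ} {μ : Measure (Omega N)}
    {φ : Omega N → Matrix (Fin N) (Fin N) ℂ}
    (hφ : ∀ i j, AEStronglyMeasurable (fun Z => φ Z i j) μ)
    {G : Omega N → EuclideanSpace ℂ (Fin N)} (hG : AEStronglyMeasurable G μ) :
    AEStronglyMeasurable (fun Z => act (φ Z) (G Z)) μ := by
  have e : (fun Z => act (φ Z) (G Z))
      = fun Z => ∑ i, ∑ j, φ Z i j • act (Matrix.single i j (1 : ℂ)) (G Z) := by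
    funext Z
    have h1 : φ Z = ∑ i, ∑ j, φ Z i j • Matrix.single i j (1 : ℂ) := by
      conv_lhs => rw [Matrix.matrix_eq_sum_single (φ Z)]
      simp only [Matrix.smul_single, smul_eq_mul, mul_one]
    have h2 : act (φ Z) = ∑ i, ∑ j, φ Z i j • act (Matrix.single i j (1 : ℂ)) := by
      conv_lhs => rw [h1]
      simp only [act, map_sum, map_smul]
    rw [h2]
    simp only [sum_apply, smul_apply]
  rw [e]
  refine Finset.aestronglyMeasurable_fun_sum _ fun i _ =>
    Finset.aestronglyMeasurable_fun_sum _ fun j _ => (hφ i j).smul ?_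
  exact (ContinuousLinearMap.continuous _).comp_aestronglyMeasurable hG

theorem SpectralAE.act_sharp {n : ℕ} {h : ℝ} {q f : (Fin (n + 1) → ℂ) → ℂ}
    (hf : IsTailSymmetric f)
    {v : EuclideanSpace ℂ (Fin (n + 1))} {G : Omega (n + 1) → EuclideanSpace ℂ (Fin (n + 1))}
    (hG : SpectralAE h q v G) :
    SpectralAE h (fun d => f d * q d) v (fun Z => act (sharp f Z) (G Z)) := by
  filter_upwards [hG] with Z hZ U d hd
  rw [hZ U d hd, hd, sharp_unitaryConj hf, ← act_mul_apply, unitaryConj_mul]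
  rfl

theorem mem_toeplitz_domain {n : ℕ} {h : ℝ} {q f : (Fin (n + 1) → ℂ) → ℂ}
    (hf : IsTailSymmetric f)
    (hφ : ∀ i j, AEStronglyMeasurable (fun Z => sharp f Z i j) (mu (n + 1) h))
    {v : EuclideanSpace ℂ (Fin (n + 1))} {u : H (n + 1) h}
    (hu : SpectralAE h q v (u : L2 (n + 1) h))
    (hq : MemLp (fun d => f d * q d) 2 (gaussian (n + 1) h)) :
    u ∈ (toeplitz h (sharp f)).domain :=
  (hu.act_sharp hf).memLp (aestronglyMeasurable_act hφ (Lp.aestronglyMeasurable _)) hq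

theorem integrable_mul_cexp_conj {n : ℕ} {h : ℝ} (hh : 0 < h) {q : (Fin (n + 1) → ℂ) → ℂ}
    (hq : MemLp q 2 (gaussian (n + 1) h)) (c : ℂ) :
    Integrable (fun d => q d * Complex.exp (c * conj (d 0))) (gaussian (n + 1) h) :=
  hq.integrable_mul ((expGrowth_cexp_conj 0 c).memLp (by fun_prop) hh)

/-- The projection may be dropped because the coherent state already lies in 𝓗_h. What remains is a
pairing of spectral functions. -/
theorem inner_coherent_toeplitz {n : ℕ} {h : ℝ} (hh : 0 < h) {q f : (Fin (n + 1) → ℂ) → ℂ}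
    (hf : IsTailSymmetric f)
    (hφ : ∀ i j, AEStronglyMeasurable (fun Z => sharp f Z i j) (mu (n + 1) h))
    {v : EuclideanSpace ℂ (Fin (n + 1))} {u : H (n + 1) h}
    (hu : SpectralAE h q v (u : L2 (n + 1) h))
    (hq : MemLp (fun d => f d * q d) 2 (gaussian (n + 1) h))
    (hdom : u ∈ (toeplitz h (sharp f)).domain)
    {Y : Omega (n + 1)} {y : ℂ} {w : EuclideanSpace ℂ (Fin (n + 1))}
    (hw : act Y.1ᴴ w = conj y • w) :
    inner ℂ (coherent hh Y w) (toeplitz h (sharp f) ⟨u, hdom⟩)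
      = inner ℂ w v *
        ∫ d, f d * q d * Complex.exp (y / h * conj (d 0)) ∂(gaussian (n + 1) h) := by
  have hm : AEStronglyMeasurable (fun Z => act (sharp f Z) ((u : L2 (n + 1) h) Z))
    (mu (n + 1) h) := aestronglyMeasurable_act hφ (Lp.aestronglyMeasurable _)
  rw [← (hu.act_sharp hf).inner_coherent hh hm hw (integrable_mul_cexp_conj hh hq _)]
  have h1 : toeplitz h (sharp f) ⟨u, hdom⟩ = (H (n + 1) h).orthogonalProjectionOnto
      (mulOp h (sharp f) ⟨(u : L2 (n + 1) h), hdom⟩) := rfl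
  rw [h1, Submodule.inner_orthogonalProjectionOnto_eq_of_mem_left, L2.inner_def]
  refine integral_congr_ae ?_
  have h2 : (mulOp h (sharp f) ⟨(u : L2 (n + 1) h), hdom⟩ : Omega (n + 1) → _)
      =ᵐ[mu (n + 1) h] fun Z => act (sharp f Z) ((u : L2 (n + 1) h) Z) :=
    MemLp.coeFn_toLp (f := fun Z => act (sharp f Z) ((u : L2 (n + 1) h) Z)) hdom
  filter_upwards [h2] with Z hZ
  rw [hZ]

/-- At a point Z = U diag(y) U* the component of the image along the j-th column of U is, by the
reproducing property, its pairing with the coherent state at Z of that column. This pairing is the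
given integral at e_1 = y_j times the component of v, so the image is again a spectral function
applied to v and a second Toeplitz operator can be applied. -/
theorem toeplitz_spectralAE {n : ℕ} {h : ℝ} (hh : 0 < h) {q f : (Fin (n + 1) → ℂ) → ℂ}
    (hf : IsTailSymmetric f)
    (hφ : ∀ i j, AEStronglyMeasurable (fun Z => sharp f Z i j) (mu (n + 1) h))
    {v : EuclideanSpace ℂ (Fin (n + 1))} {u : H (n + 1) h}
    (hu : SpectralAE h q v (u : L2 (n + 1) h))
    (hq : MemLp (fun d => f d * q d) 2 (gaussian (n + 1) h))
    (hdom : u ∈ (toeplitz h (sharp f)).domain) :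
    SpectralAE h (fun e => ∫ d, f d * q d * Complex.exp (e 0 / h * conj (d 0))
      ∂(gaussian (n + 1) h)) v (toeplitz h (sharp f) ⟨u, hdom⟩ : L2 (n + 1) h) := by
  filter_upwards [reproduces_of_mem_H hh (toeplitz h (sharp f) ⟨u, hdom⟩).2] with Z hZ U y hy
  subst hy
  rw [act_unitaryConj_eq_sum]
  conv_lhs => rw [eq_sum_colBasis U (((toeplitz h (sharp f) ⟨u, hdom⟩ : H (n + 1) h) :
    L2 (n + 1) h) (unitaryConj U y))]
  refine Finset.sum_congr rfl fun j _ => ?_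
  congr 1
  rw [← hZ (colBasis U j)]
  have := inner_coherent_toeplitz hh hf hφ hu hq hdom (act_conjTranspose_colBasis U y j)
  rw [Submodule.coe_inner] at this
  rw [this, mul_comm]
  rfl

/-! ### The Berezin transform -/

/-- Domains are subspaces and the coherent state is linear in its vector, so an eigenbasis suffices.
-/
theorem coherent_mem_of_colBasis {N : ℕ} {h : ℝ} (hh : 0 < h) {X : Omega N} (V : UN N)
    {D : Submodule ℂ (H N h)} (hD : ∀ j, coherent hh X (colBasis V j) ∈ D)
    (χ : EuclideanSpace ℂ (Fin N)) : coherent hh X χ ∈ D := by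
  change coherentMap hh X χ ∈ D
  rw [eq_sum_colBasis V χ, map_sum]
  refine Submodule.sum_mem _ fun j _ => ?_
  rw [map_smul]
  exact Submodule.smul_mem _ _ (hD j)

theorem kernel_self {n : ℕ} {h : ℝ} (hh : 0 < h) (V : UN (n + 1)) (x : Fin (n + 1) → ℂ) :
    kernel h (unitaryConj V x) (unitaryConj V x)
      = (unitaryConj V fun j => (Real.exp (‖x j‖ ^ 2 / h) : ℂ)).1 := by
  have hj : ∀ j, act (kernel h (unitaryConj V x) (unitaryConj V x)) (colBasis V j)
      = act (unitaryConj V fun j => (Real.exp (‖x j‖ ^ 2 / h) : ℂ)).1 (colBasis V j) := by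
    intro j
    have := kernelFun_unitaryConj hh (act_conjTranspose_colBasis V x j) V x
    rw [kernelFun] at this
    rw [this, act_unitaryConj_colBasis, act_unitaryConj_colBasis, Complex.mul_conj']
    push_cast
    rfl
  refine Matrix.ext fun a b => ?_
  rw [← act_single (kernel h _ _) a b, ← act_single (unitaryConj V _).1 a b,
    act_single_eq_sum V b]
  simp only [map_sum, map_smul, hj]

theorem inner_smul_smul_H {N : ℕ} {h : ℝ} (a b : ℂ) (u v : H N h) :
    inner ℂ (a • u) (b • v) = conj a * b * inner ℂ u v := by
  rw [Submodule.coe_inner, Submodule.coe_inner, Submodule.coe_smul, Submodule.coe_smul,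
    inner_smul_left, inner_smul_right, mul_assoc]

-- In the eigenbasis of X the matrix M is diagonal with entries m_j, and so is K(X,X)^{-1/2}, with
-- entries e^{-|x_j|²/(2h)}. The two outer factors combine to e^{-|x_j|²/h}.
open Classical in
theorem berezin_unitaryConj {n : ℕ} {h : ℝ} (hh : 0 < h) (T : H (n + 1) h →ₗ.[ℂ] H (n + 1) h)
    (V : UN (n + 1)) (x m : Fin (n + 1) → ℂ)
    (hdom : ∀ j, coherent hh (unitaryConj V x) (colBasis V j) ∈ T.domain)
    (hm : ∀ i j, inner ℂ (coherent hh (unitaryConj V x) (colBasis V i)) (T ⟨_, hdom j⟩)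
      = inner ℂ (colBasis V i) (colBasis V j) * m j) :
    berezin hh T (unitaryConj V x)
      = (unitaryConj V fun j => (Real.exp (-‖x j‖ ^ 2 / h) : ℂ) * m j).1 := by
  set X := unitaryConj V x with hX
  have hall : ∀ χ, coherentMap hh X χ ∈ T.domain := coherent_mem_of_colBasis hh V hdom
  -- M is defined through the standard basis. Viewing T K_{X,χ} as a linear map of χ allows its
  -- computation in the eigenbasis.
  let S : EuclideanSpace ℂ (Fin (n + 1)) →ₗ[ℂ] H (n + 1) h :=
    T.toFun ∘ₗ (coherentMap hh X).codRestrict T.domain hall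
  have hM : ∀ a b, inner ℂ (coherentMap hh X (EuclideanSpace.single a 1))
      (S (EuclideanSpace.single b 1)) = (unitaryConj V m).1 a b := by
    intro a b
    have hS : ∀ i j, inner ℂ (coherentMap hh X (colBasis V i)) (S (colBasis V j))
        = if i = j then m j else 0 := by
      intro i j
      refine (hm i j).trans ?_
      rw [inner_colBasis]
      split_ifs <;> simp
    rw [act_single_eq_sum V a, act_single_eq_sum V b, map_sum, map_sum, sum_inner,
      unitaryConj_apply]
    refine Finset.sum_congr rfl fun i _ => ?_
    rw [inner_sum, Finset.sum_eq_single i]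
    · rw [map_smul, map_smul, inner_smul_smul_H, hS, if_pos rfl, Complex.conj_conj]
      ring
    · intro j _ hji
      rw [map_smul, map_smul, inner_smul_smul_H, hS, if_neg hji.symm]
      ring
    · simp
  -- All coherent states lie in the domain, so the default value 0 never occurs.
  have hM' : (Matrix.of fun a b =>
      if hb : coherent hh X (EuclideanSpace.single b 1) ∈ T.domain then
        inner ℂ (coherent hh X (EuclideanSpace.single a 1)) (T ⟨_, hb⟩)
      else 0) = (unitaryConj V m).1 := by
    ext a b
    have hb : coherent hh X (EuclideanSpace.single b 1) ∈ T.domain := hall _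
    rw [Matrix.of_apply, dif_pos hb]
    exact hM a b
  have hR : cfc (fun x : ℝ => (Real.sqrt x)⁻¹) (kernel h X X)
      = (unitaryConj V fun j => (((Real.sqrt (Real.exp (‖x j‖ ^ 2 / h)))⁻¹ : ℝ) : ℂ)).1 := by
    rw [hX, kernel_self hh]
    exact cfc_unitaryConj V (fun j => Real.exp (‖x j‖ ^ 2 / h)) _
  have hB : berezin hh T X = cfc (fun x : ℝ => (Real.sqrt x)⁻¹) (kernel h X X)
      * (Matrix.of fun a b =>
      if hb : coherent hh X (EuclideanSpace.single b 1) ∈ T.domain then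
        inner ℂ (coherent hh X (EuclideanSpace.single a 1)) (T ⟨_, hb⟩)
      else 0) * cfc (fun x : ℝ => (Real.sqrt x)⁻¹) (kernel h X X) := rfl
  rw [hB, hM', hR, unitaryConj_mul, unitaryConj_mul]
  congr 2
  funext j
  have hs : (Real.sqrt (Real.exp (‖x j‖ ^ 2 / h)))⁻¹ * (Real.sqrt (Real.exp (‖x j‖ ^ 2 / h)))⁻¹
      = Real.exp (-‖x j‖ ^ 2 / h) := by
    rw [← mul_inv, Real.mul_self_sqrt (Real.exp_pos _).le, ← Real.exp_neg, neg_div]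
  rw [← hs]
  push_cast
  ring

/-! ### Asymptotic expansions of Gaussian averages -/

section Heat

/-- Combine (1 + t)^m ≤ m! e^{1+t} with t - c t² ≤ 1/(4c). -/
theorem one_add_pow_mul_exp_le {c : ℝ} (hc : 0 < c) (m : ℕ) {t : ℝ} (ht : 0 ≤ t) :
    (1 + t) ^ m * Real.exp (-c * t ^ 2) ≤ m.factorial * Real.exp (1 + 1 / (4 * c)) := by
  have h1 := Real.pow_div_factorial_le_exp (1 + t) (by positivity) m
  rw [div_le_iff₀ (by positivity)] at h1
  have h2 : Real.exp (1 + t) * Real.exp (-c * t ^ 2) ≤ Real.exp (1 + 1 / (4 * c)) := by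
    rw [← Real.exp_add, Real.exp_le_exp]
    have h3 : 1 / (4 * c) - t + c * t ^ 2 = (1 - 2 * c * t) ^ 2 / (4 * c) := by
      field_simp; ring
    have : 0 ≤ (1 - 2 * c * t) ^ 2 / (4 * c) := by positivity
    linarith
  calc (1 + t) ^ m * Real.exp (-c * t ^ 2)
      ≤ Real.exp (1 + t) * m.factorial * Real.exp (-c * t ^ 2) := by gcongr
    _ = m.factorial * (Real.exp (1 + t) * Real.exp (-c * t ^ 2)) := by ring
    _ ≤ _ := by gcongr

variable {E : Type*} [NormedAddCommGroup E] [NormedSpace ℝ E] [FiniteDimensional ℝ E]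
  [MeasurableSpace E] [BorelSpace E] (μ : Measure E) [μ.IsAddHaarMeasure]

theorem integrable_one_add_norm_pow_mul_exp {c : ℝ} (hc : 0 < c) (k : ℕ) :
    Integrable (fun y : E => (1 + ‖y‖) ^ k * Real.exp (-c * ‖y‖ ^ 2)) μ := by
  -- Decay of order one more than the dimension makes (1 + ‖y‖)^{-r} integrable; the Gaussian
  -- absorbs the powers k + r.
  set r := Module.finrank ℝ E + 1 with hr
  have h1 := (integrable_one_add_norm (μ := μ) (r := (r : ℝ)) (by
    rw [hr]; push_cast; linarith)).const_mul
      (((k + r).factorial : ℝ) * Real.exp (1 + 1 / (4 * c)))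
  refine h1.mono' (Continuous.aestronglyMeasurable (by fun_prop))
    (Eventually.of_forall fun y => ?_)
  rw [Real.norm_of_nonneg (by positivity), Real.rpow_neg (by positivity), Real.rpow_natCast,
    ← div_eq_mul_inv, le_div_iff₀ (by positivity)]
  have := one_add_pow_mul_exp_le hc (k + r) (norm_nonneg y)
  rw [pow_add] at this
  linarith

/-- A weight `w` with Gaussian decay together with a differential operator `L` such that the averages
`∫ F (p + √t y) w(y) dy` solve the evolution equation of `L`. -/
structure HeatPair (w : E → ℂ) (L : (E → ℂ) → E → ℂ) : Prop where
  continuous : Continuous w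
  bound : ∃ A c : ℝ, 0 < c ∧ ∀ y, ‖w y‖ ≤ A * Real.exp (-c * ‖y‖ ^ 2)
  mass : ∫ y, w y ∂μ = 1
  smooth : ∀ F, ContDiff ℝ ∞ F → ContDiff ℝ ∞ (L F)
  support : ∀ F, HasCompactSupport F → HasCompactSupport (L F)
  local' : ∀ F G p, F =ᶠ[𝓝 p] G → L F =ᶠ[𝓝 p] L G
  -- The factor 2s is chosen to cancel the derivative 1/(2√t) of s = √t.
  parts : ∀ F, ContDiff ℝ ∞ F → HasCompactSupport F → ∀ (p : E) (s : ℝ), 0 < s →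
    ∫ y, fderiv ℝ F (p + s • y) y * w y ∂μ = 2 * s * ∫ y, L F (p + s • y) * w y ∂μ

variable {μ} {w : E → ℂ} {L : (E → ℂ) → E → ℂ}

theorem HeatPair.integrable_pow (hw : HeatPair μ w L) (k : ℕ) :
    Integrable (fun y => ‖y‖ ^ k * ‖w y‖) μ := by
  obtain ⟨A, c, hc, hb⟩ := hw.bound
  refine ((integrable_one_add_norm_pow_mul_exp μ hc k).const_mul A).mono'
    (Continuous.aestronglyMeasurable (by have := hw.continuous; fun_prop))
    (Eventually.of_forall fun y => ?_)
  rw [Real.norm_of_nonneg (by positivity)]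
  calc ‖y‖ ^ k * ‖w y‖ ≤ (1 + ‖y‖) ^ k * (A * Real.exp (-c * ‖y‖ ^ 2)) := by
        refine mul_le_mul ?_ (hb y) (norm_nonneg _) (by positivity)
        gcongr; linarith
    _ = _ := by ring

theorem HeatPair.continuous_average (hw : HeatPair μ w L) {F : E → ℂ} (hF : Continuous F)
    (hc : HasCompactSupport F) (p : E) :
    Continuous fun s : ℝ => ∫ y, F (p + s • y) * w y ∂μ := by
  obtain ⟨C, hC⟩ := hc.exists_bound_of_continuous hF
  have hwc := hw.continuous
  have hi := (hw.integrable_pow 0).const_mul C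
  simp only [pow_zero, one_mul] at hi
  refine continuous_of_dominated (bound := fun y => C * ‖w y‖) (fun s => ?_) (fun s => ?_) hi ?_
  · exact Continuous.aestronglyMeasurable (by fun_prop)
  · refine Eventually.of_forall fun y => ?_
    rw [norm_mul]
    gcongr
    exact hC _
  · exact Eventually.of_forall fun y => by fun_prop

theorem HeatPair.norm_average_le (hw : HeatPair μ w L) {F : E → ℂ} (hF : Continuous F)
    (hc : HasCompactSupport F) (p : E) :
    ∃ C : ℝ, ∀ s : ℝ, ‖∫ y, F (p + s • y) * w y ∂μ‖ ≤ C := by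
  obtain ⟨C, hC⟩ := hc.exists_bound_of_continuous hF
  have hi := (hw.integrable_pow 0).const_mul C
  simp only [pow_zero, one_mul] at hi
  refine ⟨∫ y, C * ‖w y‖ ∂μ, fun s => norm_integral_le_of_norm_le hi
    (Eventually.of_forall fun y => ?_)⟩
  rw [norm_mul]
  gcongr
  exact hC _

/-- Differentiation under the integral: F has a bounded derivative, so C ‖y‖ |w(y)| dominates
uniformly in s. -/
theorem HeatPair.hasDerivAt_average (hw : HeatPair μ w L) {F : E → ℂ} (hF : ContDiff ℝ ∞ F)
    (hc : HasCompactSupport F) (p : E) (s : ℝ) :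
    HasDerivAt (fun s : ℝ => ∫ y, F (p + s • y) * w y ∂μ)
      (∫ y, fderiv ℝ F (p + s • y) y * w y ∂μ) s := by
  have hF' : Continuous (fderiv ℝ F) := hF.continuous_fderiv (by simp)
  obtain ⟨C, hC⟩ := (hc.fderiv (𝕜 := ℝ)).exists_bound_of_continuous hF'
  obtain ⟨C', hC'⟩ := hc.exists_bound_of_continuous hF.continuous
  have hwc := hw.continuous
  have hFc := hF.continuous
  have hi := (hw.integrable_pow 1).const_mul C
  have hi0 := (hw.integrable_pow 0).const_mul C'
  simp only [pow_zero, one_mul] at hi0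
  refine (hasDerivAt_integral_of_dominated_loc_of_deriv_le (μ := μ) (x₀ := s) (s := Set.univ)
    (F := fun s y => F (p + s • y) * w y) (F' := fun s y => fderiv ℝ F (p + s • y) y * w y)
    (bound := fun y => C * (‖y‖ ^ 1 * ‖w y‖)) univ_mem
    (Eventually.of_forall fun t => Continuous.aestronglyMeasurable (by fun_prop))
    (hi0.mono' (Continuous.aestronglyMeasurable (by fun_prop)) (Eventually.of_forall fun y => ?_))
    (Continuous.aestronglyMeasurable ?_) (Eventually.of_forall fun y t _ => ?_) hi
    (Eventually.of_forall fun y t _ => ?_)).2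
  · rw [norm_mul]; gcongr; exact hC' _
  · exact ((hF'.comp (by fun_prop)).clm_apply continuous_id).mul hwc
  · rw [norm_mul, pow_one, ← mul_assoc]
    gcongr
    exact (ContinuousLinearMap.le_opNorm _ _).trans (by gcongr; exact hC _)
  · have h1 : HasDerivAt (fun t : ℝ => p + t • y) y t := by
      simpa using ((hasDerivAt_id t).smul_const y).const_add p
    have h2 := ((hF.differentiable (by simp)) (p + t • y)).hasFDerivAt.comp_hasDerivAt t h1
    exact h2.mul_const (w y)

/-- The evolution equation: in the variable t = s² the derivative of the average of F is the average
of L F. -/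
theorem HeatPair.hasDerivAt_average_sqrt (hw : HeatPair μ w L) {F : E → ℂ} (hF : ContDiff ℝ ∞ F)
    (hc : HasCompactSupport F) (p : E) {t : ℝ} (ht : 0 < t) :
    HasDerivAt (fun t : ℝ => ∫ y, F (p + √t • y) * w y ∂μ)
      (∫ y, L F (p + √t • y) * w y ∂μ) t := by
  have h1 := (hw.hasDerivAt_average hF hc p (√t)).scomp t (Real.hasDerivAt_sqrt ht.ne')
  have hs : 0 < √t := Real.sqrt_pos.mpr ht
  rw [hw.parts F hF hc p _ hs] at h1
  refine h1.congr_deriv ?_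
  have : ((√t : ℝ) : ℂ) ≠ 0 := by exact_mod_cast hs.ne'
  rw [Complex.real_smul]
  push_cast
  field_simp

/-- Induction on m for all F at once: by the evolution equation, the derivative of the remainder of
order m + 1 for F is the remainder of order m for L F. The remainder vanishes at t = 0, where the
weight has mass 1, so the mean value inequality gains one power of t. -/
theorem HeatPair.expansion_of_hasCompactSupport (hw : HeatPair μ w L) (p : E) (m : ℕ) :
    ∀ F : E → ℂ, ContDiff ℝ ∞ F → HasCompactSupport F → ∃ C : ℝ, ∀ t : ℝ, 0 < t →
      ‖∫ y, F (p + √t • y) * w y ∂μ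
        - ∑ r ∈ Finset.range m, (t : ℂ) ^ r * (1 / r.factorial * (L^[r] F) p)‖ ≤ C * t ^ m := by
  induction m with
  | zero =>
    intro F hF hc
    obtain ⟨C, hC⟩ := hw.norm_average_le hF.continuous hc p
    exact ⟨C, fun t _ => by simpa using hC (√t)⟩
  | succ m ih =>
    intro F hF hc
    obtain ⟨C, hC⟩ := ih (L F) (hw.smooth F hF) (hw.support F hc)
    set D : ℝ → ℂ := fun t => ∫ y, F (p + √t • y) * w y ∂μ
        - ∑ r ∈ Finset.range (m + 1), (t : ℂ) ^ r * (1 / r.factorial * (L^[r] F) p) with hD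
    have hC0 : 0 ≤ C := by simpa using (norm_nonneg _).trans (hC 1 one_pos)
    have hDc : Continuous D := by
      refine ((hw.continuous_average hF.continuous hc p).comp Real.continuous_sqrt).sub ?_
      fun_prop
    have hD0 : D 0 = 0 := by
      simp only [hD, Real.sqrt_zero, zero_smul, add_zero, integral_const_mul, hw.mass]
      rw [Finset.sum_range_succ', Finset.sum_eq_zero]
      · simp
      · intro r _; simp
    have hDd : ∀ t, 0 < t → HasDerivAt D (∫ y, L F (p + √t • y) * w y ∂μ
        - ∑ r ∈ Finset.range m, (t : ℂ) ^ r * (1 / r.factorial * (L^[r] (L F)) p)) t := by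
      intro t ht
      refine (hw.hasDerivAt_average_sqrt hF hc p ht).sub ?_
      have h1 : ∀ r ∈ Finset.range (m + 1), HasDerivAt
          (fun t : ℝ => (t : ℂ) ^ r * (1 / r.factorial * (L^[r] F) p))
          (r * (t : ℂ) ^ (r - 1) * (1 / r.factorial * (L^[r] F) p)) t := by
        intro r _
        have := (Complex.ofRealCLM.hasDerivAt (x := t)).pow r
        have h2 := this.mul_const (1 / (r.factorial : ℂ) * (L^[r] F) p)
        refine (h2.congr_deriv ?_)
        simp
      refine (HasDerivAt.fun_sum h1).congr_deriv ?_
      rw [Finset.sum_range_succ']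
      simp only [Nat.cast_zero, zero_mul, add_zero, Nat.add_sub_cancel]
      refine Finset.sum_congr rfl fun r _ => ?_
      rw [Nat.factorial_succ, Function.iterate_succ_apply]
      have h3 : (r.factorial : ℂ) ≠ 0 := by exact_mod_cast r.factorial_ne_zero
      have h4 : ((r : ℂ) + 1) ≠ 0 := by exact_mod_cast r.succ_ne_zero
      push_cast
      field_simp
    refine ⟨C, fun t ht => ?_⟩
    -- The square root is not differentiable at 0, so the estimate is made on [ε, t], and continuity
    -- of the remainder then allows ε → 0.
    have hmv : ∀ ε, 0 < ε → ε < t → ‖D t - D ε‖ ≤ C * t ^ (m + 1) := by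
      intro ε hε hεt
      have h1 := (convex_Icc ε t).norm_image_sub_le_of_norm_hasDerivWithin_le (f := D)
        (C := C * t ^ m) (fun s hs => (hDd s (hε.trans_le hs.1)).hasDerivWithinAt)
        (fun s hs => (hC s (hε.trans_le hs.1)).trans (by
          have := hε.trans_le hs.1
          gcongr
          exact hs.2))
        (Set.left_mem_Icc.mpr hεt.le) (Set.right_mem_Icc.mpr hεt.le)
      refine h1.trans ?_
      rw [Real.norm_of_nonneg (by linarith), pow_succ, ← mul_assoc]
      gcongr
      linarith
    have hlim : Tendsto (fun ε => ‖D t - D ε‖) (𝓝[>] 0) (𝓝 ‖D t - D 0‖) :=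
      ((continuous_const.sub hDc).norm.tendsto 0).mono_left nhdsWithin_le_nhds
    rw [hD0, sub_zero] at hlim
    refine le_of_tendsto hlim ?_
    filter_upwards [Ioo_mem_nhdsGT ht] with ε hε
    exact hmv ε hε.1 hε.2

omit [FiniteDimensional ℝ E] [BorelSpace E] [μ.IsAddHaarMeasure] in
theorem HeatPair.iterate_eventuallyEq (hw : HeatPair μ w L) {F G : E → ℂ} {p : E}
    (h : F =ᶠ[𝓝 p] G) (r : ℕ) : L^[r] F =ᶠ[𝓝 p] L^[r] G := by
  induction r with
  | zero => exact h
  | succ r ih =>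
    rw [Function.iterate_succ_apply', Function.iterate_succ_apply']
    exact hw.local' _ _ _ ih

/-- The averages of a function of Gaussian growth which vanishes near `p` are negligible. -/
theorem HeatPair.tail (hw : HeatPair μ w L) {G : E → ℂ} (hG : Continuous G) {p : E}
    {c₁ : ℝ} (hi : Integrable (fun y => G (p + y) * Real.exp (-c₁ * ‖y‖ ^ 2)) μ) :
    ∃ δ : ℝ, 0 < δ ∧ (∀ t : ℝ, 0 < t → t < δ → Integrable (fun y => G (p + √t • y) * w y) μ) ∧
      ((∀ y, ‖y‖ < 1 → G (p + y) = 0) → ∀ m : ℕ, ∃ C : ℝ, ∀ t : ℝ, 0 < t → t < δ →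
        ‖∫ y, G (p + √t • y) * w y ∂μ‖ ≤ C * t ^ m) := by
  obtain ⟨A, c, hc, hb⟩ := hw.bound
  have hA : 0 ≤ A := by
    have := (norm_nonneg _).trans (hb 0)
    simpa using this
  -- `c₁` may be nonpositive. The maximum makes c/c₂ a positive threshold below which c/t ≥ c₁, so
  -- the rescaled weight decays at least as fast as e^{-c₁‖y‖²}.
  set c₂ := max c₁ 1 with hc₂
  have hc₂0 : 0 < c₂ := lt_max_of_lt_right one_pos
  have hwc := hw.continuous
  have hi2 : Integrable (fun y => ‖G (p + y) * Real.exp (-c₁ * ‖y‖ ^ 2)‖) μ := hi.norm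
  have hscale : ∀ t : ℝ, 0 < t → ∀ y : E, ‖(√t)⁻¹ • y‖ ^ 2 = ‖y‖ ^ 2 / t := by
    intro t ht y
    rw [norm_smul, norm_inv, Real.norm_of_nonneg (Real.sqrt_nonneg t), mul_pow, inv_pow,
      Real.sq_sqrt ht.le]
    field_simp
  have hle : ∀ t : ℝ, 0 < t → t < c / c₂ → c₁ ≤ c / t := by
    intro t ht htc
    rw [lt_div_iff₀ hc₂0] at htc
    refine (le_max_left c₁ 1).trans ?_
    rw [le_div_iff₀ ht]
    linarith
  have hpt : ∀ t : ℝ, 0 < t → t < c / c₂ → ∀ y, ‖G (p + y) * w ((√t)⁻¹ • y)‖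
      ≤ A * ‖G (p + y) * Real.exp (-c₁ * ‖y‖ ^ 2)‖ := by
    intro t ht htc y
    rw [norm_mul, norm_mul, Complex.norm_real, Real.norm_of_nonneg (Real.exp_pos _).le]
    have h1 := hb ((√t)⁻¹ • y)
    rw [hscale t ht] at h1
    have h2 : Real.exp (-c * (‖y‖ ^ 2 / t)) ≤ Real.exp (-c₁ * ‖y‖ ^ 2) := by
      rw [Real.exp_le_exp]
      have := mul_le_mul_of_nonneg_right (hle t ht htc) (sq_nonneg ‖y‖)
      have e : -c * (‖y‖ ^ 2 / t) = -(c / t * ‖y‖ ^ 2) := by ring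
      rw [e]; linarith
    calc ‖G (p + y)‖ * ‖w ((√t)⁻¹ • y)‖
        ≤ ‖G (p + y)‖ * (A * Real.exp (-c₁ * ‖y‖ ^ 2)) := by
          gcongr
          exact h1.trans (by gcongr)
      _ = _ := by ring
  have hint : ∀ t : ℝ, 0 < t → t < c / c₂ →
      Integrable (fun y => G (p + y) * w ((√t)⁻¹ • y)) μ := fun t ht htc =>
    (hi2.const_mul A).mono' (Continuous.aestronglyMeasurable (by fun_prop))
      (Eventually.of_forall (hpt t ht htc))
  -- Substituting z = √t y moves the scaling from the function onto the weight, at the cost of a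
  -- Jacobian.
  have hcomp : ∀ t : ℝ, 0 < t → (fun y => G (p + √t • y) * w y)
      = fun y => (fun z => G (p + z) * w ((√t)⁻¹ • z)) (√t • y) := by
    intro t ht
    funext y
    simp only
    rw [smul_smul, inv_mul_cancel₀ (Real.sqrt_pos.mpr ht).ne', one_smul]
  refine ⟨min (c / c₂) 1, lt_min (div_pos hc hc₂0) one_pos, fun t ht htδ => ?_, fun hG0 m => ?_⟩
  · rw [hcomp t ht]
    exact (hint t ht (htδ.trans_le (min_le_left _ _))).comp_smul (Real.sqrt_pos.mpr ht).ne'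
  · set k := Module.finrank ℝ E with hk
    set I := ∫ y, ‖G (p + y) * Real.exp (-c₁ * ‖y‖ ^ 2)‖ ∂μ with hI
    have hI0 : 0 ≤ I := integral_nonneg fun _ => norm_nonneg _
    refine ⟨A * Real.exp c₁ * I * ((m + k).factorial / c ^ (m + k)), fun t ht htδ => ?_⟩
    have htc := htδ.trans_le (min_le_left _ _)
    have ht1 := htδ.trans_le (min_le_right _ _)
    rw [hcomp t ht, Measure.integral_comp_smul μ (fun z => G (p + z) * w ((√t)⁻¹ • z)), norm_smul, Real.norm_eq_abs, abs_abs]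
    have hs := Real.sqrt_pos.mpr ht
    -- A crude bound of the Jacobian by an integral power of t, valid because δ ≤ 1.
    have hb1 : |((√t) ^ k)⁻¹| ≤ (t ^ k)⁻¹ := by
      rw [abs_of_pos (by positivity)]
      gcongr
      refine Real.le_sqrt_of_sq_le ?_
      nlinarith
    have hb2 : ‖∫ y, G (p + y) * w ((√t)⁻¹ • y) ∂μ‖
        ≤ A * Real.exp c₁ * I * Real.exp (-(c / t)) := by
      have e : A * Real.exp c₁ * I * Real.exp (-(c / t))
          = ∫ y, (A * Real.exp c₁ * Real.exp (-(c / t))) *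
            ‖G (p + y) * Real.exp (-c₁ * ‖y‖ ^ 2)‖ ∂μ := by
        rw [integral_const_mul]; ring
      rw [e]
      refine norm_integral_le_of_norm_le (hi2.const_mul _) (Eventually.of_forall fun y => ?_)
      rcases lt_or_ge ‖y‖ 1 with hy | hy
      · rw [hG0 y hy]; simp
      · rw [norm_mul, norm_mul, Complex.norm_real, Real.norm_of_nonneg (Real.exp_pos _).le]
        have h1 := hb ((√t)⁻¹ • y)
        rw [hscale t ht] at h1
        -- This is (c/t - c₁)(‖y‖² - 1) ≥ 0 outside the unit ball; it extracts the small factor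
        -- e^{-c/t} and still leaves an integrable weight.
        have h2 : Real.exp (-c * (‖y‖ ^ 2 / t))
            ≤ Real.exp c₁ * Real.exp (-(c / t)) * Real.exp (-c₁ * ‖y‖ ^ 2) := by
          rw [← Real.exp_add, ← Real.exp_add, Real.exp_le_exp]
          have h3 := hle t ht htc
          have h4 : 1 ≤ ‖y‖ ^ 2 := one_le_pow₀ hy
          have e : -c * (‖y‖ ^ 2 / t) = -(c / t * ‖y‖ ^ 2) := by ring
          rw [e]
          nlinarith
        calc ‖G (p + y)‖ * ‖w ((√t)⁻¹ • y)‖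
            ≤ ‖G (p + y)‖ * (A * (Real.exp c₁ * Real.exp (-(c / t))
              * Real.exp (-c₁ * ‖y‖ ^ 2))) := by
              gcongr
              exact h1.trans (by gcongr)
          _ = _ := by ring
    -- The exponent m + k is taken so that k powers of t pay for the Jacobian.
    have hb3 : Real.exp (-(c / t)) ≤ (m + k).factorial / c ^ (m + k) * t ^ (m + k) := by
      have h1 := Real.pow_div_factorial_le_exp (c / t) (by positivity) (m + k)
      rw [Real.exp_neg]
      refine (inv_anti₀ (by positivity) h1).trans (le_of_eq ?_)
      rw [div_pow]
      field_simp
    calc |((√t) ^ k)⁻¹| * ‖∫ y, G (p + y) * w ((√t)⁻¹ • y) ∂μ‖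
        ≤ (t ^ k)⁻¹ * (A * Real.exp c₁ * I *
            ((m + k).factorial / c ^ (m + k) * t ^ (m + k))) := by
          refine mul_le_mul hb1 (hb2.trans ?_) (norm_nonneg _) (by positivity)
          gcongr
      _ = _ := by
          rw [pow_add t]
          field_simp

/-- The asymptotic expansion of Gaussian averages of a smooth function of Gaussian growth. -/
theorem HeatPair.expansion (hw : HeatPair μ w L) {F : E → ℂ} (hF : ContDiff ℝ ∞ F) {p : E}
    {c₁ : ℝ} (hi : Integrable (fun y => F (p + y) * Real.exp (-c₁ * ‖y‖ ^ 2)) μ) (m : ℕ) :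
    ∃ C δ : ℝ, 0 < δ ∧ ∀ t : ℝ, 0 < t → t < δ →
      ‖∫ y, F (p + √t • y) * w y ∂μ
        - ∑ r ∈ Finset.range m, (t : ℂ) ^ r * (1 / r.factorial * (L^[r] F) p)‖ ≤ C * t ^ m := by
  -- The cutoff equals 1 on the unit ball, the region where `HeatPair.tail` needs the remaining part
  -- to vanish.
  let η : ContDiffBump p := ⟨1, 2, one_pos, one_lt_two⟩
  have hη : ContDiff ℝ ∞ fun x => ((η x : ℝ) : ℂ) := Complex.ofRealCLM.contDiff.comp η.contDiff
  set F₁ : E → ℂ := fun x => (η x : ℂ) * F x with hF₁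
  set G : E → ℂ := fun x => (1 - (η x : ℂ)) * F x with hGdef
  have hF₁s : ContDiff ℝ ∞ F₁ := hη.mul hF
  have hF₁c : HasCompactSupport F₁ :=
    HasCompactSupport.mul_right (η.hasCompactSupport.comp_left (g := fun x : ℝ => (x : ℂ))
      Complex.ofReal_zero)
  have hGc : Continuous G := ((contDiff_const.sub hη).mul hF).continuous
  have hGi : Integrable (fun y => G (p + y) * Real.exp (-c₁ * ‖y‖ ^ 2)) μ := by
    refine hi.mono (Continuous.aestronglyMeasurable (by fun_prop))
      (Eventually.of_forall fun y => ?_)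
    change ‖(1 - (η (p + y) : ℂ)) * F (p + y) * _‖ ≤ _
    rw [norm_mul, norm_mul, norm_mul]
    have : ‖(1 - (η (p + y) : ℂ))‖ ≤ 1 := by
      have e : (1 - (η (p + y) : ℂ)) = ((1 - η (p + y) : ℝ) : ℂ) := by push_cast; rfl
      rw [e, Complex.norm_real, Real.norm_of_nonneg (by linarith [η.le_one (x := p + y)])]
      linarith [η.nonneg (x := p + y)]
    gcongr
    exact mul_le_of_le_one_left (norm_nonneg _) this
  have hG0 : ∀ y, ‖y‖ < 1 → G (p + y) = 0 := by
    intro y hy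
    have : η (p + y) = 1 := η.one_of_mem_closedBall (by
      rw [Metric.mem_closedBall, dist_eq_norm, add_sub_cancel_left]; exact hy.le)
    simp [hGdef, this]
  have hev : F₁ =ᶠ[𝓝 p] F := by
    filter_upwards [η.eventuallyEq_one] with x hx
    simp [hF₁, hx]
  obtain ⟨C₁, hC₁⟩ := hw.expansion_of_hasCompactSupport p m F₁ hF₁s hF₁c
  obtain ⟨δ, hδ, hint, htail⟩ := hw.tail hGc hGi
  obtain ⟨C₂, hC₂⟩ := htail hG0 m
  refine ⟨C₁ + C₂, δ, hδ, fun t ht htδ => ?_⟩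
  have hsplit : ∫ y, F (p + √t • y) * w y ∂μ
      = ∫ y, F₁ (p + √t • y) * w y ∂μ + ∫ y, G (p + √t • y) * w y ∂μ := by
    rw [← integral_add ?_ (hint t ht htδ)]
    · refine integral_congr_ae (Eventually.of_forall fun y => ?_)
      simp only [hF₁, hGdef]; ring
    · obtain ⟨M, hM⟩ := hF₁c.exists_bound_of_continuous hF₁s.continuous
      have h0 := (hw.integrable_pow 0).const_mul M
      simp only [pow_zero, one_mul] at h0
      have hwc := hw.continuous
      have hFc := hF₁s.continuous
      refine h0.mono' (Continuous.aestronglyMeasurable (by fun_prop))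
        (Eventually.of_forall fun y => ?_)
      rw [norm_mul]
      gcongr
      exact hM _
  have hcoef : ∀ r, (L^[r] F₁) p = (L^[r] F) p := fun r =>
    (hw.iterate_eventuallyEq hev r).self_of_nhds
  have h1 := hC₁ t ht
  simp only [hcoef] at h1
  rw [hsplit, add_sub_right_comm, add_mul]
  exact (norm_add_le _ _).trans (add_le_add h1 (hC₂ t ht htδ))

end Heat

/-! ### Smooth functions under real affine rescaling -/

section RealCalculus

variable {E : Type*} [NormedAddCommGroup E] [NormedSpace ℝ E]

theorem contDiff_fderiv_apply {F : E → ℂ} (hF : ContDiff ℝ ∞ F) (v : E) :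
    ContDiff ℝ ∞ fun x => fderiv ℝ F x v :=
  (hF.fderiv_right (m := ∞) (by simp)).clm_apply contDiff_const

theorem fderiv_fderiv_apply_comm {F : E → ℂ} (hF : ContDiff ℝ ∞ F) (x u v : E) :
    fderiv ℝ (fun y => fderiv ℝ F y u) x v = fderiv ℝ (fun y => fderiv ℝ F y v) x u := by
  have hd : DifferentiableAt ℝ (fderiv ℝ F) x :=
    ((hF.fderiv_right (m := ∞) (by simp)).differentiable (by simp)) x
  have h1 : ∀ u, fderiv ℝ (fun y => fderiv ℝ F y u) x = (fderiv ℝ (fderiv ℝ F) x).flip u := by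
    intro u
    have := fderiv_clm_apply hd (differentiableAt_const u)
    rw [this]
    simp
  have hs : IsSymmSndFDerivAt ℝ F x := hF.contDiffAt.isSymmSndFDerivAt (by
    simpa using (WithTop.coe_le_coe.mpr le_top : ((2 : ℕ∞) : WithTop ℕ∞) ≤ ∞))
  rw [h1, h1]
  exact hs.eq v u

theorem hasCompactSupport_comp_affine {G : E → ℂ} (hG : HasCompactSupport G) (p : E) {s : ℝ}
    (hs : 0 < s) : HasCompactSupport fun y => G (p + s • y) :=
  hG.comp_homeomorph ((Homeomorph.smulOfNeZero s hs.ne').trans (Homeomorph.addLeft p))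

theorem hasFDerivAt_comp_affine {G : E → ℂ} (hG : ContDiff ℝ ∞ G) (p : E) (s : ℝ) (y : E) :
    HasFDerivAt (fun y => G (p + s • y)) (s • fderiv ℝ G (p + s • y)) y := by
  have h1 : HasFDerivAt (fun y : E => p + s • y) (s • ContinuousLinearMap.id ℝ E) y :=
    ((hasFDerivAt_id y).const_smul s).const_add p
  refine (((hG.differentiable (by simp)) (p + s • y)).hasFDerivAt.comp y h1).congr_fderiv ?_
  ext u
  simp

theorem integrable_comp_affine_mul [MeasurableSpace E] [BorelSpace E] {μ : Measure E}
    [IsFiniteMeasureOnCompacts μ] {G w : E → ℂ} (hG : Continuous G) (hc : HasCompactSupport G)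
    (hw : Continuous w) (p : E) {s : ℝ} (hs : 0 < s) :
    Integrable (fun y => G (p + s • y) * w y) μ :=
  Continuous.integrable_of_hasCompactSupport (by fun_prop)
    (hasCompactSupport_comp_affine hc p hs).mul_right

end RealCalculus

/-! ### Wirtinger derivatives of smooth functions -/

section WirtingerCalculus

variable {E : Type*} [NormedAddCommGroup E] [NormedSpace ℂ E] [NormedSpace ℝ E]

theorem contDiff_dz {F : E → ℂ} (hF : ContDiff ℝ ∞ F) (v : E) : ContDiff ℝ ∞ (dz v F) :=
  ((contDiff_fderiv_apply hF v).sub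
    (contDiff_const.mul (contDiff_fderiv_apply hF (Complex.I • v)))).div_const 2

theorem contDiff_dzbar {F : E → ℂ} (hF : ContDiff ℝ ∞ F) (v : E) : ContDiff ℝ ∞ (dzbar v F) :=
  ((contDiff_fderiv_apply hF v).add
    (contDiff_const.mul (contDiff_fderiv_apply hF (Complex.I • v)))).div_const 2

theorem hasCompactSupport_dz {F : E → ℂ} (hF : HasCompactSupport F) (v : E) :
    HasCompactSupport (dz v F) := by
  have h1 := hF.fderiv (𝕜 := ℝ)
  exact h1.comp_left (g := fun T : E →L[ℝ] ℂ => (T v - Complex.I * T (Complex.I • v)) / 2) (by simp)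

theorem hasCompactSupport_dzbar {F : E → ℂ} (hF : HasCompactSupport F) (v : E) :
    HasCompactSupport (dzbar v F) := by
  have h1 := hF.fderiv (𝕜 := ℝ)
  exact h1.comp_left (g := fun T : E →L[ℝ] ℂ => (T v + Complex.I * T (Complex.I • v)) / 2) (by simp)

theorem eventuallyEq_dz {F G : E → ℂ} {p : E} (h : F =ᶠ[𝓝 p] G) (v : E) :
    dz v F =ᶠ[𝓝 p] dz v G := by
  filter_upwards [h.fderiv (𝕜 := ℝ)] with x hx
  rw [dz, dz, hx]

theorem eventuallyEq_dzbar {F G : E → ℂ} {p : E} (h : F =ᶠ[𝓝 p] G) (v : E) :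
    dzbar v F =ᶠ[𝓝 p] dzbar v G := by
  filter_upwards [h.fderiv (𝕜 := ℝ)] with x hx
  rw [dzbar, dzbar, hx]

/-- Both sides expand into second real derivatives in the directions u, I u and v, I v, which are
symmetric. -/
theorem dz_dzbar_comm {F : E → ℂ} (hF : ContDiff ℝ ∞ F) (u v x : E) :
    dz u (dzbar v F) x = dzbar v (dz u F) x := by
  have hd : ∀ u, DifferentiableAt ℝ (fun y => fderiv ℝ F y u) x := fun u =>
    ((contDiff_fderiv_apply hF u).differentiable (by simp)) x
  have h1 : ∀ v, HasFDerivAt (dzbar v F) ((1 / 2 : ℂ) • (fderiv ℝ (fun y => fderiv ℝ F y v) x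
      + Complex.I • fderiv ℝ (fun y => fderiv ℝ F y (Complex.I • v)) x)) x := by
    intro v
    have := (((hd v).hasFDerivAt).add (((hd (Complex.I • v)).hasFDerivAt).const_mul
      Complex.I)).const_mul (1 / 2 : ℂ)
    refine this.congr_of_eventuallyEq (Eventually.of_forall fun y => ?_)
    rw [dzbar]
    simp only [Pi.add_apply]
    ring
  have h2 : ∀ v, HasFDerivAt (dz v F) ((1 / 2 : ℂ) • (fderiv ℝ (fun y => fderiv ℝ F y v) x
      - Complex.I • fderiv ℝ (fun y => fderiv ℝ F y (Complex.I • v)) x)) x := by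
    intro v
    have := (((hd v).hasFDerivAt).sub (((hd (Complex.I • v)).hasFDerivAt).const_mul
      Complex.I)).const_mul (1 / 2 : ℂ)
    refine this.congr_of_eventuallyEq (Eventually.of_forall fun y => ?_)
    rw [dz]
    simp only [Pi.sub_apply]
    ring
  rw [dz_eq (h1 v), dzbar_eq (h2 u)]
  simp only [smul_apply, add_apply, sub_apply, smul_eq_mul]
  rw [fderiv_fderiv_apply_comm hF x v u, fderiv_fderiv_apply_comm hF x v (Complex.I • u),
    fderiv_fderiv_apply_comm hF x (Complex.I • v) u,
    fderiv_fderiv_apply_comm hF x (Complex.I • v) (Complex.I • u)]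
  ring

variable [MeasurableSpace E] [BorelSpace E] [FiniteDimensional ℝ E]
  {μ : Measure E} [μ.IsAddHaarMeasure]

/-- Integration by parts after rescaling: the chain rule supplies the factor s, and compact support
makes every product integrable. -/
theorem integral_affine_mul_dzbar {G w : E → ℂ} (hG : ContDiff ℝ ∞ G) (hc : HasCompactSupport G)
    (hw : ContDiff ℝ ∞ w) (p : E) {s : ℝ} (hs : 0 < s) (v : E) :
    ∫ y, G (p + s • y) * dzbar v w y ∂μ = -(s * ∫ y, dzbar v G (p + s • y) * w y ∂μ) := by
  have hder := hasFDerivAt_comp_affine hG p s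
  have e : ∀ y, dzbar v (fun y => G (p + s • y)) y = s * dzbar v G (p + s • y) := by
    intro y
    rw [dzbar_eq (hder y), dzbar]
    simp only [smul_apply, Complex.real_smul]
    ring
  rw [integral_mul_dzbar v (fun y => (hder y).differentiableAt) (hw.differentiable (by simp))]
  · simp only [e, mul_assoc, integral_const_mul]
  · intro u
    simp only [(hder _).fderiv, smul_apply, Complex.real_smul, mul_assoc]
    exact (integrable_comp_affine_mul (contDiff_fderiv_apply hG u).continuous
      (hc.fderiv_apply (𝕜 := ℝ) u) hw.continuous p hs).const_mul _
  · intro u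
    exact integrable_comp_affine_mul hG.continuous hc (contDiff_fderiv_apply hw u).continuous p hs
  · exact integrable_comp_affine_mul hG.continuous hc hw.continuous p hs

theorem integral_affine_mul_dz {G w : E → ℂ} (hG : ContDiff ℝ ∞ G) (hc : HasCompactSupport G)
    (hw : ContDiff ℝ ∞ w) (p : E) {s : ℝ} (hs : 0 < s) (v : E) :
    ∫ y, G (p + s • y) * dz v w y ∂μ = -(s * ∫ y, dz v G (p + s • y) * w y ∂μ) := by
  have hder := hasFDerivAt_comp_affine hG p s
  have e : ∀ y, dz v (fun y => G (p + s • y)) y = s * dz v G (p + s • y) := by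
    intro y
    rw [dz_eq (hder y), dz]
    simp only [smul_apply, Complex.real_smul]
    ring
  rw [integral_mul_dz v (fun y => (hder y).differentiableAt) (hw.differentiable (by simp))]
  · simp only [e, mul_assoc, integral_const_mul]
  · intro u
    simp only [(hder _).fderiv, smul_apply, Complex.real_smul, mul_assoc]
    exact (integrable_comp_affine_mul (contDiff_fderiv_apply hG u).continuous
      (hc.fderiv_apply (𝕜 := ℝ) u) hw.continuous p hs).const_mul _
  · intro u
    exact integrable_comp_affine_mul hG.continuous hc (contDiff_fderiv_apply hw u).continuous p hs
  · exact integrable_comp_affine_mul hG.continuous hc hw.continuous p hs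

end WirtingerCalculus

/-! ### The heat pairs of `Δ` and of `Δ_(d) + Δ_(e) + ∂²/∂d̄_1 ∂e_1` -/

/-- The splitting of a real-linear form into complex-linear and antilinear parts. With T the
derivative of F it expresses a directional derivative through ∂_j and ∂̄_j. -/
theorem real_clm_apply_eq {N : ℕ} (T : (Fin N → ℂ) →L[ℝ] ℂ) (y : Fin N → ℂ) :
    T y = ∑ j, (y j * ((T (Pi.single j 1) - Complex.I * T (Complex.I • Pi.single j 1)) / 2)
      + conj (y j) * ((T (Pi.single j 1) + Complex.I * T (Complex.I • Pi.single j 1)) / 2)) := by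
  have h1 : y = ∑ j, ((y j).re • (Pi.single j 1 : Fin N → ℂ)
      + (y j).im • (Complex.I • (Pi.single j 1 : Fin N → ℂ))) := by
    funext i
    rw [Finset.sum_apply, Finset.sum_eq_single i]
    · simp
    · intro j _ hj
      simp [Pi.single_eq_of_ne (Ne.symm hj)]
    · simp
  conv_lhs => rw [h1]
  rw [map_sum]
  refine Finset.sum_congr rfl fun j _ => ?_
  rw [map_add, map_smul, map_smul, Complex.real_smul, Complex.real_smul]
  have h2 : y j = (y j).re + (y j).im * Complex.I := (Complex.re_add_im _).symm
  have h3 : conj (y j) = (y j).re - (y j).im * Complex.I := by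
    apply Complex.ext <;> simp
  rw [h3]
  conv_rhs => rw [h2]
  simp only [Complex.add_re, Complex.add_im, Complex.ofReal_re, Complex.ofReal_im, Complex.mul_re,
    Complex.mul_im, Complex.I_re, Complex.I_im]
  simp only [mul_zero, mul_one, sub_zero, add_zero, zero_add]
  linear_combination (T (Complex.I • Pi.single j 1) * (y j).im) * Complex.I_sq

/-- `π^{-N} e^{-‖y‖²}` -/
def heatWeight (N : ℕ) (y : Fin N → ℂ) : ℂ :=
  ((Real.pi : ℂ) ^ N)⁻¹ * ((Real.exp (-(∑ j, ‖y j‖ ^ 2) / (1 : ℝ)) : ℝ) : ℂ)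

theorem heatWeight_eq (N : ℕ) (y : Fin N → ℂ) :
    heatWeight N y = ((Real.pi : ℂ) ^ N)⁻¹ * Complex.exp (-∑ j, y j * conj (y j)) := by
  rw [heatWeight]
  push_cast
  simp only [Complex.mul_conj', div_one]

theorem contDiff_conj_apply {E : Type*} [NormedAddCommGroup E] [NormedSpace ℝ E] {F : E → ℂ}
    (hF : ContDiff ℝ ∞ F) : ContDiff ℝ ∞ fun x => conj (F x) :=
  (Complex.conjCLE : ℂ →L[ℝ] ℂ).contDiff.comp hF

theorem contDiff_heatWeight (N : ℕ) : ContDiff ℝ ∞ (heatWeight N) := by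
  rw [show heatWeight N = _ from funext (heatWeight_eq N)]
  refine contDiff_const.mul (ContDiff.cexp (ContDiff.neg (ContDiff.sum fun j _ => ?_)))
  exact (contDiff_apply ℝ ℂ j).mul (contDiff_conj_apply (contDiff_apply ℝ ℂ j))

theorem norm_sq_le_sum {N : ℕ} (d : Fin N → ℂ) : ‖d‖ ^ 2 ≤ ∑ j, ‖d j‖ ^ 2 := by
  have h0 : ‖d‖ ≤ Real.sqrt (∑ j, ‖d j‖ ^ 2) := by
    refine (pi_norm_le_iff_of_nonneg (Real.sqrt_nonneg _)).mpr fun j => ?_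
    refine Real.le_sqrt_of_sq_le ?_
    exact Finset.single_le_sum (f := fun j => ‖d j‖ ^ 2) (fun _ _ => by positivity)
      (Finset.mem_univ j)
  calc ‖d‖ ^ 2 ≤ Real.sqrt (∑ j, ‖d j‖ ^ 2) ^ 2 := by gcongr
    _ = _ := Real.sq_sqrt (Finset.sum_nonneg fun _ _ => by positivity)

theorem dzbar_heatWeight {N : ℕ} (j : Fin N) (y : Fin N → ℂ) :
    dzbar (Pi.single j 1) (heatWeight N) y = -(y j * heatWeight N y) := by
  obtain ⟨F', h1, h2⟩ := hasFDerivAt_sum_norm_sq 1 y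
  have h3 : HasFDerivAt (heatWeight N) (((Real.pi : ℂ) ^ N)⁻¹ • F') y := h1.const_mul _
  rw [dzbar_eq h3]
  simp only [smul_apply, h2, smul_eq_mul]
  have s1 : ∑ i, (conj (y i) * (Pi.single j 1 : Fin N → ℂ) i
      + y i * conj ((Pi.single j 1 : Fin N → ℂ) i)) = conj (y j) + y j := by
    rw [Finset.sum_eq_single j (fun i _ hi => by simp [hi]) (by simp)]; simp
  have s2 : ∑ i, (conj (y i) * (Complex.I • (Pi.single j 1 : Fin N → ℂ)) i
      + y i * conj ((Complex.I • (Pi.single j 1 : Fin N → ℂ)) i))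
      = Complex.I * (conj (y j) - y j) := by
    rw [Finset.sum_eq_single j (fun i _ hi => by simp [hi]) (by simp)]; simp; ring
  rw [s1, s2, heatWeight, Complex.ofReal_one]
  linear_combination (((Real.pi : ℂ) ^ N)⁻¹ * (-(conj (y j) - y j) / 2)
    * ((Real.exp (-(∑ j, ‖y j‖ ^ 2) / (1 : ℝ)) : ℝ) : ℂ)) * Complex.I_sq

theorem dz_heatWeight {N : ℕ} (j : Fin N) (y : Fin N → ℂ) :
    dz (Pi.single j 1) (heatWeight N) y = -(conj (y j) * heatWeight N y) := by
  obtain ⟨F', h1, h2⟩ := hasFDerivAt_sum_norm_sq 1 y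
  have h3 : HasFDerivAt (heatWeight N) (((Real.pi : ℂ) ^ N)⁻¹ • F') y := h1.const_mul _
  rw [dz_eq h3]
  simp only [smul_apply, h2, smul_eq_mul]
  have s1 : ∑ i, (conj (y i) * (Pi.single j 1 : Fin N → ℂ) i
      + y i * conj ((Pi.single j 1 : Fin N → ℂ) i)) = conj (y j) + y j := by
    rw [Finset.sum_eq_single j (fun i _ hi => by simp [hi]) (by simp)]; simp
  have s2 : ∑ i, (conj (y i) * (Complex.I • (Pi.single j 1 : Fin N → ℂ)) i
      + y i * conj ((Complex.I • (Pi.single j 1 : Fin N → ℂ)) i))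
      = Complex.I * (conj (y j) - y j) := by
    rw [Finset.sum_eq_single j (fun i _ hi => by simp [hi]) (by simp)]; simp; ring
  rw [s1, s2, heatWeight, Complex.ofReal_one]
  linear_combination (((Real.pi : ℂ) ^ N)⁻¹ * ((conj (y j) - y j) / 2)
    * ((Real.exp (-(∑ j, ‖y j‖ ^ 2) / (1 : ℝ)) : ℝ) : ℂ)) * Complex.I_sq

theorem integral_heatWeight (n : ℕ) : ∫ y, heatWeight (n + 1) y = 1 := by
  have h1 := integral_cexp_pi (n := n) one_pos 0 0
  simp only [zero_mul, add_zero, Complex.exp_zero, mul_one, Complex.ofReal_one,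
    div_one] at h1
  have h2 : ∀ y, heatWeight (n + 1) y = ((Real.pi : ℂ) ^ (n + 1))⁻¹
      * Complex.exp (-(∑ j, ‖y j‖ ^ 2 : ℝ)) := fun y => by
    rw [heatWeight]; push_cast; rw [div_one]
  simp only [h2, integral_const_mul, h1]
  exact inv_mul_cancel₀ (pow_ne_zero _ (by exact_mod_cast Real.pi_ne_zero))

/-- For `parts`, use y_j w = -∂̄_j w and ȳ_j w = -∂_j w. The terms y_j ∂_j F and ȳ_j ∂̄_j F each
integrate by parts to s ∂_j ∂̄_j F, which gives 2sΔ. -/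
theorem heatPair_laplacian (n : ℕ) :
    HeatPair (volume : Measure (Fin (n + 1) → ℂ)) (heatWeight (n + 1)) laplacian where
  continuous := (contDiff_heatWeight _).continuous
  bound := by
    refine ⟨((Real.pi) ^ (n + 1))⁻¹, 1, one_pos, fun y => ?_⟩
    rw [heatWeight, norm_mul, norm_inv, norm_pow, Complex.norm_real, Complex.norm_real,
      Real.norm_of_nonneg Real.pi_pos.le, Real.norm_of_nonneg (Real.exp_pos _).le]
    gcongr
    have := norm_sq_le_sum y
    linarith
  mass := integral_heatWeight n
  smooth F hF := ContDiff.sum fun j _ => contDiff_dz (contDiff_dzbar hF _) _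
  support F hF := by
    have : laplacian F = ∑ j, dz (Pi.single j 1) (dzbar (Pi.single j 1) F) := by
      funext d; simp [laplacian]
    rw [this]
    refine Finset.sum_induction _ (fun G : (Fin (n + 1) → ℂ) → ℂ => HasCompactSupport G)
      (fun _ _ => HasCompactSupport.add) HasCompactSupport.zero fun j _ => ?_
    exact hasCompactSupport_dz (hasCompactSupport_dzbar hF _) _
  local' F G p h := by
    have := eventually_all.mpr fun j : Fin (n + 1) =>
      eventuallyEq_dz (eventuallyEq_dzbar h (Pi.single j 1)) (Pi.single j 1)
    filter_upwards [this] with x hx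
    rw [laplacian, laplacian]
    exact Finset.sum_congr rfl fun j _ => hx j
  parts F hF hc p s hs := by
    have hws := contDiff_heatWeight (n + 1)
    have hwc := hws.continuous
    set w := heatWeight (n + 1) with hw
    have e : ∀ y, fderiv ℝ F (p + s • y) y * w y
        = ∑ j, (-(dz (Pi.single j 1) F (p + s • y) * dzbar (Pi.single j 1) w y)
          + -(dzbar (Pi.single j 1) F (p + s • y) * dz (Pi.single j 1) w y)) := by
      intro y
      rw [real_clm_apply_eq, Finset.sum_mul]
      refine Finset.sum_congr rfl fun j _ => ?_
      rw [dzbar_heatWeight, dz_heatWeight, dz, dzbar]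
      ring
    have i1 : ∀ j, Integrable (fun y => -(dz (Pi.single j 1) F (p + s • y)
        * dzbar (Pi.single j 1) w y)) := fun j =>
      (integrable_comp_affine_mul (contDiff_dz hF _).continuous (hasCompactSupport_dz hc _)
        (contDiff_dzbar hws _).continuous p hs).neg
    have i2 : ∀ j, Integrable (fun y => -(dzbar (Pi.single j 1) F (p + s • y)
        * dz (Pi.single j 1) w y)) := fun j =>
      (integrable_comp_affine_mul (contDiff_dzbar hF _).continuous (hasCompactSupport_dzbar hc _)
        (contDiff_dz hws _).continuous p hs).neg
    simp only [e]
    rw [integral_finsetSum _ fun j _ => by exact (i1 j).add (i2 j)]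
    simp only [laplacian, Finset.sum_mul]
    rw [integral_finsetSum _ fun j _ => integrable_comp_affine_mul
      (contDiff_dz (contDiff_dzbar hF _) _).continuous
      (hasCompactSupport_dz (hasCompactSupport_dzbar hc _) _) hwc p hs, Finset.mul_sum]
    refine Finset.sum_congr rfl fun j _ => ?_
    rw [integral_add (i1 j) (i2 j), integral_neg, integral_neg,
      integral_affine_mul_dzbar (contDiff_dz hF _) (hasCompactSupport_dz hc _) hws p hs,
      integral_affine_mul_dz (contDiff_dzbar hF _) (hasCompactSupport_dzbar hc _) hws p hs]
    simp only [dz_dzbar_comm hF]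
    ring

/-- `π^{-2N} e^{-‖a‖² - ‖b‖² + a_1 b̄_1}` -/
def productWeight (n : ℕ) (q : (Fin (n + 1) → ℂ) × (Fin (n + 1) → ℂ)) : ℂ :=
  heatWeight (n + 1) q.1 * heatWeight (n + 1) q.2 * Complex.exp (q.1 0 * conj (q.2 0))

theorem contDiff_productWeight (n : ℕ) : ContDiff ℝ ∞ (productWeight n) := by
  have h0 : ContDiff ℝ ∞ fun y : Fin (n + 1) → ℂ => y 0 := contDiff_apply ℝ ℂ 0
  refine ((contDiff_heatWeight _).comp contDiff_fst).mul
    ((contDiff_heatWeight _).comp contDiff_snd) |>.mul (ContDiff.cexp ?_)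
  exact (h0.comp contDiff_fst).mul (contDiff_conj_apply (h0.comp contDiff_snd))

theorem hasFDerivAt_productWeight {n : ℕ} (q : (Fin (n + 1) → ℂ) × (Fin (n + 1) → ℂ)) :
    ∃ F' : (Fin (n + 1) → ℂ) × (Fin (n + 1) → ℂ) →L[ℝ] ℂ, HasFDerivAt (productWeight n) F' q ∧
      ∀ u v, F' (u, v) =
        fderiv ℝ (heatWeight (n + 1)) q.1 u * heatWeight (n + 1) q.2
            * Complex.exp (q.1 0 * conj (q.2 0))
          + heatWeight (n + 1) q.1 * fderiv ℝ (heatWeight (n + 1)) q.2 v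
            * Complex.exp (q.1 0 * conj (q.2 0))
          + (u 0 * conj (q.2 0) + q.1 0 * conj (v 0)) * productWeight n q := by
  have hw := fun y => ((contDiff_heatWeight (n + 1)).differentiable (by simp) y).hasFDerivAt
  have h1 := (hw q.1).comp q (hasFDerivAt_fst (𝕜 := ℝ))
  have h2 := (hw q.2).comp q (hasFDerivAt_snd (𝕜 := ℝ))
  have h3 : HasFDerivAt (fun q : (Fin (n + 1) → ℂ) × (Fin (n + 1) → ℂ) => q.1 0)
      ((ContinuousLinearMap.proj (R := ℝ) (φ := fun _ : Fin (n + 1) => ℂ) 0).comp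
        (ContinuousLinearMap.fst ℝ _ _)) q :=
    (hasFDerivAt_apply (𝕜 := ℝ) (F' := fun _ : Fin (n + 1) => ℂ) 0 q.1).comp q hasFDerivAt_fst
  have h3' : HasFDerivAt (fun q : (Fin (n + 1) → ℂ) × (Fin (n + 1) → ℂ) => q.2 0)
      ((ContinuousLinearMap.proj (R := ℝ) (φ := fun _ : Fin (n + 1) => ℂ) 0).comp
        (ContinuousLinearMap.snd ℝ _ _)) q :=
    (hasFDerivAt_apply (𝕜 := ℝ) (F' := fun _ : Fin (n + 1) => ℂ) 0 q.2).comp q hasFDerivAt_snd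
  have h4 := (Complex.conjCLE : ℂ →L[ℝ] ℂ).hasFDerivAt.comp q h3'
  refine ⟨_, (h1.mul h2).mul (h3.mul h4).cexp, fun u v => ?_⟩
  simp only [add_apply, smul_apply, ContinuousLinearMap.comp_apply,
    ContinuousLinearMap.coe_fst', ContinuousLinearMap.coe_snd', ContinuousLinearMap.proj_apply,
    smul_eq_mul, Function.comp_apply, Pi.mul_apply, productWeight]
  have : ∀ z : ℂ, (Complex.conjCLE : ℂ →L[ℝ] ℂ) z = conj z := fun _ => rfl
  simp only [this]
  ring

/-- The cross term a_1 conj(b_1) is holomorphic in a and antiholomorphic in b. It therefore affects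
only ∂/∂a_1 and ∂/∂b̄_1 among the derivatives computed here and in the next three lemmas. -/
theorem dz_inl_productWeight {n : ℕ} (j : Fin (n + 1)) (q : (Fin (n + 1) → ℂ) × (Fin (n + 1) → ℂ)) :
    dz (Pi.single j 1, 0) (productWeight n) q
      = (-conj (q.1 j) + if j = 0 then conj (q.2 0) else 0) * productWeight n q := by
  obtain ⟨F', h1, h2⟩ := hasFDerivAt_productWeight q
  have hz := dz_heatWeight j q.1
  rw [dz] at hz
  rw [dz_eq h1, Prod.smul_mk, smul_zero, h2, h2, map_zero]
  have e1 : (Pi.single j (1 : ℂ) : Fin (n + 1) → ℂ) 0 = if j = 0 then 1 else 0 := by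
    rw [Pi.single_apply]; simp only [eq_comm]
  simp only [Pi.smul_apply, e1, Pi.zero_apply, map_zero, mul_zero, add_zero, zero_mul, smul_eq_mul]
  simp only [productWeight]
  split_ifs
  · linear_combination (heatWeight (n + 1) q.2 * Complex.exp (q.1 0 * conj (q.2 0))) * hz
      - (1 / 2 * conj (q.2 0) * (heatWeight (n + 1) q.1 * heatWeight (n + 1) q.2
        * Complex.exp (q.1 0 * conj (q.2 0)))) * Complex.I_sq
  · linear_combination (heatWeight (n + 1) q.2 * Complex.exp (q.1 0 * conj (q.2 0))) * hz

theorem dzbar_inl_productWeight {n : ℕ} (j : Fin (n + 1))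
    (q : (Fin (n + 1) → ℂ) × (Fin (n + 1) → ℂ)) :
    dzbar (Pi.single j 1, 0) (productWeight n) q = -q.1 j * productWeight n q := by
  obtain ⟨F', h1, h2⟩ := hasFDerivAt_productWeight q
  have hz := dzbar_heatWeight j q.1
  rw [dzbar] at hz
  rw [dzbar_eq h1, Prod.smul_mk, smul_zero, h2, h2, map_zero]
  have e1 : (Pi.single j (1 : ℂ) : Fin (n + 1) → ℂ) 0 = if j = 0 then 1 else 0 := by
    rw [Pi.single_apply]; simp only [eq_comm]
  simp only [Pi.smul_apply, e1, Pi.zero_apply, map_zero, mul_zero, add_zero, zero_mul, smul_eq_mul]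
  simp only [productWeight]
  split_ifs
  · linear_combination (heatWeight (n + 1) q.2 * Complex.exp (q.1 0 * conj (q.2 0))) * hz
      + (1 / 2 * conj (q.2 0) * (heatWeight (n + 1) q.1 * heatWeight (n + 1) q.2
        * Complex.exp (q.1 0 * conj (q.2 0)))) * Complex.I_sq
  · linear_combination (heatWeight (n + 1) q.2 * Complex.exp (q.1 0 * conj (q.2 0))) * hz

theorem dz_inr_productWeight {n : ℕ} (j : Fin (n + 1)) (q : (Fin (n + 1) → ℂ) × (Fin (n + 1) → ℂ)) :
    dz (0, Pi.single j 1) (productWeight n) q = -conj (q.2 j) * productWeight n q := by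
  obtain ⟨F', h1, h2⟩ := hasFDerivAt_productWeight q
  have hz := dz_heatWeight j q.2
  rw [dz] at hz
  rw [dz_eq h1, Prod.smul_mk, smul_zero, h2, h2, map_zero]
  have e1 : (Pi.single j (1 : ℂ) : Fin (n + 1) → ℂ) 0 = if j = 0 then 1 else 0 := by
    rw [Pi.single_apply]; simp only [eq_comm]
  simp only [Pi.smul_apply, e1, Pi.zero_apply, zero_add, zero_mul, smul_eq_mul,
    map_mul, Complex.conj_I]
  simp only [productWeight]
  split_ifs
  · simp only [map_one]
    linear_combination (heatWeight (n + 1) q.1 * Complex.exp (q.1 0 * conj (q.2 0))) * hz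
      + (1 / 2 * q.1 0 * (heatWeight (n + 1) q.1 * heatWeight (n + 1) q.2
        * Complex.exp (q.1 0 * conj (q.2 0)))) * Complex.I_sq
  · simp only [map_zero]
    linear_combination (heatWeight (n + 1) q.1 * Complex.exp (q.1 0 * conj (q.2 0))) * hz

theorem dzbar_inr_productWeight {n : ℕ} (j : Fin (n + 1))
    (q : (Fin (n + 1) → ℂ) × (Fin (n + 1) → ℂ)) :
    dzbar (0, Pi.single j 1) (productWeight n) q
      = (-q.2 j + if j = 0 then q.1 0 else 0) * productWeight n q := by
  obtain ⟨F', h1, h2⟩ := hasFDerivAt_productWeight q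
  have hz := dzbar_heatWeight j q.2
  rw [dzbar] at hz
  rw [dzbar_eq h1, Prod.smul_mk, smul_zero, h2, h2, map_zero]
  have e1 : (Pi.single j (1 : ℂ) : Fin (n + 1) → ℂ) 0 = if j = 0 then 1 else 0 := by
    rw [Pi.single_apply]; simp only [eq_comm]
  simp only [Pi.smul_apply, e1, Pi.zero_apply, zero_add, zero_mul, smul_eq_mul,
    map_mul, Complex.conj_I]
  simp only [productWeight]
  split_ifs
  · simp only [map_one]
    linear_combination (heatWeight (n + 1) q.1 * Complex.exp (q.1 0 * conj (q.2 0))) * hz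
      - (1 / 2 * q.1 0 * (heatWeight (n + 1) q.1 * heatWeight (n + 1) q.2
        * Complex.exp (q.1 0 * conj (q.2 0)))) * Complex.I_sq
  · simp only [map_zero]
    linear_combination (heatWeight (n + 1) q.1 * Complex.exp (q.1 0 * conj (q.2 0))) * hz

instance isAddHaarMeasure_volume_prod (N : ℕ) :
    (volume : Measure ((Fin N → ℂ) × (Fin N → ℂ))).IsAddHaarMeasure := by
  rw [Measure.volume_eq_prod]; exact Measure.prod.instIsAddHaarMeasure _ _

theorem norm_heatWeight {N : ℕ} (y : Fin N → ℂ) :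
    ‖heatWeight N y‖ = (Real.pi ^ N)⁻¹ * Real.exp (-∑ j, ‖y j‖ ^ 2) := by
  rw [heatWeight, norm_mul, norm_inv, norm_pow, Complex.norm_real, Complex.norm_real,
    Real.norm_of_nonneg Real.pi_pos.le, Real.norm_of_nonneg (Real.exp_pos _).le, div_one]

/-- The cross term is at most (|a_1|² + |b_1|²)/2, hence costs at most half of the Gaussian decay.
-/
theorem norm_productWeight_le (n : ℕ) (q : (Fin (n + 1) → ℂ) × (Fin (n + 1) → ℂ)) :
    ‖productWeight n q‖ ≤ ((Real.pi ^ (n + 1))⁻¹ * (Real.pi ^ (n + 1))⁻¹)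
      * Real.exp (-(1 / 2) * ‖q‖ ^ 2) := by
  rw [productWeight, norm_mul, norm_mul, norm_heatWeight, norm_heatWeight, Complex.norm_exp]
  have h1 := norm_sq_le_sum q.1
  have h2 := norm_sq_le_sum q.2
  have h3 : (q.1 0 * conj (q.2 0)).re ≤ ‖q.1 0‖ * ‖q.2 0‖ := by
    refine (Complex.re_le_norm _).trans ?_
    rw [norm_mul, Complex.norm_conj]
  have h4 : ‖q.1 0‖ ^ 2 ≤ ∑ j, ‖q.1 j‖ ^ 2 :=
    Finset.single_le_sum (f := fun j => ‖q.1 j‖ ^ 2) (fun _ _ => by positivity) (Finset.mem_univ 0)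
  have h5 : ‖q.2 0‖ ^ 2 ≤ ∑ j, ‖q.2 j‖ ^ 2 :=
    Finset.single_le_sum (f := fun j => ‖q.2 j‖ ^ 2) (fun _ _ => by positivity) (Finset.mem_univ 0)
  have h6 : ‖q‖ ^ 2 ≤ ‖q.1‖ ^ 2 + ‖q.2‖ ^ 2 := by
    rcases max_choice ‖q.1‖ ‖q.2‖ with h | h <;> rw [Prod.norm_def, h] <;>
      nlinarith [sq_nonneg ‖q.1‖, sq_nonneg ‖q.2‖]
  have e : (Real.pi ^ (n + 1))⁻¹ * Real.exp (-∑ j, ‖q.1 j‖ ^ 2)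
      * ((Real.pi ^ (n + 1))⁻¹ * Real.exp (-∑ j, ‖q.2 j‖ ^ 2))
      * Real.exp (q.1 0 * conj (q.2 0)).re
      = ((Real.pi ^ (n + 1))⁻¹ * (Real.pi ^ (n + 1))⁻¹) *
        Real.exp (-∑ j, ‖q.1 j‖ ^ 2 + -∑ j, ‖q.2 j‖ ^ 2 + (q.1 0 * conj (q.2 0)).re) := by
    rw [Real.exp_add, Real.exp_add]; ring
  rw [e]
  gcongr
  nlinarith [sq_nonneg (‖q.1 0‖ - ‖q.2 0‖)]

/-- Integrate over b first: the linear term in the exponent is purely antiholomorphic in b, so it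
does not change the Gaussian integral. -/
theorem integral_productWeight (n : ℕ) : ∫ q, productWeight n q = 1 := by
  have hint : Integrable (productWeight n) := by
    have := (integrable_one_add_norm_pow_mul_exp
      (volume : Measure ((Fin (n + 1) → ℂ) × (Fin (n + 1) → ℂ))) (c := 1 / 2) (by norm_num) 0)
    refine (this.const_mul ((Real.pi ^ (n + 1))⁻¹ * (Real.pi ^ (n + 1))⁻¹)).mono'
      (contDiff_productWeight n).continuous.aestronglyMeasurable (Eventually.of_forall fun q => ?_)
    rw [pow_zero, one_mul]
    exact norm_productWeight_le n q
  rw [Measure.volume_eq_prod] at hint ⊢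
  rw [integral_prod _ hint]
  have hpi : (Real.pi : ℂ) ≠ 0 := by exact_mod_cast Real.pi_ne_zero
  have h1 : ∀ a : Fin (n + 1) → ℂ, ∫ b, productWeight n (a, b) = heatWeight (n + 1) a := by
    intro a
    have h2 := integral_cexp_pi (n := n) one_pos 0 (a 0)
    have h3 : ∀ b, productWeight n (a, b) = (heatWeight (n + 1) a * ((Real.pi : ℂ) ^ (n + 1))⁻¹) *
        Complex.exp (-(∑ j, ‖b j‖ ^ 2 : ℝ) / (1 : ℝ)
          + (0 * b 0 + a 0 * conj (b 0)) / (1 : ℝ)) := by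
      intro b
      rw [productWeight, heatWeight_eq _ b, Complex.exp_add, Complex.ofReal_one, div_one, div_one,
        zero_mul, zero_add]
      push_cast
      simp only [Complex.mul_conj']
      ring
    simp only [h3, integral_const_mul, h2]
    simp only [zero_mul, zero_div, Complex.exp_zero, mul_one, Complex.ofReal_one]
    field_simp
  simp only [h1, integral_heatWeight]

theorem real_clm_prod_apply_eq {N : ℕ} (T : (Fin N → ℂ) × (Fin N → ℂ) →L[ℝ] ℂ)
    (q : (Fin N → ℂ) × (Fin N → ℂ)) :
    T q = ∑ j, (q.1 j * ((T (Pi.single j 1, 0) - Complex.I * T (Complex.I • (Pi.single j 1, 0))) / 2)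
      + conj (q.1 j) * ((T (Pi.single j 1, 0) + Complex.I * T (Complex.I • (Pi.single j 1, 0))) / 2)
      + q.2 j * ((T (0, Pi.single j 1) - Complex.I * T (Complex.I • (0, Pi.single j 1))) / 2)
      + conj (q.2 j) *
        ((T (0, Pi.single j 1) + Complex.I * T (Complex.I • (0, Pi.single j 1))) / 2)) := by
  have h1 : T q = T.comp (ContinuousLinearMap.inl ℝ _ _) q.1
      + T.comp (ContinuousLinearMap.inr ℝ _ _) q.2 := by
    simp only [ContinuousLinearMap.comp_apply, ← map_add]
    congr 1
    simp
  rw [h1, real_clm_apply_eq, real_clm_apply_eq (T.comp (ContinuousLinearMap.inr ℝ _ _)),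
    ← Finset.sum_add_distrib]
  refine Finset.sum_congr rfl fun j _ => ?_
  simp only [ContinuousLinearMap.comp_apply, ContinuousLinearMap.inl_apply,
    ContinuousLinearMap.inr_apply, Prod.smul_mk, smul_zero]
  ring

/-- As for the Laplacian, except that ā_1 w = -∂_{a_1} w + b̄_1 w and b_1 w = -∂̄_{b_1} w + a_1 w.
The extra terms are again derivatives, b̄_1 w = -∂_{b_1} w and a_1 w = -∂̄_{a_1} w, and each
integrates by parts to s ∂̄_{a_1} ∂_{b_1} F. Together they give the mixed term of the operator with
the required factor 2s. -/
theorem heatPair_productOp (n : ℕ) :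
    HeatPair (volume : Measure ((Fin (n + 1) → ℂ) × (Fin (n + 1) → ℂ))) (productWeight n)
      productOp where
  continuous := (contDiff_productWeight _).continuous
  bound := ⟨_, 1 / 2, by norm_num, norm_productWeight_le n⟩
  mass := integral_productWeight n
  smooth F hF := ((ContDiff.sum fun j _ => contDiff_dz (contDiff_dzbar hF _) _).add
    (ContDiff.sum fun j _ => contDiff_dz (contDiff_dzbar hF _) _)).add
      (contDiff_dzbar (contDiff_dz hF _) _)
  support F hF := by
    have : productOp F = ∑ j, dz (Pi.single j 1, 0) (dzbar (Pi.single j 1, 0) F)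
        + ∑ j, dz (0, Pi.single j 1) (dzbar (0, Pi.single j 1) F)
        + dzbar (Pi.single 0 1, 0) (dz (0, Pi.single 0 1) F) := by
      funext d; simp [productOp]
    rw [this]
    have hsum : ∀ G : Fin (n + 1) → (Fin (n + 1) → ℂ) × (Fin (n + 1) → ℂ) → ℂ,
        (∀ j, HasCompactSupport (G j)) → HasCompactSupport (∑ j, G j) := fun G hG =>
      Finset.sum_induction _ (fun G : (Fin (n + 1) → ℂ) × (Fin (n + 1) → ℂ) → ℂ =>
        HasCompactSupport G) (fun _ _ => HasCompactSupport.add) HasCompactSupport.zero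
        fun j _ => hG j
    exact ((hsum _ fun j => hasCompactSupport_dz (hasCompactSupport_dzbar hF _) _).add
      (hsum _ fun j => hasCompactSupport_dz (hasCompactSupport_dzbar hF _) _)).add
      (hasCompactSupport_dzbar (hasCompactSupport_dz hF _) _)
  local' F G p h := by
    have h1 := eventually_all.mpr fun j : Fin (n + 1) =>
      eventuallyEq_dz (eventuallyEq_dzbar h (Pi.single j 1, 0)) (Pi.single j 1, 0)
    have h2 := eventually_all.mpr fun j : Fin (n + 1) =>
      eventuallyEq_dz (eventuallyEq_dzbar h (0, Pi.single j 1)) (0, Pi.single j 1)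
    have h3 := eventuallyEq_dzbar (eventuallyEq_dz h (0, Pi.single 0 1)) (Pi.single 0 1, 0)
    filter_upwards [h1, h2, h3] with x hx1 hx2 hx3
    rw [productOp, productOp, hx3]
    congr 2
    · exact Finset.sum_congr rfl fun j _ => hx1 j
    · exact Finset.sum_congr rfl fun j _ => hx2 j
  parts F hF hc p s hs := by
    have hws := contDiff_productWeight n
    have hwc := hws.continuous
    set w := productWeight n with hw
    have e : ∀ q, fderiv ℝ F (p + s • q) q * w q
        = ∑ j, (-(dz (Pi.single j 1, 0) F (p + s • q) * dzbar (Pi.single j 1, 0) w q)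
          + -(dzbar (Pi.single j 1, 0) F (p + s • q) * dz (Pi.single j 1, 0) w q)
          + -(dz (0, Pi.single j 1) F (p + s • q) * dzbar (0, Pi.single j 1) w q)
          + -(dzbar (0, Pi.single j 1) F (p + s • q) * dz (0, Pi.single j 1) w q))
        + -(dzbar (Pi.single 0 1, 0) F (p + s • q) * dz (0, Pi.single 0 1) w q)
        + -(dz (0, Pi.single 0 1) F (p + s • q) * dzbar (Pi.single 0 1, 0) w q) := by
      intro q
      -- For j = 0 the naive formula misses by the contribution of the cross term, isolated here so
      -- that the two last summands of `e` cancel it.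
      have e1 : ∀ j : Fin (n + 1),
          (-(dz (Pi.single j 1, 0) F (p + s • q) * dzbar (Pi.single j 1, 0) w q)
          + -(dzbar (Pi.single j 1, 0) F (p + s • q) * dz (Pi.single j 1, 0) w q)
          + -(dz (0, Pi.single j 1) F (p + s • q) * dzbar (0, Pi.single j 1) w q)
          + -(dzbar (0, Pi.single j 1) F (p + s • q) * dz (0, Pi.single j 1) w q))
          = (q.1 j * dz (Pi.single j 1, 0) F (p + s • q)
            + conj (q.1 j) * dzbar (Pi.single j 1, 0) F (p + s • q)
            + q.2 j * dz (0, Pi.single j 1) F (p + s • q)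
            + conj (q.2 j) * dzbar (0, Pi.single j 1) F (p + s • q)) * w q
          + if j = 0 then -(dzbar (Pi.single 0 1, 0) F (p + s • q) * (conj (q.2 0) * w q)
            + dz (0, Pi.single 0 1) F (p + s • q) * (q.1 0 * w q)) else 0 := by
        intro j
        rw [dz_inl_productWeight, dzbar_inl_productWeight, dz_inr_productWeight,
          dzbar_inr_productWeight]
        split_ifs with hj
        · subst hj; ring
        · ring
      simp only [e1]
      rw [Finset.sum_add_distrib, Finset.sum_ite_eq' Finset.univ (0 : Fin (n + 1)),
        if_pos (Finset.mem_univ _), real_clm_prod_apply_eq, Finset.sum_mul,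
        dz_inr_productWeight, dzbar_inl_productWeight]
      simp only [dz, dzbar]
      ring
    have i1 : ∀ u v, Integrable (fun q => -(dz u F (p + s • q) * dzbar v w q)) := fun u v =>
      (integrable_comp_affine_mul (contDiff_dz hF u).continuous (hasCompactSupport_dz hc u)
        (contDiff_dzbar hws v).continuous p hs).neg
    have i2 : ∀ u v, Integrable (fun q => -(dzbar u F (p + s • q) * dz v w q)) := fun u v =>
      (integrable_comp_affine_mul (contDiff_dzbar hF u).continuous (hasCompactSupport_dzbar hc u)
        (contDiff_dz hws v).continuous p hs).neg
    have p1 : ∀ u v, ∫ q, -(dz u F (p + s • q) * dzbar v w q)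
        = s * ∫ q, dzbar v (dz u F) (p + s • q) * w q := fun u v => by
      rw [integral_neg, integral_affine_mul_dzbar (contDiff_dz hF u) (hasCompactSupport_dz hc u)
        hws p hs, neg_neg]
    have p2 : ∀ u v, ∫ q, -(dzbar u F (p + s • q) * dz v w q)
        = s * ∫ q, dzbar u (dz v F) (p + s • q) * w q := fun u v => by
      rw [integral_neg, integral_affine_mul_dz (contDiff_dzbar hF u) (hasCompactSupport_dzbar hc u)
        hws p hs, neg_neg]
      simp only [dz_dzbar_comm hF]
    have i3 : ∀ u v, Integrable (fun q => dzbar u (dz v F) (p + s • q) * w q) := fun u v =>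
      integrable_comp_affine_mul (contDiff_dzbar (contDiff_dz hF v) u).continuous
        (hasCompactSupport_dzbar (hasCompactSupport_dz hc v) u) hwc p hs
    have i4 : ∀ j : Fin (n + 1), Integrable (fun q =>
          -(dz (Pi.single j 1, 0) F (p + s • q) * dzbar (Pi.single j 1, 0) w q)
          + -(dzbar (Pi.single j 1, 0) F (p + s • q) * dz (Pi.single j 1, 0) w q)
          + -(dz (0, Pi.single j 1) F (p + s • q) * dzbar (0, Pi.single j 1) w q)
          + -(dzbar (0, Pi.single j 1) F (p + s • q) * dz (0, Pi.single j 1) w q)) := fun j =>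
      (((i1 _ _).add (i2 _ _)).add (i1 _ _)).add (i2 _ _)
    simp only [e]
    rw [integral_add (by exact (integrable_finsetSum _ fun j _ => i4 j).add (i2 _ _)) (i1 _ _),
      integral_add (by exact integrable_finsetSum _ fun j _ => i4 j) (i2 _ _),
      integral_finsetSum _ fun j _ => i4 j, p1, p2]
    have e2 : ∀ j : Fin (n + 1), ∫ q,
          (-(dz (Pi.single j 1, 0) F (p + s • q) * dzbar (Pi.single j 1, 0) w q)
          + -(dzbar (Pi.single j 1, 0) F (p + s • q) * dz (Pi.single j 1, 0) w q)
          + -(dz (0, Pi.single j 1) F (p + s • q) * dzbar (0, Pi.single j 1) w q)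
          + -(dzbar (0, Pi.single j 1) F (p + s • q) * dz (0, Pi.single j 1) w q))
        = 2 * s * ((∫ q, dzbar (Pi.single j 1, 0) (dz (Pi.single j 1, 0) F) (p + s • q) * w q)
          + ∫ q, dzbar (0, Pi.single j 1) (dz (0, Pi.single j 1) F) (p + s • q) * w q) := by
      intro j
      rw [integral_add (by exact ((i1 _ _).add (i2 _ _)).add (i1 _ _)) (i2 _ _),
        integral_add (by exact (i1 _ _).add (i2 _ _)) (i1 _ _), integral_add (i1 _ _) (i2 _ _),
        p1, p1, p2, p2]
      ring
    simp only [e2, productOp, add_mul, Finset.sum_mul, dz_dzbar_comm hF]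
    have i5 : ∀ u v : Fin (n + 1) → (Fin (n + 1) → ℂ) × (Fin (n + 1) → ℂ),
        Integrable (fun q => ∑ j, dzbar (u j) (dz (v j) F) (p + s • q) * w q) := fun u v =>
      integrable_finsetSum _ fun j _ => i3 _ _
    rw [integral_add (by exact (i5 _ _).add (i5 _ _)) (i3 _ _),
      integral_add (by exact i5 _ _) (by exact i5 _ _),
      integral_finsetSum _ fun j _ => i3 _ _, integral_finsetSum _ fun j _ => i3 _ _,
      ← Finset.mul_sum, Finset.sum_add_distrib]
    ring

/-! ### Square integrability of symbols -/

/-- f(d) is a diagonal entry of U* f^#(Z) U, and entries of unitary matrices have modulus at most 1.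
-/
theorem norm_apply_le_sum_sharp {n : ℕ} {f : (Fin (n + 1) → ℂ) → ℂ} (hf : IsTailSymmetric f)
    (U : UN (n + 1)) (d : Fin (n + 1) → ℂ) :
    ‖f d‖ ≤ ∑ a, ∑ b, ‖sharp f (unitaryConj U d) a b‖ := by
  have hU : U.1ᴴ * U.1 = 1 := Matrix.UnitaryGroup.star_mul_self U
  have h1 : U.1ᴴ * sharp f (unitaryConj U d) * U.1 = Matrix.diagonal (sharpDiag f d) := by
    rw [sharp_unitaryConj hf, unitaryConj_val]
    calc _ = (U.1ᴴ * U.1) * Matrix.diagonal (sharpDiag f d) * (U.1ᴴ * U.1) := by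
          simp only [Matrix.mul_assoc]
      _ = _ := by rw [hU, Matrix.one_mul, Matrix.mul_one]
  have h2 := congrFun (congrFun h1 0) 0
  rw [Matrix.diagonal_apply_eq, sharpDiag_zero, Matrix.mul_apply] at h2
  rw [← h2, Finset.sum_comm]
  refine (norm_sum_le _ _).trans (Finset.sum_le_sum fun b _ => ?_)
  rw [norm_mul, Matrix.mul_apply]
  refine (mul_le_of_le_one_right (norm_nonneg _) (norm_unitary_entry_le U b 0)).trans ?_
  refine (norm_sum_le _ _).trans (Finset.sum_le_sum fun a _ => ?_)
  rw [norm_mul, Matrix.conjTranspose_apply, norm_star]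
  exact mul_le_of_le_one_left (norm_nonneg _) (norm_unitary_entry_le U a 0)

theorem memLp_of_memLp_sharp {n : ℕ} {h : ℝ} {f : (Fin (n + 1) → ℂ) → ℂ} (hf : IsTailSymmetric f)
    (hc : Continuous f) (hφ : ∀ i j, MemLp (fun Z => sharp f Z i j) 2 (mu (n + 1) h)) :
    MemLp f 2 (gaussian (n + 1) h) := by
  have hmap := (measurable_conjMap (n + 1)).aemeasurable
    (μ := (haarUN (n + 1)).prod (gaussian (n + 1) h))
  have h1 : ∀ a b, MemLp (fun p : UN (n + 1) × (Fin (n + 1) → ℂ) =>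
      sharp f (unitaryConj p.1⁻¹ p.2) a b) 2 ((haarUN (n + 1)).prod (gaussian (n + 1) h)) := by
    intro a b
    have := hφ a b
    unfold mu at this
    exact (memLp_map_measure_iff this.aestronglyMeasurable hmap).mp this
  have h2 : MemLp (fun p : UN (n + 1) × (Fin (n + 1) → ℂ) => f p.2) 2
      ((haarUN (n + 1)).prod (gaussian (n + 1) h)) :=
    (memLp_finsetSum Finset.univ fun a _ => memLp_finsetSum Finset.univ fun b _ =>
      (h1 a b).norm).mono' (hc.comp continuous_snd).aestronglyMeasurable
      (Eventually.of_forall fun p => norm_apply_le_sum_sharp hf p.1⁻¹ p.2)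
  replace h2 := (memLp_two_iff_integrable_sq_norm
    (hc.comp continuous_snd).aestronglyMeasurable).mp h2
  rw [memLp_two_iff_integrable_sq_norm hc.aestronglyMeasurable]
  exact (Integrable.comp_snd_iff (IsProbabilityMeasure.ne_zero (haarUN (n + 1)))
    (f := fun d : Fin (n + 1) → ℂ => ‖f d‖ ^ 2)).mp h2

/-- The Gaussian density at h₀ is positive everywhere. Measurability of a symbol, assumed for one
parameter only, is thereby available for all h. -/
theorem mu_absolutelyContinuous (N : ℕ) (h : ℝ) {h₀ : ℝ} (hh₀ : 0 < h₀) : mu N h ≪ mu N h₀ := by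
  have h1 : gaussian N h ≪ gaussian N h₀ :=
    (withDensity_absolutelyContinuous _ _).trans
      (withDensity_absolutelyContinuous' (Measurable.aemeasurable (by fun_prop)) (Eventually.of_forall fun d => by
        simp only [ne_eq, ENNReal.ofReal_eq_zero, not_le]; positivity))
  exact (Measure.AbsolutelyContinuous.prod Measure.AbsolutelyContinuous.rfl h1).map
    (measurable_conjMap N)

theorem memLp_mul_gaussian {N : ℕ} {h h₀ : ℝ} (hh : 0 < h) (hh₀ : 0 < h₀) {f q : (Fin N → ℂ) → ℂ}
    (hc : Continuous f) (hf : MemLp f 2 (gaussian N h₀)) (hqm : StronglyMeasurable q) {C : ℝ}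
    (hq : ∀ d, ‖q d‖ ^ 2 * Real.exp (-(∑ j, ‖d j‖ ^ 2) / h)
      ≤ C * Real.exp (-(∑ j, ‖d j‖ ^ 2) / h₀)) :
    MemLp (fun d => f d * q d) 2 (gaussian N h) := by
  have hm := hc.stronglyMeasurable.mul hqm
  rw [memLp_two_iff_integrable_sq_norm hc.aestronglyMeasurable] at hf
  have h1 := (integrable_gaussian_iff hh₀ _).mp hf.ofReal
  refine (memLp_two_iff_integrable_sq_norm hm.aestronglyMeasurable).mpr ?_
  have h2 : Integrable (fun d => ((‖f d * q d‖ ^ 2 : ℝ) : ℂ)) (gaussian N h) := by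
    rw [integrable_gaussian_iff hh]
    refine (h1.norm.const_mul C).mono' (StronglyMeasurable.aestronglyMeasurable ?_)
      (Eventually.of_forall fun d => ?_)
    · exact (Complex.continuous_ofReal.comp_stronglyMeasurable (hm.norm.pow 2)).mul
        (Continuous.stronglyMeasurable (by fun_prop))
    · simp only [norm_mul, Complex.norm_real, Complex.coe_algebraMap, norm_pow, Real.norm_eq_abs,
        abs_norm, Real.abs_exp]
      calc (‖f d‖ * ‖q d‖) ^ 2 * Real.exp (-(∑ j, ‖d j‖ ^ 2) / h)
          = ‖f d‖ ^ 2 * (‖q d‖ ^ 2 * Real.exp (-(∑ j, ‖d j‖ ^ 2) / h)) := by ring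
        _ ≤ ‖f d‖ ^ 2 * (C * Real.exp (-(∑ j, ‖d j‖ ^ 2) / h₀)) :=
            mul_le_mul_of_nonneg_left (hq d) (by positivity)
        _ = _ := by ring
  exact h2.re

theorem norm_sq_apply_le_sum {N : ℕ} (d : Fin N → ℂ) (i : Fin N) : ‖d i‖ ^ 2 ≤ ∑ j, ‖d j‖ ^ 2 :=
  Finset.single_le_sum (f := fun j => ‖d j‖ ^ 2) (fun _ _ => by positivity) (Finset.mem_univ i)

/-- The factor e^{2|d_1||x|/h} costs half of the Gaussian e^{-|d|²/h} and the constant e^{2|x|²/h}.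
The other half still dominates the Gaussian at h₀, since h ≤ h₀/4. -/
theorem memLp_mul_cexp {n : ℕ} {h h₀ : ℝ} (hh : 0 < h) (hh₀ : h ≤ h₀ / 4)
    {f : (Fin (n + 1) → ℂ) → ℂ} (hc : Continuous f) (hf : MemLp f 2 (gaussian (n + 1) h₀)) (x : ℂ) :
    MemLp (fun d => f d * Complex.exp (d 0 * conj x / h)) 2 (gaussian (n + 1) h) := by
  have h0 : 0 < h₀ := by linarith
  refine memLp_mul_gaussian hh h0 hc hf (Continuous.stronglyMeasurable (by fun_prop))
    (C := Real.exp (2 * ‖x‖ ^ 2 / h)) fun d => ?_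
  rw [Complex.norm_exp, ← Real.exp_nat_mul, ← Real.exp_add, ← Real.exp_add, Real.exp_le_exp]
  have h1 : (d 0 * conj x / h).re ≤ ‖d 0‖ * ‖x‖ / h := by
    refine (Complex.re_le_norm _).trans_eq ?_
    rw [norm_div, norm_mul, Complex.norm_conj, Complex.norm_real, Real.norm_of_nonneg hh.le]
  have h2 := norm_sq_apply_le_sum d 0
  set S := ∑ j, ‖d j‖ ^ 2
  have hS : 0 ≤ S := (sq_nonneg _).trans h2
  have h3 : S / h₀ ≤ S / (4 * h) := by gcongr; linarith
  have h4 : 2 * (‖d 0‖ * ‖x‖ / h) ≤ 2 * ‖x‖ ^ 2 / h + S / (2 * h) := by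
    rw [show 2 * ‖x‖ ^ 2 / h + S / (2 * h) = (2 * ‖x‖ ^ 2 + S / 2) / h by field_simp,
      ← mul_div_assoc]
    gcongr
    nlinarith [sq_nonneg (2 * ‖x‖ - ‖d 0‖)]
  have h5 : S / (4 * h) ≤ S / (2 * h) := by gcongr; norm_num
  have h6 : -S / h = -(S / (2 * h)) - S / (2 * h) := by field_simp; ring
  have h7 : -S / h₀ = -(S / h₀) := neg_div _ _
  push_cast
  rw [h6, h7]
  linarith

/-- From r|d_1| ≤ r²/3 + (3/4)|d_1|² with r = |x| + |y|; the remaining quarter of the Gaussian pays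
for g. The point is the rate 1/3: after squaring, the growth e^{2|y|²/(3h)} still leaves Gaussian
decay to spare for the second symbol. -/
theorem norm_integral_cexp_le {n : ℕ} {h h₀ : ℝ} (hh : 0 < h) (hh₀ : h ≤ h₀ / 4)
    {g : (Fin (n + 1) → ℂ) → ℂ} (hg : Integrable g (gaussian (n + 1) h₀)) (x : ℂ) :
    ∃ D : ℝ, 0 ≤ D ∧ ∀ y : ℂ, ‖∫ d, g d * Complex.exp (d 0 * conj x / h)
        * Complex.exp (y / h * conj (d 0)) ∂(gaussian (n + 1) h)‖
      ≤ D * Real.exp ((‖x‖ + ‖y‖) ^ 2 / (3 * h)) := by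
  have h0 : 0 < h₀ := by linarith
  have h1 := ((integrable_gaussian_iff h0 _).mp hg).norm
  refine ⟨‖((Real.pi * h : ℝ) : ℂ)⁻¹ ^ (n + 1)‖ *
    ∫ d, ‖g d * Real.exp (-(∑ j, ‖d j‖ ^ 2) / h₀)‖, by positivity, fun y => ?_⟩
  rw [integral_gaussian_eq hh, norm_mul, mul_assoc, ← integral_mul_const]
  refine mul_le_mul_of_nonneg_left (norm_integral_le_of_norm_le (h1.mul_const _)
    (Eventually.of_forall fun d => ?_)) (norm_nonneg _)
  simp only [norm_mul, Complex.norm_exp, Complex.norm_real, Real.norm_eq_abs, Real.abs_exp]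
  rw [mul_assoc, mul_assoc, mul_assoc]
  refine mul_le_mul_of_nonneg_left ?_ (norm_nonneg _)
  rw [← Real.exp_add, ← Real.exp_add, ← Real.exp_add, Real.exp_le_exp]
  have h1 : (d 0 * conj x / h).re ≤ ‖d 0‖ * ‖x‖ / h := by
    refine (Complex.re_le_norm _).trans_eq ?_
    rw [norm_div, norm_mul, Complex.norm_conj, Complex.norm_real, Real.norm_of_nonneg hh.le]
  have h1' : (y / h * conj (d 0)).re ≤ ‖y‖ * ‖d 0‖ / h := by
    refine (Complex.re_le_norm _).trans_eq ?_
    rw [norm_mul, norm_div, Complex.norm_conj, Complex.norm_real, Real.norm_of_nonneg hh.le]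
    ring
  have h2 := norm_sq_apply_le_sum d 0
  set S := ∑ j, ‖d j‖ ^ 2
  have hS : 0 ≤ S := (sq_nonneg _).trans h2
  have h3 : S / h₀ ≤ S / (4 * h) := by gcongr; linarith
  have h4 : ‖d 0‖ * ‖x‖ / h + ‖y‖ * ‖d 0‖ / h ≤ (‖x‖ + ‖y‖) ^ 2 / (3 * h) + 3 / 4 * S / h := by
    rw [show (‖x‖ + ‖y‖) ^ 2 / (3 * h) + 3 / 4 * S / h = ((‖x‖ + ‖y‖) ^ 2 / 3 + 3 / 4 * S) / h by
      field_simp, ← add_div]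
    refine div_le_div_of_nonneg_right ?_ hh.le
    nlinarith [sq_nonneg (2 * (‖x‖ + ‖y‖) - 3 * ‖d 0‖)]
  have h6 : -S / h = -(3 / 4 * S / h) - S / (4 * h) := by field_simp; ring
  have h7 : -S / h₀ = -(S / h₀) := neg_div _ _
  rw [h6, h7]
  linarith

theorem memLp_mul_integral_cexp {n : ℕ} {h h₀ h₁ : ℝ} (hh : 0 < h) (hh₀ : h ≤ h₀ / 4)
    (hh₁ : h ≤ h₁ / 4) {f g : (Fin (n + 1) → ℂ) → ℂ} (hfc : Continuous f) (hgc : Continuous g)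
    (hf : MemLp f 2 (gaussian (n + 1) h₀)) (hg : Integrable g (gaussian (n + 1) h₁)) (x : ℂ) :
    MemLp (fun d => f d * ∫ e, g e * Complex.exp (e 0 * conj x / h)
        * Complex.exp (d 0 / h * conj (e 0)) ∂(gaussian (n + 1) h)) 2 (gaussian (n + 1) h) := by
  have h0 : 0 < h₀ := by linarith
  obtain ⟨D, hD, hb⟩ := norm_integral_cexp_le hh hh₁ hg x
  refine memLp_mul_gaussian hh h0 hfc hf ?_ (C := D ^ 2 * Real.exp (6 * ‖x‖ ^ 2 / h)) fun d => ?_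
  · refine StronglyMeasurable.integral_prod_right
      (f := fun (d e : Fin (n + 1) → ℂ) => g e * Complex.exp (e 0 * conj x / h)
        * Complex.exp (d 0 / h * conj (e 0))) (Continuous.stronglyMeasurable ?_)
    simp only [Function.uncurry_def]
    fun_prop
  refine (mul_le_mul_of_nonneg_right (pow_le_pow_left₀ (norm_nonneg _) (hb (d 0)) 2)
    (Real.exp_pos _).le).trans ?_
  rw [mul_pow, ← Real.exp_nat_mul, mul_assoc, mul_assoc, ← Real.exp_add, ← Real.exp_add]
  refine mul_le_mul_of_nonneg_left (Real.exp_le_exp.mpr ?_) (by positivity)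
  have h2 := norm_sq_apply_le_sum d 0
  set S := ∑ j, ‖d j‖ ^ 2
  have hS : 0 ≤ S := (sq_nonneg _).trans h2
  have h3 : S / h₀ ≤ S / (4 * h) := by gcongr; linarith
  -- The difference of the two sides is at least (8|x| - |d_1|)²/(12h). With three quarters of the
  -- decay spent here, the last quarter is what h ≤ h₀/4 requires.
  have h4 : 2 * ((‖x‖ + ‖d 0‖) ^ 2 / (3 * h)) ≤ 6 * ‖x‖ ^ 2 / h + 3 / 4 * S / h := by
    rw [show 2 * ((‖x‖ + ‖d 0‖) ^ 2 / (3 * h)) = (2 / 3 * (‖x‖ + ‖d 0‖) ^ 2) / h by field_simp,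
      ← add_div]
    gcongr
    nlinarith [sq_nonneg (8 * ‖x‖ - ‖d 0‖)]
  have h6 : -S / h = -(3 / 4 * S / h) - S / (4 * h) := by field_simp; ring
  have h7 : -S / h₀ = -(S / h₀) := neg_div _ _
  push_cast
  rw [h6, h7]
  linarith

/-! ### Rescaling -/

theorem sum_norm_sq_vecCons_add {n : ℕ} (x : ℂ) (s : ℝ) (y : Fin (n + 1) → ℂ) :
    ((∑ j, ‖(Matrix.vecCons x (0 : Fin n → ℂ) + s • y) j‖ ^ 2 : ℝ) : ℂ)
      = x * conj x + s * (x * conj (y 0) + conj x * y 0)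
        + (s : ℂ) ^ 2 * ((∑ j, ‖y j‖ ^ 2 : ℝ) : ℂ) := by
  push_cast
  simp only [← Complex.mul_conj', Fin.sum_univ_succ, Pi.add_apply, Pi.smul_apply,
    Matrix.cons_val_zero, Matrix.cons_val_succ, Pi.zero_apply, zero_add, map_add,
    Complex.real_smul, map_mul, Complex.conj_ofReal, map_zero, mul_zero, zero_add, mul_add,
    Finset.mul_sum]
  have : ∀ i : Fin n, (s : ℂ) * y i.succ * (s * conj (y i.succ))
      = (s : ℂ) ^ 2 * (y i.succ * conj (y i.succ)) := fun i => by ring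
  simp only [this]
  ring

theorem integral_eq_integral_affine {N : ℕ} {h : ℝ} (hh : 0 < h) (p : Fin N → ℂ)
    (G : (Fin N → ℂ) → ℂ) : ∫ d, G d = (h : ℂ) ^ N * ∫ y, G (p + √h • y) := by
  rw [Measure.integral_comp_smul volume (fun y => G (p + y)), integral_add_left_eq_self]
  -- The real dimension is 2N, so scaling by √h has Jacobian h^N.
  have h1 : Module.finrank ℝ (Fin N → ℂ) = 2 * N := by
    rw [Module.finrank_pi_fintype]; simp [mul_comm]
  rw [h1, pow_mul, Real.sq_sqrt hh.le, abs_of_pos (by positivity), Complex.real_smul]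
  push_cast
  rw [← mul_assoc, mul_inv_cancel₀ (pow_ne_zero _ (by exact_mod_cast hh.ne')), one_mul]

/-- Completing the square: -|x|² + d_1 x̄ + x d̄_1 - |d|² = -|d - (x; 0)|². -/
theorem integral_toeplitz_eq {n : ℕ} {h : ℝ} (hh : 0 < h) (f : (Fin (n + 1) → ℂ) → ℂ) (x : ℂ) :
    (Real.exp (-‖x‖ ^ 2 / h) : ℂ) * ∫ d, f d * Complex.exp (d 0 * conj x / h)
        * Complex.exp (x / h * conj (d 0)) ∂(gaussian (n + 1) h)
      = ∫ y, f (Matrix.vecCons x 0 + √h • y) * heatWeight (n + 1) y := by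
  have h0 : (h : ℂ) ≠ 0 := by exact_mod_cast hh.ne'
  have hpi : (Real.pi : ℂ) ≠ 0 := by exact_mod_cast Real.pi_ne_zero
  have hs : (√h : ℂ) ^ 2 = h := by exact_mod_cast Real.sq_sqrt hh.le
  rw [integral_gaussian_eq hh, integral_eq_integral_affine hh (Matrix.vecCons x 0), ← mul_assoc,
    ← mul_assoc, ← integral_const_mul]
  refine integral_congr_ae (Eventually.of_forall fun y => ?_)
  have hS := sum_norm_sq_vecCons_add x (√h) y
  simp only [heatWeight]
  set S' := ∑ j, ‖(Matrix.vecCons x (0 : Fin n → ℂ) + √h • y) j‖ ^ 2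
  set S := ∑ j, ‖y j‖ ^ 2
  have e : (Real.exp (-‖x‖ ^ 2 / h) : ℂ) *
      (Complex.exp ((Matrix.vecCons x (0 : Fin n → ℂ) + √h • y) 0 * conj x / h)
        * Complex.exp (x / h * conj ((Matrix.vecCons x (0 : Fin n → ℂ) + √h • y) 0))
        * (Real.exp (-S' / h) : ℂ)) = (Real.exp (-S / (1 : ℝ)) : ℂ) := by
    push_cast
    rw [← Complex.exp_add, ← Complex.exp_add, ← Complex.exp_add, hS]
    congr 1
    rw [← Complex.mul_conj', hs]
    simp only [Pi.add_apply, Pi.smul_apply, Matrix.cons_val_zero, map_add, Complex.real_smul,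
      map_mul, Complex.conj_ofReal]
    field_simp
    ring
  rw [← e]
  push_cast
  rw [inv_pow, mul_pow]
  field_simp

/-- With d = (x; 0) + √h a and e = (x; 0) + √h b, the exponent -|x|² + x d̄_1 + e_1 x̄ + d_1 ē_1 -
|d|² - |e|² loses its constant and linear terms and equals h(-|a|² - |b|² + a_1 b̄_1). Keeping the
integrals iterated avoids any integrability assumption. -/
theorem integral_toeplitz_mul_eq {n : ℕ} {h : ℝ} (hh : 0 < h) (f g : (Fin (n + 1) → ℂ) → ℂ)
    (x : ℂ) :
    (Real.exp (-‖x‖ ^ 2 / h) : ℂ) * ∫ d, f d * (∫ e, g e * Complex.exp (e 0 * conj x / h)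
          * Complex.exp (d 0 / h * conj (e 0)) ∂(gaussian (n + 1) h))
        * Complex.exp (x / h * conj (d 0)) ∂(gaussian (n + 1) h)
      = ∫ a, ∫ b, f (Matrix.vecCons x 0 + √h • a) * g (Matrix.vecCons x 0 + √h • b)
          * productWeight n (a, b) := by
  have h0 : (h : ℂ) ≠ 0 := by exact_mod_cast hh.ne'
  have hpi : (Real.pi : ℂ) ≠ 0 := by exact_mod_cast Real.pi_ne_zero
  have hs : (√h : ℂ) ^ 2 = h := by exact_mod_cast Real.sq_sqrt hh.le
  rw [integral_gaussian_eq hh, integral_eq_integral_affine hh (Matrix.vecCons x 0), ← mul_assoc,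
    ← mul_assoc, ← integral_const_mul]
  refine integral_congr_ae (Eventually.of_forall fun a => ?_)
  simp only
  set d := Matrix.vecCons x (0 : Fin n → ℂ) + √h • a with hd
  have hb : ∀ b, f d * g (Matrix.vecCons x 0 + √h • b) * productWeight n (a, b)
      = ((Real.exp (-‖x‖ ^ 2 / h) : ℂ) * f d * Complex.exp (x / h * conj (d 0))
          * (Real.exp (-(∑ j, ‖d j‖ ^ 2) / h) : ℂ) * ((Real.pi : ℂ) ^ (n + 1))⁻¹
          * ((Real.pi : ℂ) ^ (n + 1))⁻¹)
        * (g (Matrix.vecCons x 0 + √h • b)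
          * Complex.exp ((Matrix.vecCons x (0 : Fin n → ℂ) + √h • b) 0 * conj x / h)
          * Complex.exp (d 0 / h * conj ((Matrix.vecCons x (0 : Fin n → ℂ) + √h • b) 0))
          * (Real.exp (-(∑ j, ‖(Matrix.vecCons x (0 : Fin n → ℂ) + √h • b) j‖ ^ 2) / h) : ℂ)) := by
    intro b
    have hSa := sum_norm_sq_vecCons_add x (√h) a
    have hSb := sum_norm_sq_vecCons_add x (√h) b
    rw [← hd] at hSa
    simp only [productWeight, heatWeight]
    set e := Matrix.vecCons x (0 : Fin n → ℂ) + √h • b with he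
    set Sd := ∑ j, ‖d j‖ ^ 2
    set Se := ∑ j, ‖e j‖ ^ 2
    set Sa := ∑ j, ‖a j‖ ^ 2
    set Sb := ∑ j, ‖b j‖ ^ 2
    have key : (Real.exp (-‖x‖ ^ 2 / h) : ℂ) * (Complex.exp (x / h * conj (d 0))
          * (Real.exp (-Sd / h) : ℂ) * (Complex.exp (e 0 * conj x / h)
          * Complex.exp (d 0 / h * conj (e 0)) * (Real.exp (-Se / h) : ℂ)))
        = (Real.exp (-Sa / (1 : ℝ)) : ℂ) * (Real.exp (-Sb / (1 : ℝ)) : ℂ)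
          * Complex.exp (a 0 * conj (b 0)) := by
      push_cast
      simp only [← Complex.exp_add]
      congr 1
      rw [← Complex.mul_conj', hSa, hSb, hs, hd, he]
      simp only [Pi.add_apply, Pi.smul_apply, Matrix.cons_val_zero, map_add, Complex.real_smul,
        map_mul, Complex.conj_ofReal]
      field_simp
      linear_combination (a 0 * conj (b 0)) * hs
    linear_combination (-(f d * g e * (((Real.pi : ℂ) ^ (n + 1))⁻¹
      * ((Real.pi : ℂ) ^ (n + 1))⁻¹))) * key
  obtain ⟨G, hG⟩ : ∃ G : (Fin (n + 1) → ℂ) → ℂ, ∀ e, g e * Complex.exp (e 0 * conj x / h)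
      * Complex.exp (d 0 / h * conj (e 0)) * (Real.exp (-(∑ j, ‖e j‖ ^ 2) / h) : ℂ) = G e :=
    ⟨_, fun e => rfl⟩
  simp only [hb, hG]
  rw [integral_const_mul, integral_gaussian_eq hh]
  simp only [hG]
  rw [integral_eq_integral_affine hh (Matrix.vecCons x 0), Complex.ofReal_mul, inv_pow, mul_pow]
  field_simp

/-! ### Integrability -/

/-- The norm is the sup norm, so |y|² ≤ N‖y‖² in Euclidean terms; a factor 2 comes from |p + y|² ≤
2|p|² + 2|y|². -/
theorem integrable_shift_mul_exp {N : ℕ} {h₀ : ℝ} (hh₀ : 0 < h₀) {f : (Fin N → ℂ) → ℂ}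
    (hc : Continuous f) (hf : Integrable f (gaussian N h₀)) (p : Fin N → ℂ) :
    Integrable fun y => f (p + y) * Real.exp (-(2 * N / h₀) * ‖y‖ ^ 2) := by
  have h1 := (((integrable_gaussian_iff hh₀ _).mp hf).comp_add_left p).norm.const_mul
    (Real.exp (2 * (∑ j, ‖p j‖ ^ 2) / h₀))
  refine h1.mono' (Continuous.aestronglyMeasurable (by fun_prop)) (Eventually.of_forall fun y => ?_)
  simp only [norm_mul, Complex.norm_real, Real.norm_eq_abs, Real.abs_exp]
  rw [mul_left_comm, ← Real.exp_add]
  gcongr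
  have h2 : ∑ j, ‖y j‖ ^ 2 ≤ N * ‖y‖ ^ 2 := by
    refine (Finset.sum_le_card_nsmul _ _ (‖y‖ ^ 2) fun j _ => ?_).trans_eq (by simp)
    gcongr
    exact norm_le_pi_norm y j
  have h3 : ∑ j, ‖(p + y) j‖ ^ 2 ≤ 2 * (∑ j, ‖p j‖ ^ 2) + 2 * ∑ j, ‖y j‖ ^ 2 := by
    rw [Finset.mul_sum, Finset.mul_sum, ← Finset.sum_add_distrib]
    refine Finset.sum_le_sum fun j _ => ?_
    have := norm_add_le (p j) (y j)
    rw [Pi.add_apply]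
    nlinarith [norm_nonneg (p j + y j), sq_nonneg (‖p j‖ - ‖y j‖)]
  rw [← add_div, neg_mul, div_mul_eq_mul_div, ← neg_div]
  gcongr
  linarith

theorem integrable_shift_prod_mul_exp {N : ℕ} {c c' : ℝ} (hc : 0 ≤ c) (hc' : 0 ≤ c')
    {f g : (Fin N → ℂ) → ℂ} (hfc : Continuous f) (hgc : Continuous g) {p : Fin N → ℂ}
    (hf : Integrable fun y => f (p + y) * Real.exp (-c * ‖y‖ ^ 2))
    (hg : Integrable fun y => g (p + y) * Real.exp (-c' * ‖y‖ ^ 2)) :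
    Integrable fun q : (Fin N → ℂ) × (Fin N → ℂ) =>
      f ((p, p) + q).1 * g ((p, p) + q).2 * Real.exp (-(c + c') * ‖q‖ ^ 2) := by
  have h1 := hf.norm.mul_prod hg.norm
  rw [← Measure.volume_eq_prod] at h1
  refine h1.mono' (Continuous.aestronglyMeasurable (by fun_prop)) (Eventually.of_forall fun q => ?_)
  simp only [norm_mul, Complex.norm_real, Real.norm_eq_abs, Real.abs_exp, Prod.fst_add,
    Prod.snd_add]
  rw [mul_mul_mul_comm, ← Real.exp_add]
  gcongr
  have h2 : ‖q.1‖ ^ 2 ≤ ‖q‖ ^ 2 := by gcongr; exact norm_fst_le q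
  have h3 : ‖q.2‖ ^ 2 ≤ ‖q‖ ^ 2 := by gcongr; exact norm_snd_le q
  nlinarith [mul_le_mul_of_nonneg_left h2 hc, mul_le_mul_of_nonneg_left h3 hc']

/-! ### Toeplitz operators on coherent states -/

theorem aestronglyMeasurable_sharp {n : ℕ} {h₀ : ℝ} (hh₀ : 0 < h₀) {f : (Fin (n + 1) → ℂ) → ℂ}
    (hφ : ∀ i j, MemLp (fun Z => sharp f Z i j) 2 (mu (n + 1) h₀)) (h : ℝ) (i j : Fin (n + 1)) :
    AEStronglyMeasurable (fun Z => sharp f Z i j) (mu (n + 1) h) :=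
  (hφ i j).aestronglyMeasurable.mono_ac (mu_absolutelyContinuous _ h hh₀)

theorem mem_domain_opMul {V : Type*} [AddCommGroup V] [Module ℂ V] {S T : V →ₗ.[ℂ] V} {u : V}
    (hT : u ∈ T.domain) (hS : T ⟨u, hT⟩ ∈ S.domain) : u ∈ (opMul S T).domain :=
  ⟨⟨u, hT⟩, hS, rfl⟩

theorem coherent_mem_toeplitz_domain {n : ℕ} {h h₀ : ℝ} (hh : 0 < h) (hh₀ : h ≤ h₀ / 4)
    {f : (Fin (n + 1) → ℂ) → ℂ} (hf : IsTailSymmetric f) (hc : Continuous f)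
    (hφ : ∀ i j, MemLp (fun Z => sharp f Z i j) 2 (mu (n + 1) h₀)) (V : UN (n + 1))
    (x : Fin (n + 1) → ℂ) (j : Fin (n + 1)) :
    coherent hh (unitaryConj V x) (colBasis V j) ∈ (toeplitz h (sharp f)).domain :=
  mem_toeplitz_domain hf (aestronglyMeasurable_sharp (by linarith) hφ h)
    (coherent_spectralAE hh (act_conjTranspose_colBasis V x j))
    (memLp_mul_cexp hh hh₀ hc (memLp_of_memLp_sharp hf hc hφ) (x j))

theorem toeplitz_coherent_spectralAE {n : ℕ} {h h₀ : ℝ} (hh : 0 < h) (hh₀ : h ≤ h₀ / 4)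
    {f : (Fin (n + 1) → ℂ) → ℂ} (hf : IsTailSymmetric f) (hc : Continuous f)
    (hφ : ∀ i j, MemLp (fun Z => sharp f Z i j) 2 (mu (n + 1) h₀)) (V : UN (n + 1))
    (x : Fin (n + 1) → ℂ) (j : Fin (n + 1)) :
    SpectralAE h (fun d => ∫ e, f e * Complex.exp (e 0 * conj (x j) / h)
        * Complex.exp (d 0 / h * conj (e 0)) ∂(gaussian (n + 1) h)) (colBasis V j)
      (toeplitz h (sharp f) ⟨_, coherent_mem_toeplitz_domain hh hh₀ hf hc hφ V x j⟩ :
        L2 (n + 1) h) :=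
  toeplitz_spectralAE hh hf (aestronglyMeasurable_sharp (by linarith) hφ h)
    (coherent_spectralAE hh (act_conjTranspose_colBasis V x j))
    (memLp_mul_cexp hh hh₀ hc (memLp_of_memLp_sharp hf hc hφ) (x j)) _

theorem berezin_toeplitz {n : ℕ} {h h₀ : ℝ} (hh : 0 < h) (hh₀ : h ≤ h₀ / 4)
    {f : (Fin (n + 1) → ℂ) → ℂ} (hf : IsTailSymmetric f) (hc : Continuous f)
    (hφ : ∀ i j, MemLp (fun Z => sharp f Z i j) 2 (mu (n + 1) h₀)) (V : UN (n + 1))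
    (x : Fin (n + 1) → ℂ) :
    berezin hh (toeplitz h (sharp f)) (unitaryConj V x)
      = (unitaryConj V fun j =>
          ∫ y, f (Matrix.vecCons (x j) 0 + √h • y) * heatWeight (n + 1) y).1 := by
  simp only [← integral_toeplitz_eq hh]
  refine berezin_unitaryConj hh _ V x _ (coherent_mem_toeplitz_domain hh hh₀ hf hc hφ V x)
    fun i j => ?_
  rw [inner_coherent_toeplitz hh hf (aestronglyMeasurable_sharp (by linarith) hφ h)
    (coherent_spectralAE hh (act_conjTranspose_colBasis V x j))
    (memLp_mul_cexp hh hh₀ hc (memLp_of_memLp_sharp hf hc hφ) (x j)) _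
    (act_conjTranspose_colBasis V x i), inner_colBasis]
  -- The pairing produces x_i where x_j is wanted. The two agree for i = j, and otherwise
  -- orthogonality of the columns annihilates both sides.
  split_ifs with hij
  · rw [hij]
  · rw [zero_mul, zero_mul]

theorem memLp_mul_toeplitz_coherent {n : ℕ} {h h₀ h₁ : ℝ} (hh : 0 < h) (hh₀ : h ≤ h₀ / 4)
    (hh₁ : h ≤ h₁ / 4) {f g : (Fin (n + 1) → ℂ) → ℂ} (hf : IsTailSymmetric f)
    (hg : IsTailSymmetric g) (hfc : Continuous f) (hgc : Continuous g)
    (hφ : ∀ i j, MemLp (fun Z => sharp f Z i j) 2 (mu (n + 1) h₀))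
    (hψ : ∀ i j, MemLp (fun Z => sharp g Z i j) 2 (mu (n + 1) h₁)) (x : ℂ) :
    MemLp (fun d => f d * ∫ e, g e * Complex.exp (e 0 * conj x / h)
        * Complex.exp (d 0 / h * conj (e 0)) ∂(gaussian (n + 1) h)) 2 (gaussian (n + 1) h) := by
  have : Fact (0 < h₁) := ⟨by linarith⟩
  exact memLp_mul_integral_cexp hh hh₀ hh₁ hfc hgc (memLp_of_memLp_sharp hf hfc hφ)
    ((memLp_of_memLp_sharp hg hgc hψ).integrable (by norm_num)) x

theorem coherent_mem_opMul_domain {n : ℕ} {h h₀ h₁ : ℝ} (hh : 0 < h) (hh₀ : h ≤ h₀ / 4)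
    (hh₁ : h ≤ h₁ / 4) {f g : (Fin (n + 1) → ℂ) → ℂ} (hf : IsTailSymmetric f)
    (hg : IsTailSymmetric g) (hfc : Continuous f) (hgc : Continuous g)
    (hφ : ∀ i j, MemLp (fun Z => sharp f Z i j) 2 (mu (n + 1) h₀))
    (hψ : ∀ i j, MemLp (fun Z => sharp g Z i j) 2 (mu (n + 1) h₁)) (V : UN (n + 1))
    (x : Fin (n + 1) → ℂ) (j : Fin (n + 1)) :
    coherent hh (unitaryConj V x) (colBasis V j)
      ∈ (opMul (toeplitz h (sharp f)) (toeplitz h (sharp g))).domain :=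
  mem_domain_opMul (coherent_mem_toeplitz_domain hh hh₁ hg hgc hψ V x j)
    (mem_toeplitz_domain hf (aestronglyMeasurable_sharp (by linarith) hφ h)
      (toeplitz_coherent_spectralAE hh hh₁ hg hgc hψ V x j)
      (memLp_mul_toeplitz_coherent hh hh₀ hh₁ hf hg hfc hgc hφ hψ (x j)))

theorem berezin_opMul {n : ℕ} {h h₀ h₁ : ℝ} (hh : 0 < h) (hh₀ : h ≤ h₀ / 4)
    (hh₁ : h ≤ h₁ / 4) {f g : (Fin (n + 1) → ℂ) → ℂ} (hf : IsTailSymmetric f)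
    (hg : IsTailSymmetric g) (hfc : Continuous f) (hgc : Continuous g)
    (hφ : ∀ i j, MemLp (fun Z => sharp f Z i j) 2 (mu (n + 1) h₀))
    (hψ : ∀ i j, MemLp (fun Z => sharp g Z i j) 2 (mu (n + 1) h₁)) (V : UN (n + 1))
    (x : Fin (n + 1) → ℂ) :
    berezin hh (opMul (toeplitz h (sharp f)) (toeplitz h (sharp g))) (unitaryConj V x)
      = (unitaryConj V fun j => ∫ a, ∫ b, f (Matrix.vecCons (x j) 0 + √h • a)
          * g (Matrix.vecCons (x j) 0 + √h • b) * productWeight n (a, b)).1 := by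
  simp only [← integral_toeplitz_mul_eq hh]
  refine berezin_unitaryConj hh _ V x _
    (coherent_mem_opMul_domain hh hh₀ hh₁ hf hg hfc hgc hφ hψ V x) fun i j => ?_
  refine (inner_coherent_toeplitz hh hf (aestronglyMeasurable_sharp (by linarith) hφ h)
    (toeplitz_coherent_spectralAE hh hh₁ hg hgc hψ V x j)
    (memLp_mul_toeplitz_coherent hh hh₀ hh₁ hf hg hfc hgc hφ hψ (x j))
    (mem_domain_of_mem_map (coherent_mem_opMul_domain hh hh₀ hh₁ hf hg hfc hgc hφ hψ V x j)).2
    (act_conjTranspose_colBasis V x i)).trans ?_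
  rw [inner_colBasis]
  split_ifs with hij
  · rw [hij]
  · rw [zero_mul, zero_mul]

/-! ### Asymptotic expansions -/

/-- The diagonalizing unitary does not depend on h and has entries of modulus at most 1, so the
errors of the eigenvalues simply add up. -/
theorem hasExpansion_of_unitaryConj {N : ℕ} {F : ∀ h : ℝ, 0 < h → Matrix (Fin N) (Fin N) ℂ}
    {a : ℕ → Matrix (Fin N) (Fin N) ℂ} (V : UN N) {c : ℝ → Fin N → ℂ} {b : ℕ → Fin N → ℂ} {ε : ℝ}
    (hε : 0 < ε) (hF : ∀ (h : ℝ) (hh : 0 < h), h < ε → F h hh = (unitaryConj V (c h)).1)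
    (ha : ∀ r, a r = (unitaryConj V (b r)).1)
    (hc : ∀ j (m : ℕ), ∃ C δ : ℝ, 0 < δ ∧ ∀ t : ℝ, 0 < t → t < δ →
      ‖c t j - ∑ r ∈ Finset.range m, (t : ℂ) ^ r * b r j‖ ≤ C * t ^ m) :
    HasExpansion F a := by
  intro m
  -- `HasExpansion` at m includes the term r = m, hence m + 1 terms.
  choose C δ hδ hC using fun j => hc j (m + 1)
  obtain ⟨δ', hδ', hle⟩ : ∃ δ' : ℝ, 0 < δ' ∧ ∀ j, δ' ≤ δ j := by
    rcases isEmpty_or_nonempty (Fin N) with hN | hN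
    · exact ⟨1, one_pos, fun j => hN.elim j⟩
    · obtain ⟨j, hj⟩ := Finite.exists_min δ
      exact ⟨δ j, hδ j, hj⟩
  refine ⟨∑ j, C j, min ε δ', lt_min hε hδ', fun h hh hlt i k => ?_⟩
  have e : F h hh i k - ∑ r ∈ Finset.range (m + 1), (h : ℂ) ^ r * a r i k
      = ∑ j, V.1 i j * (c h j - ∑ r ∈ Finset.range (m + 1), (h : ℂ) ^ r * b r j)
          * conj (V.1 k j) := by
    simp only [hF h hh (hlt.trans_le (min_le_left _ _)), ha, unitaryConj_apply, mul_sub, sub_mul,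
      Finset.sum_sub_distrib, Finset.mul_sum, Finset.sum_mul]
    rw [Finset.sum_comm]
    congr 1
    exact Finset.sum_congr rfl fun _ _ => Finset.sum_congr rfl fun _ _ => by ring
  rw [e, Finset.sum_mul]
  refine (norm_sum_le _ _).trans (Finset.sum_le_sum fun j _ => ?_)
  rw [norm_mul, norm_mul, Complex.norm_conj]
  refine (mul_le_of_le_one_right (by positivity) (norm_unitary_entry_le V k j)).trans ?_
  refine (mul_le_of_le_one_left (norm_nonneg _) (norm_unitary_entry_le V i j)).trans ?_
  exact hC j h hh (hlt.trans_le ((min_le_right _ _).trans (hle j)))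

theorem expansion_heatWeight {n : ℕ} {h₀ : ℝ} (hh₀ : 0 < h₀) {f : (Fin (n + 1) → ℂ) → ℂ}
    (hs : ContDiff ℝ ∞ f) (hf : Integrable f (gaussian (n + 1) h₀)) (x : ℂ) (m : ℕ) :
    ∃ C δ : ℝ, 0 < δ ∧ ∀ t : ℝ, 0 < t → t < δ →
      ‖(∫ y, f (Matrix.vecCons x 0 + √t • y) * heatWeight (n + 1) y)
        - ∑ r ∈ Finset.range m, (t : ℂ) ^ r * lCoeff r f x‖ ≤ C * t ^ m :=
  (heatPair_laplacian n).expansion hs (integrable_shift_mul_exp hh₀ hs.continuous hf _) m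

theorem expansion_productWeight {n : ℕ} {h₀ h₁ : ℝ} (hh₀ : 0 < h₀) (hh₁ : 0 < h₁)
    {f g : (Fin (n + 1) → ℂ) → ℂ} (hs : ContDiff ℝ ∞ f) (hs' : ContDiff ℝ ∞ g)
    (hf : Integrable f (gaussian (n + 1) h₀)) (hg : Integrable g (gaussian (n + 1) h₁)) (x : ℂ)
    (m : ℕ) :
    ∃ C δ : ℝ, 0 < δ ∧ ∀ t : ℝ, 0 < t → t < δ →
      ‖(∫ a, ∫ b, f (Matrix.vecCons x 0 + √t • a) * g (Matrix.vecCons x 0 + √t • b)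
          * productWeight n (a, b))
        - ∑ r ∈ Finset.range m, (t : ℂ) ^ r * mCoeff r f g x‖ ≤ C * t ^ m := by
  have hF : ContDiff ℝ ∞ fun q : (Fin (n + 1) → ℂ) × (Fin (n + 1) → ℂ) => f q.1 * g q.2 :=
    (hs.comp contDiff_fst).mul (hs'.comp contDiff_snd)
  have hi := integrable_shift_prod_mul_exp (by positivity) (by positivity) hs.continuous
    hs'.continuous (integrable_shift_mul_exp hh₀ hs.continuous hf (Matrix.vecCons x 0))
    (integrable_shift_mul_exp hh₁ hs'.continuous hg (Matrix.vecCons x 0))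
  -- Only the integrability part of `tail` is used, to pass by Fubini from the integral over the
  -- product space to the iterated one.
  obtain ⟨δ₁, hδ₁, hint, -⟩ := (heatPair_productOp n).tail hF.continuous hi
  obtain ⟨C, δ₂, hδ₂, hC⟩ := (heatPair_productOp n).expansion hF hi m
  refine ⟨C, min δ₁ δ₂, lt_min hδ₁ hδ₂, fun t ht hlt => ?_⟩
  have h1 := hint t ht (hlt.trans_le (min_le_left _ _))
  have h2 := hC t ht (hlt.trans_le (min_le_right _ _))
  rw [Measure.volume_eq_prod] at h1 h2
  rw [integral_prod _ h1] at h2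
  exact h2

end NormalMatrix

end

theorem mainTheorem4 (n : ℕ)
    (φ ψ : NormalMatrix.Omega (n + 1) → Matrix (Fin (n + 1)) (Fin (n + 1)) ℂ)
    (hφ : NormalMatrix.IsUInvariant φ) (hψ : NormalMatrix.IsUInvariant ψ)
    (f g : (Fin (n + 1) → ℂ) → ℂ)
    (hf : NormalMatrix.IsTailSymmetric f) (hg : NormalMatrix.IsTailSymmetric g)
    (hφf : φ = NormalMatrix.sharp f) (hψg : ψ = NormalMatrix.sharp g)
    (hf_smooth : ContDiff ℝ ∞ f) (hg_smooth : ContDiff ℝ ∞ g)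
    (hφ_int : NormalMatrix.SquareIntegrableForSome φ)
    (hψ_int : NormalMatrix.SquareIntegrableForSome ψ) :
    (∃ δ : ℝ, 0 < δ ∧ ∀ (h : ℝ) (hh : 0 < h), h < δ →
      ∀ (X : NormalMatrix.Omega (n + 1)) (χ : EuclideanSpace ℂ (Fin (n + 1))),
        NormalMatrix.coherent hh X χ ∈ (NormalMatrix.toeplitz h φ).domain ∧
        NormalMatrix.coherent hh X χ ∈
          (NormalMatrix.opMul (NormalMatrix.toeplitz h φ) (NormalMatrix.toeplitz h ψ)).domain) ∧
    (∀ X : NormalMatrix.Omega (n + 1),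
      NormalMatrix.HasExpansion
        (fun h hh => NormalMatrix.berezin hh (NormalMatrix.toeplitz h φ) X)
        (fun r => NormalMatrix.spectralSharp (NormalMatrix.lCoeff r f) X)) ∧
    (∀ X : NormalMatrix.Omega (n + 1),
      NormalMatrix.HasExpansion
        (fun h hh => NormalMatrix.berezin hh
          (NormalMatrix.opMul (NormalMatrix.toeplitz h φ) (NormalMatrix.toeplitz h ψ)) X)
        (fun r => NormalMatrix.spectralSharp (NormalMatrix.mCoeff r f g) X)) := by
  subst hφf hψg
  obtain ⟨h₀, hh₀, hφ'⟩ := hφ_int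
  obtain ⟨h₁, hh₁, hψ'⟩ := hψ_int
  have hfc := hf_smooth.continuous
  have hgc := hg_smooth.continuous
  -- Below this threshold the Gaussian estimates hold for both symbols, uniformly in X and χ.
  have hε : 0 < min (h₀ / 4) (h₁ / 4) := by positivity
  have : Fact (0 < h₀) := ⟨hh₀⟩
  have : Fact (0 < h₁) := ⟨hh₁⟩
  have hfi := (NormalMatrix.memLp_of_memLp_sharp hf hfc hφ').integrable (by norm_num)
  have hgi := (NormalMatrix.memLp_of_memLp_sharp hg hgc hψ').integrable (by norm_num)
  refine ⟨⟨_, hε, fun h hh hlt X χ => ?_⟩, fun X => ?_, fun X => ?_⟩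
  all_goals obtain ⟨V, x, rfl⟩ := NormalMatrix.exists_unitaryConj X
  · have h0 := (hlt.trans_le (min_le_left _ _)).le
    have h1 := (hlt.trans_le (min_le_right _ _)).le
    exact ⟨NormalMatrix.coherent_mem_of_colBasis hh V
        (NormalMatrix.coherent_mem_toeplitz_domain hh h0 hf hfc hφ' V x) χ,
      NormalMatrix.coherent_mem_of_colBasis hh V
        (NormalMatrix.coherent_mem_opMul_domain hh h0 h1 hf hg hfc hgc hφ' hψ' V x) χ⟩
  · exact NormalMatrix.hasExpansion_of_unitaryConj V hε
      (fun h hh hlt => NormalMatrix.berezin_toeplitz hh (hlt.trans_le (min_le_left _ _)).le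
        hf hfc hφ' V x)
      (fun r => NormalMatrix.spectralSharp_unitaryConj _ V x)
      (fun j m => NormalMatrix.expansion_heatWeight hh₀ hf_smooth hfi (x j) m)
  · exact NormalMatrix.hasExpansion_of_unitaryConj V hε
      (fun h hh hlt => NormalMatrix.berezin_opMul hh (hlt.trans_le (min_le_left _ _)).le
        (hlt.trans_le (min_le_right _ _)).le hf hg hfc hgc hφ' hψ' V x)
      (fun r => NormalMatrix.spectralSharp_unitaryConj _ V x)
      (fun j m => NormalMatrix.expansion_productWeight hh₀ hh₁ hf_smooth hg_smooth hfi hgi (x j) m)
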